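/- Let $\mathbb K$ be an algebraically closed field of characteristic $0$ and let $(\mathcal G,*)$ be a finite-dimensional (left) pre-Lie algebra over $\mathbb K$, i.e. $(x*y)*z-x*(y*z)$ is symmetric in $x,y$. Let $\mathcal G=\mathfrak g_1\oplus\mathfrak g_2$ be a decomposition into two subspaces such that $\mathfrak g_2$ is a subalgebra (then $(\mathcal G,\mathfrak g_1,\mathfrak g_2)$ is called a quasi-twilled pre-Lie algebra). For $X,Y\in\mathcal G$ write $X=(x,u)$, $Y=(y,v)$ with $x,y\in\mathfrak g_1$, $u,v\in\mathfrak g_2$, and write $(\cdot)_1,(\cdot)_2$ for the projections of $\mathcal G$ onto $\mathfrak g_1,\mathfrak g_2$. Define bilinear maps on $\mathcal G$ by $$\hat\phi_1(X,Y)=(0,(x*y)_2),\quad \hat\mu_1(X,Y)=((x*y)_1,(x*v)_2+(u*y)_2),\quad \hat\mu_2(X,Y)=((x*v)_1+(u*y)_1,(u*v)_2).$$ For vector spaces $V,W$ and $n\ge 1$ let $C^n(V,W)=\mathrm{Hom}(\wedge^{n-1}V\otimes V,W)$ and $C^*(V,W)=\bigoplus_{n\ge1}C^n(V,W)$. For $P\in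 C^{p+1}(V,V)$, $Q\in C^{q+1}(V,V)$ the Matsushima–Nijenhuis bracket is $[P,Q]^{MN}=P\diamond Q-(-1)^{pq}Q\diamond P\in C^{p+q+1}(V,V)$, where $$\begin{aligned}(P\diamond Q)(x_1,\dots,x_{p+q+1})={}&\sum_{\sigma\in \mathbb S_{(q,1,p-1)}}\mathrm{sgn}(\sigma)\,P\big(Q(x_{\sigma(1)},\dots,x_{\sigma(q+1)}),x_{\sigma(q+2)},\dots,x_{\sigma(p+q)},x_{p+q+1}\big)\\&+(-1)^{pq}\sum_{\sigma\in \mathbb S_{(p,q)}}\mathrm{sgn}(\sigma)\,P\big(x_{\sigma(1)},\dots,x_{\sigma(p)},Q(x_{\sigma(p+1)},\dots,x_{\sigma(p+q)},x_{p+q+1})\big);\end{aligned}$$ here $\mathbb S_{(i_1,\dots,i_k)}$ is the set of $(i_1,\dots,i_k)$-unshuffles (permutations of $\{1,\dots,i_1+\dots+i_k\}$ increasing on each of the consecutive blocks of lengths $i_1,\dots,i_k$), and the first sum is absent for $p=0$. The lift $\hat f\in C^n(\mathcal G,\mathcal G)$ of $f\in C^n(\mathfrak g_2,\mathfrak g_1)$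 is $\hat f((x_1,v_1),\dots,(x_n,v_n))=(f(v_1,\dots,v_n),0)$; lifting identifies $C^*(\mathfrak g_2,\mathfrak g_1)$ with a subspace of $C^*(\mathcal G,\mathcal G)$. An $L_\infty$-algebra is a graded vector space $E$ with multilinear operations $l_k$ ($k\ge1$) of $k$ arguments and degree $2-k$ that are graded skew-symmetric, $l_k(x_{\sigma(1)},\dots,x_{\sigma(k)})=\chi(\sigma)\,l_k(x_1,\dots,x_k)$, and satisfy for all $n\ge1$ and homogeneous $x_1,\dots,x_n$ $$\sum_{i+j=n+1,\ i,j\ge 1}(-1)^i\sum_{\sigma\in \mathbb S_{(i,n-i)}}\chi(\sigma)\,l_j\big(l_i(x_{\sigma(1)},\dots,x_{\sigma(i)}),x_{\sigma(i+1)},\dots,x_{\sigma(n)}\big)=0,$$ where $\chi(\sigma)$ is the sign with $x_{\sigma(1)}\wedge\dots\wedge x_{\sigma(n)}=\chi(\sigma)\,x_1\wedge\dots\wedge x_n$ under the rule $u\wedge v=-(-1)^{|u||v|}v\wedge u$. Theorem. The formulas $$d_{\hat\mu_2}(f_1)=[\hat\mu_2,\hat f_1]^{MN},\qquad [f_1,f_2]_{\hat\mu_1}=(-1)^{m-1}\big[[\hat\mu_1,\hat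 f_1]^{MN},\hat f_2\big]^{MN},$$ $$[f_1,f_2,f_3]_{\hat\phi_1}=(-1)^{n-1}\big[\big[[\hat\phi_1,\hat f_1]^{MN},\hat f_2\big]^{MN},\hat f_3\big]^{MN},$$ for $f_1\in C^m(\mathfrak g_2,\mathfrak g_1)$, $f_2\in C^n(\mathfrak g_2,\mathfrak g_1)$, $f_3\in C^k(\mathfrak g_2,\mathfrak g_1)$, define operations on $C^*(\mathfrak g_2,\mathfrak g_1)$ (their right-hand sides are lifts of elements of $C^{m+1}$, $C^{m+n}$ and $C^{m+n+k-1}(\mathfrak g_2,\mathfrak g_1)$, respectively). With $C^m(\mathfrak g_2,\mathfrak g_1)$ placed in degree $m$, $l_1=d_{\hat\mu_2}$, $l_2=[-,-]_{\hat\mu_1}$, $l_3=[-,-,-]_{\hat\phi_1}$ and $l_k=0$ for $k\ge4$, the graded vector space $C^*(\mathfrak g_2,\mathfrak g_1)$ is an $L_\infty$-algebra. -/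

import Mathlib

open scoped DirectSum

/-! ### Unshuffles -/

/-- Let `b` be a weakly increasing function on `{0, …, n - 1}`; it cuts this set into consecutive
blocks. The unshuffles for this block decomposition are the permutations that are increasing on
each block. -/
def unshuffles {n : ℕ} (b : Fin n → ℕ) : Finset (Equiv.Perm (Fin n)) :=
  Finset.univ.filter fun σ => ∀ i j, i < j → b i = b j → σ i < σ j

/-- Two consecutive blocks, of lengths `p` and `n - p`. -/
def twoBlocks (p : ℕ) {n : ℕ} (a : Fin n) : ℕ := if a.val < p then 0 else 1

/-- Three consecutive blocks, of lengths `q`, `1` and `n - q - 1`. -/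
def threeBlocks (q : ℕ) {n : ℕ} (a : Fin n) : ℕ :=
  if a.val < q then 0 else if a.val = q then 1 else 2

theorem twoBlocks_monotone (p : ℕ) {n : ℕ} : Monotone (twoBlocks p : Fin n → ℕ) := by
  intro i j hij
  have : i.val ≤ j.val := hij
  unfold twoBlocks
  split_ifs <;> omega

theorem threeBlocks_monotone (q : ℕ) {n : ℕ} : Monotone (threeBlocks q : Fin n → ℕ) := by
  intro i j hij
  have : i.val ≤ j.val := hij
  unfold threeBlocks
  split_ifs <;> omega

theorem exists_mul_mem_unshuffles {n : ℕ} {b : Fin n → ℕ} (hb : Monotone b)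
    (τ : Equiv.Perm (Fin n)) :
    ∃ k : Equiv.Perm (Fin n), (∀ a, b (k a) = b a) ∧ τ * k ∈ unshuffles b := by
  let g : Fin n → ℕ ×ₗ Fin n := fun a => toLex (b a, τ a)
  have hs : Monotone (g ∘ Tuple.sort g) := Tuple.monotone_sort g
  have h1 : Monotone (b ∘ Tuple.sort g) := fun i j hij =>
    Prod.Lex.monotone_fst _ _ (hs hij)
  have h2 : b ∘ Tuple.sort g = b ∘ (Equiv.refl (Fin n) : Equiv.Perm (Fin n)) :=
    Tuple.unique_monotone h1 hb
  have h3 : ∀ a, b (Tuple.sort g a) = b a := fun a => congrFun h2 a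
  refine ⟨Tuple.sort g, h3, ?_⟩
  simp only [unshuffles, Finset.mem_filter, Finset.mem_univ, true_and, Equiv.Perm.mul_apply]
  intro i j hij hbij
  have hle := hs hij.le
  rw [Function.comp_apply, Function.comp_apply, Prod.Lex.le_iff] at hle
  have hne : τ (Tuple.sort g i) ≠ τ (Tuple.sort g j) := fun h =>
    hij.ne ((Tuple.sort g).injective (τ.injective h))
  rcases hle with h | h
  · exact absurd h (by simp [g, h3, hbij])
  · exact lt_of_le_of_ne h.2 hne

theorem eq_of_mul_mem_unshuffles {n : ℕ} {b : Fin n → ℕ} (hb : Monotone b)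
    {τ k l : Equiv.Perm (Fin n)} (hk : ∀ a, b (k a) = b a) (hl : ∀ a, b (l a) = b a)
    (h1 : τ * k ∈ unshuffles b) (h2 : τ * l ∈ unshuffles b) : k = l := by
  let g : Fin n → ℕ ×ₗ Fin n := fun a => toLex (b a, τ a)
  have mono : ∀ m : Equiv.Perm (Fin n), (∀ a, b (m a) = b a) → τ * m ∈ unshuffles b →
      Monotone (g ∘ m) := by
    intro m hm hu i j hij
    rcases hij.eq_or_lt with rfl | hlt
    · exact le_rfl
    rw [Function.comp_apply, Function.comp_apply, Prod.Lex.le_iff]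
    rcases (hb hij).eq_or_lt with h | h
    · right
      simp only [unshuffles, Finset.mem_filter, Finset.mem_univ, true_and] at hu
      exact ⟨by simp [g, hm, h], (hu i j hlt h).le⟩
    · left
      simpa [g, hm] using h
  have := Tuple.unique_monotone (mono k hk h1) (mono l hl h2)
  ext a
  have h := congrFun this a
  simp only [g, Function.comp_apply, EmbeddingLike.apply_eq_iff_eq, Prod.mk.injEq] at h
  rw [h.2]

section UnshuffleSum

variable {K V W : Type*} [CommRing K] [AddCommGroup V] [Module K V] [AddCommGroup W] [Module K W]

/-- A multilinear map is block alternating if it vanishes when two arguments in the same block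
agree. -/
def IsBlockAlternating {n : ℕ} (b : Fin n → ℕ) (F : MultilinearMap K (fun _ : Fin n => V) W) :
    Prop :=
  ∀ (v : Fin n → V) (i j : Fin n), v i = v j → i ≠ j → b i = b j → F v = 0

theorem IsBlockAlternating.map_swap {n : ℕ} {b : Fin n → ℕ}
    {F : MultilinearMap K (fun _ : Fin n => V) W} (hF : IsBlockAlternating b F)
    (v : Fin n → V) {i j : Fin n} (hij : i ≠ j) (h : b i = b j) :
    F (fun a => v (Equiv.swap i j a)) = -F v := by
  have key := hF (Function.update (Function.update v i (v i + v j)) j (v i + v j)) i j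
    (by simp [Function.update_of_ne hij]) hij h
  have e1 : Function.update (Function.update v i (v i)) j (v j) = v := by simp
  have e2 : Function.update (Function.update v i (v j)) j (v i) =
      fun a => v (Equiv.swap i j a) := by
    funext a
    by_cases ha : a = j
    · subst ha; simp
    · by_cases hi : a = i
      · subst hi; simp [Function.update_of_ne ha]
      · simp [Function.update_of_ne ha, Function.update_of_ne hi, Equiv.swap_apply_of_ne_of_ne hi ha]
  have z1 : F (Function.update (Function.update v i (v i)) j (v i)) = 0 :=
    hF _ i j (by simp [Function.update_of_ne hij]) hij h
  have z2 : F (Function.update (Function.update v i (v j)) j (v j)) = 0 :=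
    hF _ i j (by simp [Function.update_of_ne hij]) hij h
  have add_left : ∀ y y' z : V, F (Function.update (Function.update v i (y + y')) j z) =
      F (Function.update (Function.update v i y) j z) +
        F (Function.update (Function.update v i y') j z) := by
    intro y y' z
    rw [Function.update_comm hij (y + y') z v, F.map_update_add, Function.update_comm hij y z v,
      Function.update_comm hij y' z v]
  rw [F.map_update_add, add_left, add_left] at key
  rw [e1, e2, z1, z2] at key
  rw [eq_neg_iff_add_eq_zero]
  simpa [add_comm] using key

theorem IsBlockAlternating.map_perm {n : ℕ} {b : Fin n → ℕ}
    {F : MultilinearMap K (fun _ : Fin n => V) W} (hF : IsBlockAlternating b F)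
    (k : Equiv.Perm (Fin n)) (hk : ∀ a, b (k a) = b a) (v : Fin n → V) :
    F (fun a => v (k a)) = Equiv.Perm.sign k • F v := by
  induction hm : k.support.card using Nat.strong_induction_on generalizing k v with
  | _ m ih =>
    by_cases h1 : k = 1
    · subst h1; simp
    obtain ⟨x, hx⟩ : ∃ x, k x ≠ x := by
      by_contra! hcon
      exact h1 (Equiv.ext hcon)
    have hcard := Equiv.Perm.card_support_swap_mul hx
    have hk' : ∀ a, b ((Equiv.swap x (k x) * k) a) = b a := by
      intro a
      rw [Equiv.Perm.mul_apply, ← hk a]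
      by_cases e1 : k a = x
      · rw [e1, Equiv.swap_apply_left, hk]
      by_cases e2 : k a = k x
      · rw [e2, Equiv.swap_apply_right, hk]
      rw [Equiv.swap_apply_of_ne_of_ne e1 e2]
    have h := ih _ (hm ▸ hcard) (Equiv.swap x (k x) * k) hk'
      (fun a => v (Equiv.swap x (k x) a)) rfl
    simp only [Equiv.Perm.mul_apply, Equiv.swap_apply_self] at h
    rw [h, hF.map_swap v (Ne.symm hx) (hk x).symm, Equiv.Perm.sign_mul,
      Equiv.Perm.sign_swap (Ne.symm hx)]
    simp

/-- The signed sum `∑ sgn(σ) F(v_{σ(1)}, …, v_{σ(n)})` over all unshuffles of the block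
decomposition `b`, for a multilinear map `F` that is alternating in each block. -/
def unshuffleSum {n : ℕ} (b : Fin n → ℕ) (hb : Monotone b)
    (F : MultilinearMap K (fun _ : Fin n => V) W) (hF : IsBlockAlternating b F) :
    V [⋀^Fin n]→ₗ[K] W :=
  { (∑ σ ∈ unshuffles b, Equiv.Perm.sign σ • F.domDomCongr σ :
      MultilinearMap K (fun _ : Fin n => V) W) with
    map_eq_zero_of_eq' := by
      intro v i j hv hij
      choose k hk hu using fun τ : Equiv.Perm (Fin n) => exists_mul_mem_unshuffles hb τ
      have hswap : ∀ a, v (Equiv.swap i j a) = v a := by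
        intro a
        by_cases hi : a = i
        · subst hi; simp [hv]
        by_cases hj : a = j
        · subst hj; simp [hv]
        rw [Equiv.swap_apply_of_ne_of_ne hi hj]
      change (∑ σ ∈ unshuffles b, Equiv.Perm.sign σ • F.domDomCongr σ :
        MultilinearMap K (fun _ : Fin n => V) W) v = 0
      rw [sum_apply]
      refine Finset.sum_involution
        (fun σ _ => Equiv.swap i j * σ * k (Equiv.swap i j * σ)) ?_ ?_ ?_ ?_
      · intro σ _
        have e : (fun a => v ((Equiv.swap i j * σ * k (Equiv.swap i j * σ)) a)) =
            fun a => (fun c => v (σ c)) (k (Equiv.swap i j * σ) a) := by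
          funext a
          simp [hswap]
        simp only [smul_apply, MultilinearMap.domDomCongr_apply]
        rw [e, hF.map_perm _ (hk _) (fun c => v (σ c)), smul_smul]
        simp only [Equiv.Perm.sign_mul, Equiv.Perm.sign_swap hij]
        rw [mul_assoc, Int.units_mul_self]
        simp
      · intro σ _ hne heq
        apply hne
        have hkσ : k (Equiv.swap i j * σ) = σ⁻¹ * Equiv.swap i j * σ := by
          have h := congrArg (fun t => σ⁻¹ * Equiv.swap i j * t) heq
          simpa [mul_assoc] using h
        have hb' : b (σ⁻¹ j) = b (σ⁻¹ i) := by
          have h := hk (Equiv.swap i j * σ) (σ⁻¹ i)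
          rw [hkσ] at h
          simpa using h
        simp only [smul_apply, MultilinearMap.domDomCongr_apply]
        rw [hF (fun a => v (σ a)) (σ⁻¹ i) (σ⁻¹ j) (by simpa using hv)
          (fun h => hij (σ⁻¹.injective h)) hb'.symm, smul_zero]
      · intro σ _
        exact hu _
      · intro σ hσ
        have hmem := hu (Equiv.swap i j * (Equiv.swap i j * σ * k (Equiv.swap i j * σ)))
        have e1 : Equiv.swap i j * (Equiv.swap i j * σ * k (Equiv.swap i j * σ)) =
            σ * k (Equiv.swap i j * σ) := by
          simp [← mul_assoc]
        have hkk := eq_of_mul_mem_unshuffles hb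
          (τ := σ) (k := k (Equiv.swap i j * σ) * k (σ * k (Equiv.swap i j * σ))) (l := 1)
          (fun a => by rw [Equiv.Perm.mul_apply, hk, hk]) (fun a => rfl)
          (by rw [e1] at hmem; simpa [mul_assoc] using hmem) (by simpa using hσ)
        change Equiv.swap i j * (Equiv.swap i j * σ * k (Equiv.swap i j * σ)) *
          k (Equiv.swap i j * (Equiv.swap i j * σ * k (Equiv.swap i j * σ))) = σ
        rw [e1, mul_assoc, hkk, mul_one] }

theorem unshuffleSum_apply {n : ℕ} (b : Fin n → ℕ) (hb : Monotone b)
    (F : MultilinearMap K (fun _ : Fin n => V) W) (hF : IsBlockAlternating b F) (v : Fin n → V) :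
    unshuffleSum b hb F hF v =
      ∑ σ ∈ unshuffles b, Equiv.Perm.sign σ • F (fun a => v (σ a)) := by
  change (∑ σ ∈ unshuffles b, Equiv.Perm.sign σ • F.domDomCongr σ :
    MultilinearMap K (fun _ : Fin n => V) W) v = _
  simp

end UnshuffleSum

/-! ### Cochains and the Matsushima–Nijenhuis bracket -/

/-- `PreLieCochain K V W p` is `C^{p+1}(V, W) = Hom(⋀^p V ⊗ V, W)`: the maps of `p + 1` arguments
that are multilinear and alternating in the first `p` of them. The last argument is written
separately. -/
abbrev PreLieCochain (K V W : Type*) [CommRing K] [AddCommGroup V] [Module K V]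
    [AddCommGroup W] [Module K W] (p : ℕ) : Type _ :=
  V [⋀^Fin p]→ₗ[K] (V →ₗ[K] W)

namespace PreLieCochain

section Bracket

variable {K V : Type*} [CommRing K] [AddCommGroup V] [Module K V]

/-- `P(Q(x₁, …, x_q, x_{q+1}), x_{q+2}, …, x_{p+q}, z)` for `P ∈ C^{p+1}(V, V)` and
`Q ∈ C^{q+1}(V, V)`, where `p = s + 1`, as a function of `x` with values in the linear maps
in `z`. -/
def insertFirst {s q : ℕ} (P : PreLieCochain K V V (s + 1)) (Q : PreLieCochain K V V q) :
    MultilinearMap K (fun _ : Fin (s + 1 + q) => V) (V →ₗ[K] V) where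
  toFun x := P (Fin.cons
    (Q (fun a : Fin q => x ⟨a, by omega⟩) (x ⟨q, by omega⟩))
    (fun c : Fin s => x ⟨q + 1 + c, by omega⟩))
  map_update_add' := by
    intro inst x i y z
    obtain rfl := Subsingleton.elim inst (instDecidableEqFin _)
    exact ((MultilinearMap.uncurrySum (P.toMultilinearMap.curryLeft.compMultilinearMap
      Q.toMultilinearMap.uncurryRight)).domDomCongr
      (finSumFinEquiv.trans (finCongr (by omega : q + 1 + s = s + 1 + q)))).map_update_add x i y z
  map_update_smul' := by
    intro inst x i c y
    obtain rfl := Subsingleton.elim inst (instDecidableEqFin _)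
    exact ((MultilinearMap.uncurrySum (P.toMultilinearMap.curryLeft.compMultilinearMap
      Q.toMultilinearMap.uncurryRight)).domDomCongr
      (finSumFinEquiv.trans (finCongr (by omega : q + 1 + s = s + 1 + q)))).map_update_smul x i c y

/-- `P(x₁, …, x_p, Q(x_{p+1}, …, x_{p+q}, z))` for `P ∈ C^{p+1}(V, V)` and `Q ∈ C^{q+1}(V, V)`,
as a function of `x` with values in the linear maps in `z`. -/
def insertLast {p q : ℕ} (P : PreLieCochain K V V p) (Q : PreLieCochain K V V q) :
    MultilinearMap K (fun _ : Fin (p + q) => V) (V →ₗ[K] V) where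
  toFun x := P (fun a : Fin p => x ⟨a, by omega⟩) ∘ₗ Q (fun c : Fin q => x ⟨p + c, by omega⟩)
  map_update_add' := by
    intro inst x i y z
    obtain rfl := Subsingleton.elim inst (instDecidableEqFin _)
    exact (((LinearMap.mul' K (Module.End K V)).compMultilinearMap
      (P.toMultilinearMap.domCoprod Q.toMultilinearMap)).domDomCongr
      finSumFinEquiv).map_update_add x i y z
  map_update_smul' := by
    intro inst x i c y
    obtain rfl := Subsingleton.elim inst (instDecidableEqFin _)
    exact (((LinearMap.mul' K (Module.End K V)).compMultilinearMap
      (P.toMultilinearMap.domCoprod Q.toMultilinearMap)).domDomCongr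
      finSumFinEquiv).map_update_smul x i c y

theorem insertFirst_isBlockAlternating {s q : ℕ} (P : PreLieCochain K V V (s + 1))
    (Q : PreLieCochain K V V q) : IsBlockAlternating (threeBlocks q) (insertFirst P Q) := by
  intro v i j hv hij hb
  change P (Fin.cons
    (Q (fun a : Fin q => v ⟨a, by omega⟩) (v ⟨q, by omega⟩))
    (fun c : Fin s => v ⟨q + 1 + c, by omega⟩)) = 0
  have hij' : i.val ≠ j.val := fun h => hij (Fin.ext h)
  by_cases hi : i.val < q
  · have hj : j.val < q := by
      unfold threeBlocks at hb
      split_ifs at hb <;> omega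
    have hQ : Q (fun a : Fin q => v ⟨a, by omega⟩) = 0 :=
      Q.map_eq_zero_of_eq _ (i := ⟨i, hi⟩) (j := ⟨j, hj⟩) hv (fun h => hij' (by simpa using h))
    exact P.map_coord_zero 0 (by rw [Fin.cons_zero, hQ, LinearMap.zero_apply])
  · have hi' : q + 1 ≤ i.val := by
      unfold threeBlocks at hb
      split_ifs at hb <;> omega
    have hj' : q + 1 ≤ j.val := by
      unfold threeBlocks at hb
      split_ifs at hb <;> omega
    refine P.map_eq_zero_of_eq _ (i := Fin.succ ⟨i - (q + 1), by omega⟩)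
      (j := Fin.succ ⟨j - (q + 1), by omega⟩) ?_ ?_
    · rw [Fin.cons_succ, Fin.cons_succ]
      convert hv using 2 <;> (ext; simp; omega)
    · intro h
      have := congrArg Fin.val h
      simp only [Fin.val_succ] at this
      omega

theorem insertLast_isBlockAlternating {p q : ℕ} (P : PreLieCochain K V V p)
    (Q : PreLieCochain K V V q) : IsBlockAlternating (twoBlocks p) (insertLast P Q) := by
  intro v i j hv hij hb
  change P (fun a : Fin p => v ⟨a, by omega⟩) ∘ₗ Q (fun c : Fin q => v ⟨p + c, by omega⟩) = 0
  have hij' : i.val ≠ j.val := fun h => hij (Fin.ext h)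
  by_cases hi : i.val < p
  · have hj : j.val < p := by
      unfold twoBlocks at hb
      split_ifs at hb <;> omega
    rw [P.map_eq_zero_of_eq (fun a : Fin p => v ⟨a, by omega⟩) (i := ⟨i, hi⟩) (j := ⟨j, hj⟩) hv
      (fun h => hij' (by simpa using h)), LinearMap.zero_comp]
  · have hj : p ≤ j.val := by
      unfold twoBlocks at hb
      split_ifs at hb <;> omega
    rw [Q.map_eq_zero_of_eq (fun c : Fin q => v ⟨p + c, by omega⟩) (i := ⟨i - p, by omega⟩)
      (j := ⟨j - p, by omega⟩) ?_ ?_, LinearMap.comp_zero]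
    · convert hv using 2 <;> (ext; simp; omega)
    · intro h
      have := congrArg Fin.val h
      simp only at this
      omega

/-- The first sum in the product `P ⋄ Q`, over the `(q, 1, p - 1)`-unshuffles; it is empty for
`p = 0`. -/
def diamondFirst : {p q : ℕ} → PreLieCochain K V V p → PreLieCochain K V V q →
    PreLieCochain K V V (p + q)
  | 0, _, _, _ => 0
  | _ + 1, q, P, Q => unshuffleSum (threeBlocks q) (threeBlocks_monotone q) (insertFirst P Q)
      (insertFirst_isBlockAlternating P Q)

/-- The second sum in the product `P ⋄ Q`, over the `(p, q)`-unshuffles. -/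
def diamondLast {p q : ℕ} (P : PreLieCochain K V V p) (Q : PreLieCochain K V V q) :
    PreLieCochain K V V (p + q) :=
  unshuffleSum (twoBlocks p) (twoBlocks_monotone p) (insertLast P Q)
    (insertLast_isBlockAlternating P Q)

/-- The product `P ⋄ Q ∈ C^{p+q+1}(V, V)` of `P ∈ C^{p+1}(V, V)` and `Q ∈ C^{q+1}(V, V)`. -/
def diamond {p q : ℕ} (P : PreLieCochain K V V p) (Q : PreLieCochain K V V q) :
    PreLieCochain K V V (p + q) :=
  diamondFirst P Q + (-1 : K) ^ (p * q) • diamondLast P Q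

theorem diamond_apply_succ {s q : ℕ} (P : PreLieCochain K V V (s + 1)) (Q : PreLieCochain K V V q)
    (x : Fin (s + 1 + q) → V) (z : V) :
    diamond P Q x z =
      ∑ σ ∈ unshuffles (threeBlocks q), Equiv.Perm.sign σ •
        P (Fin.cons (Q (fun a : Fin q => x (σ ⟨a, by omega⟩)) (x (σ ⟨q, by omega⟩)))
          (fun c : Fin s => x (σ ⟨q + 1 + c, by omega⟩))) z +
      (-1 : K) ^ ((s + 1) * q) • ∑ σ ∈ unshuffles (twoBlocks (s + 1)), Equiv.Perm.sign σ •
        P (fun a : Fin (s + 1) => x (σ ⟨a, by omega⟩))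
          (Q (fun c : Fin q => x (σ ⟨s + 1 + c, by omega⟩)) z) := by
  simp only [diamond, diamondFirst, diamondLast, AlternatingMap.add_apply,
    AlternatingMap.smul_apply, unshuffleSum_apply, LinearMap.add_apply, LinearMap.smul_apply,
    LinearMap.sum_apply]
  rfl

/-- The Matsushima–Nijenhuis bracket `[P, Q] = P ⋄ Q - (-1)^{pq} Q ⋄ P` of `P ∈ C^{p+1}(V, V)` and
`Q ∈ C^{q+1}(V, V)`. -/
def mnBracket {p q : ℕ} (P : PreLieCochain K V V p) (Q : PreLieCochain K V V q) :
    PreLieCochain K V V (p + q) :=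
  diamond P Q - (-1 : K) ^ (p * q) •
    (diamond Q P).domDomCongr (finCongr (Nat.add_comm q p))

end Bracket

/-- A bilinear product on `V` as an element of `C²(V, V) = Hom(V ⊗ V, V)`. -/
def ofBilin {K V : Type*} [CommRing K] [AddCommGroup V] [Module K V] (m : V →ₗ[K] V →ₗ[K] V) :
    PreLieCochain K V V 1 :=
  AlternatingMap.ofSubsingleton K V (V →ₗ[K] V) (0 : Fin 1) m

/-! ### The graded space `C*(V, W)` -/

/-- The total space `C*(V, W) = ⨁_{m ≥ 1} C^m(V, W)`; the summand with index `p` is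
`C^{p+1}(V, W)`. -/
abbrev Total (K V W : Type*) [CommRing K] [AddCommGroup V] [Module K V]
    [AddCommGroup W] [Module K W] : Type _ :=
  ⨁ p : ℕ, PreLieCochain K V W p

/-- An element of `C^{p+1}(V, W)` as an element of `C*(V, W)`. -/
def toTotal {K V W : Type*} [CommRing K] [AddCommGroup V] [Module K V]
    [AddCommGroup W] [Module K W] {p : ℕ} (f : PreLieCochain K V W p) : Total K V W :=
  DirectSum.lof K ℕ (fun p => PreLieCochain K V W p) p f

/-- The grading of `C*(V, W)` in which `C^m(V, W)` has degree `m`. -/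
def grading (K V W : Type*) [CommRing K] [AddCommGroup V] [Module K V]
    [AddCommGroup W] [Module K W] (m : ℤ) : Submodule K (Total K V W) where
  carrier := {f | ∀ p : ℕ, f p ≠ 0 → (p : ℤ) + 1 = m}
  zero_mem' := fun _ h => absurd rfl h
  add_mem' := by
    intro f g hf hg p hp
    by_contra hne
    have h1 : f p = 0 := by_contra fun h => hne (hf p h)
    have h2 : g p = 0 := by_contra fun h => hne (hg p h)
    exact hp (by rw [DirectSum.add_apply, h1, h2, add_zero])
  smul_mem' := by
    intro c f hf p hp
    refine hf p fun h => hp ?_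
    rw [DirectSum.smul_apply, h, smul_zero]

/-! ### Lifts -/

section Lift

variable {K G : Type*} [CommRing K] [AddCommGroup G] [Module K G] {g₁ g₂ : Submodule K G}

/-- The lift `f̂ ∈ C^{p+1}(G, G)` of `f ∈ C^{p+1}(g₂, g₁)` for `G = g₁ ⊕ g₂`: it applies `f` to the
`g₂`-components of its arguments. -/
noncomputable def lift (h : IsCompl g₁ g₂) (p : ℕ) :
    PreLieCochain K g₂ g₁ p →ₗ[K] PreLieCochain K G G p where
  toFun f := ((g₁.subtype.compRight K).comp
    (LinearMap.lcomp K g₁ (g₂.projectionOnto g₁ h.symm))).compAlternatingMap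
      (f.compLinearMap (g₂.projectionOnto g₁ h.symm))
  map_add' f f' := by ext; simp
  map_smul' c f := by ext; simp

theorem lift_apply (h : IsCompl g₁ g₂) (p : ℕ) (f : PreLieCochain K g₂ g₁ p) (x : Fin p → G)
    (z : G) :
    lift h p f x z =
      (f (fun i => g₂.projectionOnto g₁ h.symm (x i)) (g₂.projectionOnto g₁ h.symm z) : G) :=
  rfl

/-- The lift as a map from `C*(g₂, g₁)` to `C*(G, G)`. -/
noncomputable def liftTotal (h : IsCompl g₁ g₂) : Total K g₂ g₁ →ₗ[K] Total K G G :=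
  DirectSum.lmap (fun p => lift h p)

end Lift

end PreLieCochain

/-! ### Quasi-twilled pre-Lie algebras -/

section QuasiTwilled

variable {K G : Type*} [CommRing K] [LeftPreLieRing G] [LeftPreLieAlgebra K G]

/-- For a pre-Lie algebra `G` that is the direct sum of subspaces `g₁` and `g₂`, the triple
`(G, g₁, g₂)` is a quasi-twilled pre-Lie algebra if `g₂` is a subalgebra. -/
structure IsQuasiTwilled (g₁ g₂ : Submodule K G) : Prop where
  isCompl : IsCompl g₁ g₂
  mul_mem : ∀ u ∈ g₂, ∀ v ∈ g₂, u * v ∈ g₂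

/-- The bilinear map `(X, Y) ↦ r (s X * t Y)`. -/
def sandwich (r s t : G →ₗ[K] G) : G →ₗ[K] G →ₗ[K] G :=
  ((LinearMap.mul K G).compl₁₂ s t).compr₂ r

variable {g₁ g₂ : Submodule K G}

open PreLieCochain

/-- The component `φ̂₁` of the multiplication: `φ̂₁((x, u), (y, v)) = (0, (x * y)₂)`. -/
noncomputable def phiHatOne (h : IsCompl g₁ g₂) : PreLieCochain K G G 1 :=
  ofBilin (sandwich (g₂.projection g₁ h.symm) (g₁.projection g₂ h) (g₁.projection g₂ h))

/-- The component `μ̂₁` of the multiplication: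
`μ̂₁((x, u), (y, v)) = ((x * y)₁, (x * v)₂ + (u * y)₂)`. -/
noncomputable def muHatOne (h : IsCompl g₁ g₂) : PreLieCochain K G G 1 :=
  ofBilin
    (sandwich (g₁.projection g₂ h) (g₁.projection g₂ h) (g₁.projection g₂ h) +
      sandwich (g₂.projection g₁ h.symm) (g₁.projection g₂ h) (g₂.projection g₁ h.symm) +
      sandwich (g₂.projection g₁ h.symm) (g₂.projection g₁ h.symm) (g₁.projection g₂ h))

/-- The component `μ̂₂` of the multiplication:
`μ̂₂((x, u), (y, v)) = ((x * v)₁ + (u * y)₁, (u * v)₂)`. -/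
noncomputable def muHatTwo (h : IsCompl g₁ g₂) : PreLieCochain K G G 1 :=
  ofBilin
    (sandwich (g₁.projection g₂ h) (g₁.projection g₂ h) (g₂.projection g₁ h.symm) +
      sandwich (g₁.projection g₂ h) (g₂.projection g₁ h.symm) (g₁.projection g₂ h) +
      sandwich (g₂.projection g₁ h.symm) (g₂.projection g₁ h.symm) (g₂.projection g₁ h.symm))

/-- The component `φ̂₂` of the multiplication: `φ̂₂((x, u), (y, v)) = ((u * v)₁, 0)`. -/
noncomputable def phiHatTwo (h : IsCompl g₁ g₂) : PreLieCochain K G G 1 :=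
  ofBilin (sandwich (g₁.projection g₂ h) (g₂.projection g₁ h.symm) (g₂.projection g₁ h.symm))

theorem hat_decomposition (h : IsCompl g₁ g₂) :
    ofBilin (LinearMap.mul K G) = phiHatOne h + muHatOne h + muHatTwo h + phiHatTwo h := by
  ext x z
  change x 0 * z = _
  have hx := Submodule.projection_add_projection_eq_self h (x 0)
  have hz := Submodule.projection_add_projection_eq_self h z
  have hxz := Submodule.projection_add_projection_eq_self h (x 0 * z)
  change x 0 * z = sandwich _ _ _ (x 0) z + (_ + _ + _ : G →ₗ[K] G →ₗ[K] G) (x 0) z +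
    (_ + _ + _ : G →ₗ[K] G →ₗ[K] G) (x 0) z + sandwich _ _ _ (x 0) z
  simp only [sandwich, LinearMap.add_apply, LinearMap.compr₂_apply, LinearMap.compl₁₂_apply,
    LinearMap.mul_apply']
  conv_lhs => rw [← hxz, ← hx, ← hz]
  simp only [mul_add, add_mul, map_add]
  abel

theorem isQuasiTwilled_iff (h : IsCompl g₁ g₂) : IsQuasiTwilled g₁ g₂ ↔ phiHatTwo h = 0 := by
  have key : ∀ (x : Fin 1 → G) (z : G), phiHatTwo h x z =
      g₁.projection g₂ h (g₂.projection g₁ h.symm (x 0) * g₂.projection g₁ h.symm z) :=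
    fun x z => rfl
  constructor
  · intro hG
    ext x z
    rw [key]
    simpa using hG.mul_mem _ (by simp) _ (by simp)
  · intro h0
    refine ⟨h, fun u hu v hv => ?_⟩
    have h1 := key (fun _ => u) v
    rw [h0] at h1
    have hu' : g₂.projection g₁ h.symm u = u := by simpa using hu
    have hv' : g₂.projection g₁ h.symm v = v := by simpa using hv
    rw [hu', hv'] at h1
    simpa using h1.symm

end QuasiTwilled

/-! ### L∞-algebras -/

/-- The Koszul sign `χ(σ)` of elements of degrees `d` in the graded skew-symmetric algebra, where
`u ∧ v = -(-1)^{|u||v|} v ∧ u`: it is determined by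
`x_{σ(1)} ∧ ⋯ ∧ x_{σ(n)} = χ(σ) x₁ ∧ ⋯ ∧ x_n`, so that each inversion contributes a factor. -/
def koszulSign {n : ℕ} (d : Fin n → ℤ) (σ : Equiv.Perm (Fin n)) : ℤˣ :=
  ∏ ij ∈ Finset.univ.filter (fun ij : Fin n × Fin n => ij.1 < ij.2 ∧ σ ij.2 < σ ij.1),
    -Int.negOnePow (d (σ ij.1) * d (σ ij.2))

/-- An L∞-algebra structure on a vector space `E` with a grading `E = ⨁_{m ∈ ℤ} 𝒜 m`: graded
skew-symmetric operations `l k` of `k` arguments (`k ≥ 1`; the value at `k = 0` is fixed to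
be `0`) and of degree `2 - k` that satisfy the generalized Jacobi identities. -/
structure LInftyAlgebra (K : Type*) [Field K] {E : Type*} [AddCommGroup E] [Module K E]
    (𝒜 : ℤ → Submodule K E) where
  isInternal : DirectSum.IsInternal 𝒜
  l : (k : ℕ) → MultilinearMap K (fun _ : Fin k => E) E
  l_zero : l 0 = 0
  /-- The operation `l k` has degree `2 - k`. -/
  l_mem : ∀ (k : ℕ) (d : Fin k → ℤ) (x : Fin k → E), (∀ i, x i ∈ 𝒜 (d i)) →
    l k x ∈ 𝒜 (∑ i, d i + 2 - k)
  /-- The operation `l k` is graded skew-symmetric. -/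
  l_skew : ∀ (k : ℕ) (d : Fin k → ℤ) (x : Fin k → E), (∀ i, x i ∈ 𝒜 (d i)) →
    ∀ σ : Equiv.Perm (Fin k), l k (fun i => x (σ i)) = koszulSign d σ • l k x
  /-- For all `n ≥ 1`, the sum over `i + j = n + 1` with `i, j ≥ 1` of
  `(-1)^i ∑_σ χ(σ) l_j(l_i(x_{σ(1)}, …, x_{σ(i)}), x_{σ(i+1)}, …, x_{σ(n)})`, where `σ` runs through
  the `(i, n - i)`-unshuffles, vanishes. Here `i = t + 1` and `j = n - 1 - t + 1`. -/
  jacobi : ∀ (n : ℕ) (d : Fin n → ℤ) (x : Fin n → E), (∀ i, x i ∈ 𝒜 (d i)) →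
    ∑ t : Fin n, (-1 : ℤ) ^ (t.val + 1) •
      ∑ σ ∈ unshuffles (twoBlocks (t.val + 1) : Fin n → ℕ), koszulSign d σ •
        l (n - 1 - t.val + 1)
          (Fin.cons (l (t.val + 1) (fun a : Fin (t.val + 1) => x (σ ⟨a, by omega⟩)))
            (fun c : Fin (n - 1 - t.val) => x (σ ⟨t.val + 1 + c, by omega⟩))) = 0

open PreLieCochain

-- The operations are higher derived brackets: iterated brackets of the components of the
-- multiplication with elements of an abelian subalgebra, the lifts.
--
-- To obtain the ambient graded Lie algebra, a cochain in `C^{p+1}(V, V)` is regarded as a linear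
-- functional on the exterior algebra of `V` with values in the endomorphisms of `V`; the last
-- argument stays inside the endomorphism. Signed sums over unshuffles become shuffle products,
-- which obey a two-term recursion under contraction with a vector, so identities between them need
-- no permutations. In this language `P ⋄ Q` is the insertion of the alternatization `flat Q` into
-- `P` plus a composition. The associator of `P, Q, R` keeps only the terms in which `Q` and `R`
-- enter different arguments of `P`, so it is graded symmetric in `Q, R` (`dia_dia_sub_comm`). Thus
-- `⋄` is a graded right pre-Lie product and its commutator is a graded Lie bracket `mn`, which
-- agrees with the Matsushima–Nijenhuis bracket (`toT_mnBracket`).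
--
-- Let `e` be the projection onto `g₁`. Bracketing with `e` is a derivation; its eigenvalue, the
-- weight, is the number of inputs from `g₁` minus the number of outputs in `g₁`. Weights `-2, -3,
-- …` do not occur (`eq_zero_of_weight`), and the cochains of weight `-1` are exactly the lifts
-- (`weight_conj`, `conj_of_weight`, `exists_lift_eq_iff`). Hence lifts commute with each other. The
-- multiplication is the sum of `μ̂₂`, `μ̂₁`, `φ̂₁`, of weights `0, 1, 2`; the part `φ̂₂` of weight
-- `-1` vanishes because `g₂` is a subalgebra. The pre-Lie identity says that the multiplication has
-- bracket zero with itself, and in characteristic zero this splits into one equation per weight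
-- (`sum_br_component`).
--
-- Let `Δ k` be the component of weight `k - 1`. Its iterated bracket with `k` lifts has weight
-- `-1`, hence is a lift, and with more than `k` lifts it vanishes. Expand the iterated bracket of
-- `[Δ i, Δ j]`, `i + j = n + 1`, with `n` lifts by the Leibniz rule: only the splittings that
-- saturate `Δ i` or `Δ j` survive, and the two kinds agree after summation over `i`. So twice the
-- Jacobi sum is zero (`sum_pairSum_eq_zero`). The sign `decSign` translates between the parity `m -
-- 1` natural for the bracket and the degree `m` used in the definition of an L∞-algebra.

universe k u

/-! ### Recursion for sums over unshuffles -/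

section InsertZero

open Equiv

/-- The permutation `σ` of `{0, …, n}` with `σ c = 0` that induces `τ` on the other elements. -/
def insertZero {n : ℕ} (c : Fin (n + 1)) (τ : Perm (Fin n)) : Perm (Fin (n + 1)) :=
  Perm.decomposeFin.symm (0, τ) * c.cycleRange

@[simp]
theorem insertZero_self {n : ℕ} (c : Fin (n + 1)) (τ : Perm (Fin n)) : insertZero c τ c = 0 := by
  simp [insertZero]

@[simp]
theorem insertZero_succAbove {n : ℕ} (c : Fin (n + 1)) (τ : Perm (Fin n)) (i : Fin n) :
    insertZero c τ (c.succAbove i) = (τ i).succ := by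
  simp [insertZero]

theorem sign_insertZero {n : ℕ} (c : Fin (n + 1)) (τ : Perm (Fin n)) :
    Perm.sign (insertZero c τ) = (-1) ^ (c : ℕ) * Perm.sign τ := by
  simp [insertZero, mul_comm]

theorem insertZero_bijective (n : ℕ) :
    Function.Bijective fun x : Fin (n + 1) × Perm (Fin n) => insertZero x.1 x.2 := by
  constructor
  · rintro ⟨c, τ⟩ ⟨c', τ'⟩ h
    have hc : c = c' := (insertZero c' τ').injective (by
      have := congrArg (fun σ : Perm (Fin (n + 1)) => σ c) h
      simpa using this.symm)
    subst hc
    have h' := Perm.decomposeFin.symm.injective (mul_right_cancel h)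
    simp only [Prod.mk.injEq, true_and] at h'
    rw [h']
  · intro σ
    -- After the position of the value `0` has been cycled to the front, the permutation fixes `0`;
    -- the second component of `decomposeFin` is what it induces on the other elements.
    refine ⟨(σ.symm 0, (Perm.decomposeFin (σ * (σ.symm 0).cycleRange⁻¹)).2), ?_⟩
    have h0 : (Perm.decomposeFin (σ * (σ.symm 0).cycleRange⁻¹)).1 = 0 := by
      rw [← Perm.decomposeFin_symm_apply_zero
        (Perm.decomposeFin (σ * (σ.symm 0).cycleRange⁻¹)).1
        (Perm.decomposeFin (σ * (σ.symm 0).cycleRange⁻¹)).2, Prod.mk.eta, symm_apply_apply]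
      simp [Perm.inv_def]
    have : ((0 : Fin (n + 1)), (Perm.decomposeFin (σ * (σ.symm 0).cycleRange⁻¹)).2) =
        Perm.decomposeFin (σ * (σ.symm 0).cycleRange⁻¹) := Prod.ext h0.symm rfl
    simp [insertZero, this]

/-- The least value `0` can only stand at the first position of a block, and there it imposes no
condition on the other entries. -/
theorem insertZero_mem_unshuffles {n : ℕ} {b : Fin (n + 1) → ℕ} {c : Fin (n + 1)}
    {τ : Perm (Fin n)} : insertZero c τ ∈ unshuffles b ↔
      (∀ i < c, b i ≠ b c) ∧ τ ∈ unshuffles (b ∘ c.succAbove) := by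
  simp only [unshuffles, Finset.mem_filter, Finset.mem_univ, true_and, Function.comp_apply]
  constructor
  · refine fun h => ⟨fun i hi hb => ?_, fun i j hij hb => ?_⟩
    · simpa using h i c hi hb
    · simpa using h (c.succAbove i) (c.succAbove j) (by simpa using hij) hb
  · rintro ⟨h1, h2⟩ i j hij hb
    obtain rfl | ⟨j, rfl⟩ := Fin.eq_self_or_eq_succAbove c j
    · exact absurd hb (h1 i hij)
    obtain rfl | ⟨i, rfl⟩ := Fin.eq_self_or_eq_succAbove c i
    · simp
    simpa using h2 i j (by simpa using hij) hb

open Classical in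
theorem sum_unshuffles_eq_sum_insertZero {M : Type*} [AddCommMonoid M] {n : ℕ}
    (b : Fin (n + 1) → ℕ) (f : Perm (Fin (n + 1)) → M) :
    ∑ σ ∈ unshuffles b, f σ = ∑ c with ∀ i < c, b i ≠ b c,
      ∑ τ ∈ unshuffles (b ∘ c.succAbove), f (insertZero c τ) := by
  have h : unshuffles b = Finset.univ.filter (· ∈ unshuffles b) := by simp
  rw [h, Finset.sum_filter, ← (insertZero_bijective n).sum_comp, Fintype.sum_prod_type,
    Finset.sum_filter]
  refine Finset.sum_congr rfl fun c _ => ?_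
  simp only [insertZero_mem_unshuffles]
  split_ifs with hc
  · simp only [and_iff_right hc]
    simp
  · simp [hc]

theorem ofFn_insertNth {α : Type*} {n : ℕ} (c : Fin (n + 1)) (a : α) (x : Fin n → α) :
    List.ofFn (c.insertNth a x : Fin (n + 1) → α) =
      (List.ofFn x).take c ++ a :: (List.ofFn x).drop c := by
  induction n with
  | zero =>
    obtain rfl := Fin.fin_one_eq_zero c
    simp
  | succ n ih =>
    induction c using Fin.cases with
    | zero => simp
    | succ c =>
      have h : (c.succ.insertNth a x : Fin (n + 2) → α) =
          Fin.cons (x 0) (c.insertNth a (Fin.tail x) : Fin (n + 1) → α) := by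
        rw [eq_comm, Fin.eq_insertNth_iff]
        refine ⟨by simp, funext fun i => ?_⟩
        induction i using Fin.cases with
        | zero => simp [Fin.removeNth]
        | succ i => simp [Fin.removeNth, Fin.tail]
      rw [h, List.ofFn_cons, ih, List.ofFn_succ (f := x)]
      rfl

/-- Passes from permutations to lists: as a word, the extended permutation arises from the shorter
one by inserting the first letter at position `c`. -/
theorem ofFn_comp_insertZero {α : Type*} {n : ℕ} (y : Fin (n + 1) → α) (c : Fin (n + 1))
    (τ : Perm (Fin n)) :
    List.ofFn (y ∘ insertZero c τ) =
      (List.ofFn (Fin.tail y ∘ τ)).take c ++ y 0 :: (List.ofFn (Fin.tail y ∘ τ)).drop c := by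
  have : y ∘ insertZero c τ = c.insertNth (y 0) (Fin.tail y ∘ τ) := by
    rw [Fin.eq_insertNth_iff]
    exact ⟨by simp, funext fun i => by simp [Fin.removeNth, Fin.tail]⟩
  rw [this, ofFn_insertNth]

end InsertZero

/-! ### Recursion for Koszul signs -/

section KoszulSign

open Equiv

theorem koszulSign_eq_prod {n : ℕ} (d : Fin n → ℤ) (σ : Perm (Fin n)) :
    koszulSign d σ = ∏ i, ∏ j,
      if i < j ∧ σ j < σ i then -Int.negOnePow (d (σ i) * d (σ j)) else 1 := by
  rw [koszulSign, Finset.prod_filter, ← Finset.univ_product_univ, Finset.prod_product]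

/-- The value `0` at position `c` forms inversions with exactly the `c` entries before it; all other
inversions are those of `τ`. -/
theorem koszulSign_insertZero {n : ℕ} (d : Fin (n + 1) → ℤ) (c : Fin (n + 1))
    (τ : Perm (Fin n)) :
    koszulSign d (insertZero c τ) =
      (((List.ofFn (Fin.tail d ∘ τ)).take c).map fun e => -Int.negOnePow (d 0 * e)).prod *
        koszulSign (Fin.tail d) τ := by
  simp only [koszulSign_eq_prod, Fin.prod_univ_succAbove _ c, insertZero_self,
    insertZero_succAbove, Fin.succAbove_lt_succAbove_iff, Fin.succ_lt_succ_iff]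
  simp only [lt_self_iff_false, Fin.not_lt_zero, and_false, if_false, Finset.prod_const_one,
    Fin.succ_pos, and_true, one_mul, Finset.prod_mul_distrib]
  congr 1
  rw [List.map_take, List.map_ofFn, List.prod_take_ofFn, Finset.prod_filter]
  refine Finset.prod_congr rfl fun i _ => ?_
  have h : c.succAbove i < c ↔ (i : ℕ) < c := by
    rw [Fin.succAbove_lt_iff_castSucc_lt, Fin.lt_def, Fin.val_castSucc]
  simp only [h, Function.comp_apply, Fin.tail, mul_comm]

/-- In degree zero each inversion contributes `-1`. Ordinary unshuffle sums are therefore a special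
case of the graded ones. -/
theorem sign_eq_koszulSign {n : ℕ} (σ : Perm (Fin n)) : Perm.sign σ = koszulSign 0 σ := by
  induction n with
  | zero => simp [Subsingleton.elim σ 1, koszulSign_eq_prod]
  | succ n ih =>
    obtain ⟨⟨c, τ⟩, rfl⟩ := (insertZero_bijective n).2 σ
    have : Fin.tail (0 : Fin (n + 1) → ℤ) = 0 := rfl
    simp only [sign_insertZero, koszulSign_insertZero, ih, this]
    congr 1
    have h : (min (c : ℕ) n) = c := by omega
    simp [h, Function.comp_def]

end KoszulSign

/-! ### Sums over the splittings of a list -/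

section SplitSum

variable {α M : Type*} [AddCommGroup M]

/-- The sum of `± H I J` over all ways to split a list into a sublist `I` of length `p` and its
complement `J`; the sign is the product of `s y z` over all `y` in `J` and all later `z` in `I`. -/
def splitSum (s : α → α → ℤˣ) : ℕ → List α → (List α → List α → M) → M
  | 0, [], H => H [] []
  | _ + 1, [], _ => 0
  | 0, y :: l, H => splitSum s 0 l fun I J => (I.map (s y)).prod • H I (y :: J)
  | p + 1, y :: l, H => splitSum s p l (fun I J => H (y :: I) J) +
      splitSum s (p + 1) l fun I J => (I.map (s y)).prod • H I (y :: J)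

/-- The summands matter only at genuine splittings of the list, so length and membership facts are
available when they are rewritten. -/
theorem splitSum_congr {s : α → α → ℤˣ} {p : ℕ} {l : List α} {H H' : List α → List α → M}
    (h : ∀ I J, (I ++ J).Perm l → I.length = p → H I J = H' I J) :
    splitSum s p l H = splitSum s p l H' := by
  induction l generalizing p H H' with
  | nil =>
    cases p with
    | zero => exact h [] [] (List.Perm.refl _) rfl
    | succ p => rfl
  | cons y l ih =>
    have h2 : ∀ I J, (I ++ J).Perm l → I.length = p →
        (I.map (s y)).prod • H I (y :: J) = (I.map (s y)).prod • H' I (y :: J) := fun I J hIJ hI => by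
      rw [h I (y :: J) (List.perm_middle.trans (hIJ.cons y)) hI]
    cases p with
    | zero => exact ih h2
    | succ p =>
      simp only [splitSum]
      rw [ih h2, ih fun I J hIJ hI => h (y :: I) J (hIJ.cons y) (by simp [hI])]

theorem splitSum_zero (s : α → α → ℤˣ) (p : ℕ) (l : List α) :
    splitSum s p l (fun _ _ => (0 : M)) = 0 := by
  induction l generalizing p with
  | nil => cases p <;> rfl
  | cons y l ih => cases p <;> simp [splitSum, ih]

theorem splitSum_eq_zero {s : α → α → ℤˣ} {p : ℕ} {l : List α} {H : List α → List α → M}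
    (h : ∀ I J, (I ++ J).Perm l → I.length = p → H I J = 0) : splitSum s p l H = 0 :=
  (splitSum_congr h).trans (splitSum_zero s p l)

theorem splitSum_of_length_lt {s : α → α → ℤˣ} {p : ℕ} {l : List α} (h : l.length < p)
    (H : List α → List α → M) : splitSum s p l H = 0 :=
  splitSum_eq_zero fun I J hIJ hI => by
    have := hIJ.length_eq
    simp only [List.length_append] at this
    omega

theorem map_splitSum {N F : Type*} [AddCommGroup N] [FunLike F M N] [AddMonoidHomClass F M N]
    (φ : F) (s : α → α → ℤˣ) (p : ℕ) (l : List α) (H : List α → List α → M) :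
    φ (splitSum s p l H) = splitSum s p l fun I J => φ (H I J) := by
  induction l generalizing p H with
  | nil => cases p <;> simp [splitSum]
  | cons y l ih => cases p <;> simp [splitSum, ih, Units.smul_def, map_zsmul]

theorem splitSum_smul {R : Type*} [Monoid R] [DistribMulAction R M] (r : R) (s : α → α → ℤˣ)
    (p : ℕ) (l : List α) (H : List α → List α → M) :
    (splitSum s p l fun I J => r • H I J) = r • splitSum s p l H :=
  (map_splitSum (DistribSMul.toAddMonoidHom M r) s p l H).symm

theorem splitSum_add (s : α → α → ℤˣ) (p : ℕ) (l : List α) (H H' : List α → List α → M) :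
    (splitSum s p l fun I J => H I J + H' I J) = splitSum s p l H + splitSum s p l H' := by
  induction l generalizing p H H' with
  | nil => cases p <;> simp [splitSum]
  | cons y l ih => cases p <;> simp [splitSum, ih, smul_add]; abel

end SplitSum

/-! ### Sums over two-block unshuffles as sums over splittings -/

section TwoBlocks

open Equiv

variable {α M : Type*} [AddCommGroup M]

theorem twoBlocks_comp_succAbove_zero (p n : ℕ) :
    (twoBlocks (p + 1) : Fin (n + 1) → ℕ) ∘ (0 : Fin (n + 1)).succAbove = twoBlocks p := by
  funext i
  simp [twoBlocks]

theorem twoBlocks_comp_succAbove_self {p n : ℕ} (hp : p < n + 1) :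
    (twoBlocks p : Fin (n + 1) → ℕ) ∘ (⟨p, hp⟩ : Fin (n + 1)).succAbove = twoBlocks p := by
  funext i
  simp only [twoBlocks, Function.comp_apply, Fin.succAbove, Fin.lt_def, Fin.val_castSucc]
  split_ifs <;> (simp_all; try omega)

theorem sum_unshuffles_twoBlocks_zero {n : ℕ} (f : Perm (Fin (n + 1)) → M) :
    ∑ σ ∈ unshuffles (twoBlocks 0), f σ =
      ∑ τ ∈ unshuffles (twoBlocks 0), f (insertZero 0 τ) := by
  classical
  rw [sum_unshuffles_eq_sum_insertZero, Finset.sum_eq_single 0]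
  · rw [← twoBlocks_comp_succAbove_self (Nat.succ_pos n)]; rfl
  · intro c hc h0
    rw [Finset.mem_filter] at hc
    exact absurd (by simp [twoBlocks]) (hc.2 0 (Fin.pos_of_ne_zero h0))
  · simp

/-- The two summands correspond to `0` opening the first block, which thereby loses a position, or
opening the second one. -/
theorem sum_unshuffles_twoBlocks_succ {n p : ℕ} (hp : p + 1 < n + 1)
    (f : Perm (Fin (n + 1)) → M) :
    ∑ σ ∈ unshuffles (twoBlocks (p + 1)), f σ =
      ∑ τ ∈ unshuffles (twoBlocks p), f (insertZero 0 τ) +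
        ∑ τ ∈ unshuffles (twoBlocks (p + 1)), f (insertZero ⟨p + 1, hp⟩ τ) := by
  classical
  rw [sum_unshuffles_eq_sum_insertZero, Finset.sum_eq_add 0 ⟨p + 1, hp⟩]
  · rw [twoBlocks_comp_succAbove_self, twoBlocks_comp_succAbove_zero]
  · simp [Fin.ext_iff]
  · rintro c hc ⟨h0, h1⟩
    rw [Finset.mem_filter] at hc
    have h0' : (c : ℕ) ≠ 0 := fun h => h0 (Fin.ext h)
    have h1' : (c : ℕ) ≠ p + 1 := fun h => h1 (Fin.ext h)
    by_cases h : (c : ℕ) < p + 1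
    · exact absurd (by simp [twoBlocks, h]) (hc.2 0 (Fin.pos_of_ne_zero h0))
    · refine absurd ?_ (hc.2 ⟨p + 1, hp⟩ (by rw [Fin.lt_def]; simp; omega))
      simp [twoBlocks, h]
  · simp
  · intro h
    refine absurd ?_ h
    simp only [Finset.mem_filter, Finset.mem_univ, true_and, Fin.lt_def]
    intro i hi
    simp [twoBlocks, hi]

theorem sum_unshuffles_twoBlocks_card {n : ℕ} (f : Perm (Fin (n + 1)) → M) :
    ∑ σ ∈ unshuffles (twoBlocks (n + 1)), f σ =
      ∑ τ ∈ unshuffles (twoBlocks n), f (insertZero 0 τ) := by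
  classical
  rw [sum_unshuffles_eq_sum_insertZero, Finset.sum_eq_single 0]
  · rw [twoBlocks_comp_succAbove_zero]
  · intro c hc h0
    rw [Finset.mem_filter] at hc
    exact absurd (by simp [twoBlocks, c.isLt]) (hc.2 0 (Fin.pos_of_ne_zero h0))
  · simp

/-- An unshuffle is the choice of the sublist that fills the first block. Both sides obey the same
recursion on the first letter, which joins the first block without sign or passes all of it to open
the second. -/
theorem sum_unshuffles_twoBlocks (d : α → ℤ) {n p : ℕ} (hp : p ≤ n) (y : Fin n → α)
    (H : List α → List α → M) :
    ∑ σ ∈ unshuffles (twoBlocks p), koszulSign (d ∘ y) σ •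
        H ((List.ofFn (y ∘ σ)).take p) ((List.ofFn (y ∘ σ)).drop p) =
      splitSum (fun a b => -Int.negOnePow (d a * d b)) p (List.ofFn y) H := by
  have hd : ∀ {m : ℕ} (z : Fin (m + 1) → α), Fin.tail (d ∘ z) = d ∘ Fin.tail z := fun _ => rfl
  induction n generalizing p H with
  | zero =>
    obtain rfl : p = 0 := by omega
    have : unshuffles (twoBlocks 0 : Fin 0 → ℕ) = {1} := by decide
    simp [this, splitSum, koszulSign_eq_prod]
  | succ n ih =>
    rw [show List.ofFn y = y 0 :: List.ofFn (Fin.tail y) from List.ofFn_succ]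
    have h2 : ∀ (hpn : p < n + 1) (τ : Perm (Fin n)),
        koszulSign (d ∘ y) (insertZero ⟨p, hpn⟩ τ) •
          H ((List.ofFn (y ∘ insertZero ⟨p, hpn⟩ τ)).take p)
            ((List.ofFn (y ∘ insertZero ⟨p, hpn⟩ τ)).drop p) =
        koszulSign (d ∘ Fin.tail y) τ • (fun I J =>
          (I.map fun b => -Int.negOnePow (d (y 0) * d b)).prod • H I (y 0 :: J))
            ((List.ofFn (Fin.tail y ∘ τ)).take p) ((List.ofFn (Fin.tail y ∘ τ)).drop p) := by
      intro hpn τ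
      have hl : ((List.ofFn (Fin.tail y ∘ τ)).take p).length = p := by simp; omega
      rw [ofFn_comp_insertZero, koszulSign_insertZero, List.take_left' hl, List.drop_left' hl, hd,
        mul_comm, mul_smul, Function.comp_assoc, ← List.map_ofFn, ← List.map_take, List.map_map]
      rfl
    have h1 : ∀ q (τ : Perm (Fin n)),
        koszulSign (d ∘ y) (insertZero 0 τ) •
          H ((List.ofFn (y ∘ insertZero 0 τ)).take (q + 1))
            ((List.ofFn (y ∘ insertZero 0 τ)).drop (q + 1)) =
        koszulSign (d ∘ Fin.tail y) τ • (fun I J => H (y 0 :: I) J)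
            ((List.ofFn (Fin.tail y ∘ τ)).take q) ((List.ofFn (Fin.tail y ∘ τ)).drop q) := by
      intro q τ
      rw [ofFn_comp_insertZero, koszulSign_insertZero, hd]
      simp
    cases p with
    | zero =>
      rw [sum_unshuffles_twoBlocks_zero, splitSum, ← ih (Nat.zero_le n) (Fin.tail y)]
      exact Finset.sum_congr rfl fun τ _ => h2 (Nat.succ_pos n) τ
    | succ p =>
      rw [splitSum, ← ih (by omega) (Fin.tail y)]
      rcases hp.lt_or_eq with hpn | hpn
      · rw [sum_unshuffles_twoBlocks_succ hpn, ← ih (by omega) (Fin.tail y)]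
        exact congrArg₂ _ (Finset.sum_congr rfl fun τ _ => h1 p τ)
          (Finset.sum_congr rfl fun τ _ => h2 hpn τ)
      · obtain rfl : p = n := by omega
        -- The second block is empty here, so the summand in which the first letter enters it has
        -- too few letters for the first block.
        rw [splitSum_of_length_lt (by simp), add_zero, sum_unshuffles_twoBlocks_card]
        exact Finset.sum_congr rfl fun τ _ => h1 p τ

end TwoBlocks

/-! ### The shuffle product of functionals on the exterior algebra -/

/-- The linear maps from the exterior algebra of `V` to `W`, that is, sequences of alternating maps
with one member in each degree. -/
abbrev ExtHom (K : Type k) (V W : Type u) [CommRing K] [AddCommGroup V] [Module K V]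
    [AddCommGroup W] [Module K W] : Type _ :=
  ExteriorAlgebra K V →ₗ[K] W

/-- The space of linear maps from `V` to `W`, as a separate type. -/
structure HomSpace (K : Type k) (V W : Type u) [CommRing K] [AddCommGroup V] [Module K V]
    [AddCommGroup W] [Module K W] : Type u where
  /-- The underlying linear map. -/
  toLinearMap : V →ₗ[K] W

namespace HomSpace

variable {K : Type k} {V W : Type u} [CommRing K] [AddCommGroup V] [Module K V]
  [AddCommGroup W] [Module K W]

/-- The bijection with the space of linear maps. -/
def equiv (K : Type k) (V W : Type u) [CommRing K] [AddCommGroup V] [Module K V]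
    [AddCommGroup W] [Module K W] : HomSpace K V W ≃ (V →ₗ[K] W) :=
  ⟨toLinearMap, mk, fun _ => rfl, fun _ => rfl⟩

variable (K V W) in
/-- The additive structure of `HomSpace`. -/
def instGroup : AddCommGroup (HomSpace K V W) := (equiv K V W).addCommGroup

instance : AddCommGroup (HomSpace K V W) := instGroup K V W

variable (K V W) in
/-- The module structure of `HomSpace`. -/
def instModule : Module K (HomSpace K V W) := (equiv K V W).module K

instance : Module K (HomSpace K V W) := instModule K V W

/-- A linear map as an element of `HomSpace`. -/
def of : (V →ₗ[K] W) →ₗ[K] HomSpace K V W where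
  toFun f := ⟨f⟩
  map_add' _ _ := rfl
  map_smul' _ _ := rfl

/-- The evaluation of an element of `HomSpace`. -/
def app : HomSpace K V W →ₗ[K] V →ₗ[K] W where
  toFun f := f.toLinearMap
  map_add' _ _ := rfl
  map_smul' _ _ := rfl

@[simp]
theorem app_of (f : V →ₗ[K] W) : app (of f) = f := rfl

@[ext]
theorem ext {f g : HomSpace K V W} (h : ∀ v, app f v = app g v) : f = g := by
  cases f; cases g; congr 1; exact LinearMap.ext h

attribute [irreducible] instGroup instModule

end HomSpace

namespace ExtHom

open ExteriorAlgebra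

section Basic

variable {K : Type k} {V W W₁ W₂ W₃ : Type u} [CommRing K] [AddCommGroup V] [Module K V]
  [AddCommGroup W] [Module K W] [AddCommGroup W₁] [Module K W₁] [AddCommGroup W₂] [Module K W₂]
  [AddCommGroup W₃] [Module K W₃]

/-- The grading involution. -/
def eps : ExtHom K V W →ₗ[K] ExtHom K V W :=
  LinearMap.lcomp K W (CliffordAlgebra.involute (Q := (0 : QuadraticForm K V))).toLinearMap

/-- The contraction with a vector, which becomes the first argument. -/
def contr : V →ₗ[K] ExtHom K V W →ₗ[K] ExtHom K V W :=
  LinearMap.mk₂ K (fun v P => P ∘ₗ LinearMap.mulLeft K (ι K v))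
    (fun _ _ _ => LinearMap.ext fun _ => by simp [add_mul]) (fun _ _ _ => LinearMap.ext fun _ => by simp)
    (fun _ _ _ => LinearMap.ext fun _ => by simp) (fun _ _ _ => LinearMap.ext fun _ => by simp)

/-- The functional `x ↦ (v ↦ P (v ∧ x))`. -/
def openFirst : ExtHom K V W →ₗ[K] ExtHom K V (HomSpace K V W) where
  toFun P := HomSpace.of ∘ₗ LinearMap.mk₂ K (fun x v => P (ι K v * x))
    (fun _ _ _ => by simp [mul_add]) (fun _ _ _ => by simp)
    (fun _ _ _ => by simp [add_mul]) (fun _ _ _ => by simp)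
  map_add' _ _ := LinearMap.ext fun _ => HomSpace.ext fun _ => by simp
  map_smul' _ _ := LinearMap.ext fun _ => HomSpace.ext fun _ => by simp

/-- The functional of degree zero with a given value. -/
def const : W →ₗ[K] ExtHom K V W where
  toFun w := (algebraMapInv (R := K) (M := V)).toLinearMap.smulRight w
  map_add' _ _ := LinearMap.ext fun _ => by simp
  map_smul' c w := LinearMap.ext fun _ => smul_comm _ _ _

@[simp]
theorem contr_apply (v : V) (P : ExtHom K V W) (x : ExteriorAlgebra K V) :
    contr v P x = P (ι K v * x) := rfl

@[simp]
theorem openFirst_apply (P : ExtHom K V W) (x : ExteriorAlgebra K V) (v : V) :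
    HomSpace.app (openFirst P x) v = P (ι K v * x) := rfl

@[simp]
theorem const_one (w : W) : (const w : ExtHom K V W) 1 = w := by simp [const]

@[simp]
theorem const_ι_mul (w : W) (v : V) (x : ExteriorAlgebra K V) :
    (const w : ExtHom K V W) (ι K v * x) = 0 := by
  simp [const, algebraMapInv]

@[simp]
theorem eps_one (P : ExtHom K V W) : eps P 1 = P 1 := by simp [eps]

@[simp]
theorem eps_ι_mul (P : ExtHom K V W) (v : V) (x : ExteriorAlgebra K V) :
    eps P (ι K v * x) = - eps (contr v P) x := by
  simp [eps]

/-- Two functionals agree if they agree at `1` and have the same contractions. -/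
theorem ext_contr {P Q : ExtHom K V W} (h1 : P 1 = Q 1) (h : ∀ v, contr v P = contr v Q) :
    P = Q := by
  refine LinearMap.ext fun x => ?_
  induction x using CliffordAlgebra.left_induction with
  | algebraMap r => simp [Algebra.algebraMap_eq_smul_one, h1]
  | add x y hx hy => simp [hx, hy]
  | ι_mul x v _ => exact LinearMap.congr_fun (h v) x

theorem induction_on (C : ExteriorAlgebra K V → Prop) (h1 : C 1)
    (hadd : ∀ x y, C x → C y → C (x + y)) (hsmul : ∀ (r : K) x, C x → C (r • x))
    (hmul : ∀ v x, C x → C (ι K v * x)) (x : ExteriorAlgebra K V) : C x := by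
  induction x using CliffordAlgebra.left_induction with
  | algebraMap r => rw [Algebra.algebraMap_eq_smul_one]; exact hsmul r 1 h1
  | add x y hx hy => exact hadd x y hx hy
  | ι_mul x v hx => exact hmul v x hx

theorem contr_contr_self (v : V) (P : ExtHom K V W) : contr v (contr v P) = 0 := by
  refine LinearMap.ext fun x => ?_
  simp [← mul_assoc]

theorem contr_contr_comm (v w : V) (P : ExtHom K V W) :
    contr v (contr w P) = - contr w (contr v P) := by
  refine LinearMap.ext fun x => ?_
  rw [LinearMap.neg_apply, eq_neg_iff_add_eq_zero]
  have := contr_contr_self (v + w) P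
  simpa [contr_contr_self] using LinearMap.congr_fun this x

theorem contr_eps (v : V) (P : ExtHom K V W) : contr v (eps P) = - eps (contr v P) := by
  refine LinearMap.ext fun x => ?_
  simp

@[simp]
theorem eps_eps (P : ExtHom K V W) : eps (eps P) = P := by
  refine LinearMap.ext fun x => ?_
  simp [eps]

theorem eps_const (w : W) : eps (const w : ExtHom K V W) = const w :=
  ext_contr (by simp) fun v => by
    refine LinearMap.ext fun x => ?_
    have h : contr v (const w : ExtHom K V W) = 0 := LinearMap.ext fun x => by simp
    simp [h]

@[simp]
theorem contr_const (v : V) (w : W) : contr v (const w : ExtHom K V W) = 0 :=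
  LinearMap.ext fun x => by simp

@[simp]
theorem openFirst_const (w : W) : openFirst (const w : ExtHom K V W) = 0 :=
  LinearMap.ext fun x => HomSpace.ext fun v => by simp

theorem contr_openFirst (v : V) (P : ExtHom K V W) :
    contr v (openFirst P) = - openFirst (contr v P) :=
  LinearMap.ext fun x => HomSpace.ext fun w => by
    rw [LinearMap.neg_apply, map_neg, LinearMap.neg_apply, openFirst_apply, contr_apply,
      openFirst_apply]
    simpa using LinearMap.congr_fun (contr_contr_comm v w P) x

theorem eps_openFirst (P : ExtHom K V W) : eps (openFirst P) = - openFirst (eps P) := by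
  refine LinearMap.ext fun x => HomSpace.ext fun v => ?_
  have := LinearMap.congr_fun (contr_eps v P) x
  rw [contr_apply] at this
  rw [LinearMap.neg_apply, map_neg, LinearMap.neg_apply, openFirst_apply, this,
    LinearMap.neg_apply, neg_neg]
  rfl

/-- The composition with a linear map on the target. -/
def post (g : W →ₗ[K] W₁) : ExtHom K V W →ₗ[K] ExtHom K V W₁ := g.compRight K

@[simp]
theorem post_apply (g : W →ₗ[K] W₁) (P : ExtHom K V W) (x : ExteriorAlgebra K V) :
    post g P x = g (P x) := rfl

theorem contr_post (g : W →ₗ[K] W₁) (P : ExtHom K V W) (v : V) :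
    contr v (post g P) = post g (contr v P) := rfl

theorem eps_post (g : W →ₗ[K] W₁) (P : ExtHom K V W) : eps (post g P) = post g (eps P) := rfl

/-- An alternating map of degree `p` as a functional. -/
def ofAlt (p : ℕ) : V [⋀^Fin p]→ₗ[K] W →ₗ[K] ExtHom K V W :=
  liftAlternating ∘ₗ LinearMap.single K (fun p : ℕ => V [⋀^Fin p]→ₗ[K] W) p

theorem ofAlt_ιMulti {p : ℕ} (f : V [⋀^Fin p]→ₗ[K] W) (x : Fin p → V) :
    ofAlt p f (ιMulti K p x) = f x := by
  simp [ofAlt]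

theorem ofAlt_succ_one {p : ℕ} (f : V [⋀^Fin (p + 1)]→ₗ[K] W) : ofAlt (p + 1) f 1 = 0 := by
  simp [ofAlt]

theorem contr_ofAlt_succ {p : ℕ} (f : V [⋀^Fin (p + 1)]→ₗ[K] W) (v : V) :
    contr v (ofAlt (p + 1) f) = ofAlt p (f.curryLeft v) := by
  refine LinearMap.ext fun x => ?_
  simp only [contr_apply, ofAlt, LinearMap.comp_apply, liftAlternating_ι_mul]
  congr 2
  funext i
  by_cases h : i = p
  · subst h; simp
  · have h' : i + 1 ≠ p + 1 := by omega
    simp [Pi.single_eq_of_ne h, Pi.single_eq_of_ne h']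

theorem ofAlt_zero (f : V [⋀^Fin 0]→ₗ[K] W) : ofAlt 0 f = const (f 0) := by
  refine ext_contr (by simp [ofAlt]) fun v => ?_
  rw [contr_const]
  refine LinearMap.ext fun x => ?_
  simp only [contr_apply, ofAlt, LinearMap.comp_apply, liftAlternating_ι_mul]
  have : (fun i : ℕ => AlternatingMap.curryLeft
      (LinearMap.single K (fun p : ℕ => V [⋀^Fin p]→ₗ[K] W) 0 f i.succ) v) = 0 := by
    funext i
    simp
  rw [this]
  simp

/-- The projection of the exterior algebra onto `V`. -/
def proj : ExtHom K V V :=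
  ofAlt 1 (AlternatingMap.ofSubsingleton K V V (0 : Fin 1) LinearMap.id)

@[simp]
theorem proj_one : (proj : ExtHom K V V) 1 = 0 := ofAlt_succ_one _

@[simp]
theorem contr_proj (v : V) : contr v (proj : ExtHom K V V) = const v := by
  rw [proj, contr_ofAlt_succ, ofAlt_zero]
  simp

@[simp]
theorem openFirst_proj : openFirst (proj : ExtHom K V V) = const (HomSpace.of LinearMap.id) :=
  LinearMap.ext fun x => HomSpace.ext fun v => by
    have := LinearMap.congr_fun (contr_proj (K := K) v) x
    rw [contr_apply] at this
    rw [openFirst_apply, this]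
    simp [const]

/-- The functional has even degree if `p` is even and odd degree if `p` is odd. -/
def IsPar (p : ℕ) (P : ExtHom K V W) : Prop := eps P = (-1 : ℤˣ) ^ p • P

theorem IsPar.contr {p : ℕ} {P : ExtHom K V W} (h : IsPar p P) (v : V) :
    IsPar (p + 1) (contr v P) := by
  unfold IsPar at *
  rw [← neg_eq_iff_eq_neg.2 (contr_eps v P), h, pow_succ]
  simp [Units.smul_def]

theorem isPar_const (w : W) : IsPar 0 (const w : ExtHom K V W) := by
  simp [IsPar, eps_const]

theorem isPar_of_contr {p : ℕ} {P : ExtHom K V W} (h1 : P 1 = (-1 : ℤˣ) ^ p • P 1)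
    (h : ∀ v, IsPar (p + 1) (contr v P)) : IsPar p P := by
  refine ext_contr (by simpa [Units.smul_def] using h1) fun v => ?_
  rw [contr_eps, h v, pow_succ]
  simp [Units.smul_def]

theorem isPar_proj : IsPar 1 (proj : ExtHom K V V) :=
  isPar_of_contr (by simp) fun v => by
    rw [contr_proj]
    simpa [IsPar] using isPar_const (K := K) (V := V) v

end Basic

/-! ### The shuffle product and its symmetries -/

section Shuffle

variable {K : Type k} {V W₁ W₂ W₃ U₁ U₂ U₃ : Type u} [CommRing K] [AddCommGroup V] [Module K V]
  [AddCommGroup W₁] [Module K W₁] [AddCommGroup W₂] [Module K W₂] [AddCommGroup W₃] [Module K W₃]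
  [AddCommGroup U₁] [Module K U₁] [AddCommGroup U₂] [Module K U₂] [AddCommGroup U₃] [Module K U₃]

/-- The recursion step for the shuffle product: a vector is given to one of the factors. -/
def shuffleStep : V →ₗ[K] (ExtHom K V W₁ →ₗ[K] ExtHom K V W₂ →ₗ[K] W₃) →ₗ[K]
    (ExtHom K V W₁ →ₗ[K] ExtHom K V W₂ →ₗ[K] W₃) :=
  -- Applying `eps` to the first factor accounts for the sign with which `v` passes it on the way to
  -- the second.
  LinearMap.mk₂ K (fun v β => β ∘ₗ contr v + β.compl₁₂ eps (contr v))
    (fun _ _ _ => by ext1; refine LinearMap.ext fun _ => ?_; simp; abel)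
    (fun _ _ _ => by ext1; refine LinearMap.ext fun _ => ?_; simp)
    (fun _ _ _ => by ext1; refine LinearMap.ext fun _ => ?_; simp; abel)
    (fun _ _ _ => by ext1; refine LinearMap.ext fun _ => ?_; simp)

theorem shuffleStep_apply (v : V) (β : ExtHom K V W₁ →ₗ[K] ExtHom K V W₂ →ₗ[K] W₃)
    (P : ExtHom K V W₁) (Q : ExtHom K V W₂) :
    shuffleStep v β P Q = β (contr v P) Q + β (eps P) (contr v Q) := rfl

/-- This is the condition under which the recursion descends from words to the exterior algebra.
Double contractions vanish, and the mixed terms cancel because `eps` anticommutes with contraction.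
-/
theorem shuffleStep_shuffleStep (v : V)
    (β : ExtHom K V W₁ →ₗ[K] ExtHom K V W₂ →ₗ[K] W₃) :
    shuffleStep v (shuffleStep v β) = (0 : QuadraticForm K V) v • β := by
  refine LinearMap.ext fun P => LinearMap.ext fun Q => ?_
  simp [shuffleStep_apply, contr_contr_self, contr_eps]

/-- The shuffle product of `P` and `Q` for a bilinear map `B` on the values: the value at
`v₁ ∧ ⋯ ∧ vₙ` is the signed sum of `B (P v_I) (Q v_J)` over the decompositions of the set of indices
into `I` and `J`. -/
def shuffle (B : W₁ →ₗ[K] W₂ →ₗ[K] W₃) :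
    ExtHom K V W₁ →ₗ[K] ExtHom K V W₂ →ₗ[K] ExtHom K V W₃ :=
  LinearMap.mk₂ K (fun P Q =>
    (LinearMap.applyₗ Q ∘ₗ LinearMap.applyₗ P) ∘ₗ
      CliffordAlgebra.foldr 0 shuffleStep shuffleStep_shuffleStep
        (B.compl₁₂ (LinearMap.applyₗ (1 : ExteriorAlgebra K V))
          (LinearMap.applyₗ (1 : ExteriorAlgebra K V))))
    (fun _ _ _ => LinearMap.ext fun _ => by simp)
    (fun _ _ _ => LinearMap.ext fun _ => by simp)
    (fun _ _ _ => LinearMap.ext fun _ => by simp)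
    (fun _ _ _ => LinearMap.ext fun _ => by simp)

@[simp]
theorem shuffle_one (B : W₁ →ₗ[K] W₂ →ₗ[K] W₃) (P : ExtHom K V W₁) (Q : ExtHom K V W₂) :
    shuffle B P Q 1 = B (P 1) (Q 1) := by
  simp [shuffle]

theorem shuffle_ι_mul (B : W₁ →ₗ[K] W₂ →ₗ[K] W₃) (P : ExtHom K V W₁) (Q : ExtHom K V W₂)
    (v : V) (x : ExteriorAlgebra K V) :
    shuffle B P Q (ι K v * x) =
      shuffle B (contr v P) Q x + shuffle B (eps P) (contr v Q) x := by
  simp only [shuffle, LinearMap.mk₂_apply, LinearMap.comp_apply, CliffordAlgebra.foldr_mul,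
    CliffordAlgebra.foldr_ι]
  rfl

theorem contr_shuffle (B : W₁ →ₗ[K] W₂ →ₗ[K] W₃) (P : ExtHom K V W₁) (Q : ExtHom K V W₂)
    (v : V) :
    contr v (shuffle B P Q) = shuffle B (contr v P) Q + shuffle B (eps P) (contr v Q) :=
  LinearMap.ext fun x => shuffle_ι_mul B P Q v x

theorem post_shuffle {B : W₁ →ₗ[K] W₂ →ₗ[K] W₃} {B' : U₁ →ₗ[K] U₂ →ₗ[K] U₃} {f : W₁ →ₗ[K] U₁}
    {g : W₂ →ₗ[K] U₂} {h : W₃ →ₗ[K] U₃} (H : ∀ a b, h (B a b) = B' (f a) (g b))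
    (P : ExtHom K V W₁) (Q : ExtHom K V W₂) :
    post h (shuffle B P Q) = shuffle B' (post f P) (post g Q) := by
  refine LinearMap.ext fun x => ?_
  induction x using induction_on generalizing P Q with
  | h1 => simp [H]
  | hadd x y hx hy => rw [map_add, map_add, hx, hy]
  | hsmul r x hx => rw [map_smul, map_smul, hx]
  | hmul v x hx =>
    have := congrArg₂ (· + ·) (hx (contr v P) Q) (hx (eps P) (contr v Q))
    simpa [shuffle_ι_mul, contr_post, eps_post] using this

theorem eps_shuffle (B : W₁ →ₗ[K] W₂ →ₗ[K] W₃) (P : ExtHom K V W₁) (Q : ExtHom K V W₂) :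
    eps (shuffle B P Q) = shuffle B (eps P) (eps Q) := by
  refine LinearMap.ext fun x => ?_
  induction x using induction_on generalizing P Q with
  | h1 => simp
  | hadd x y hx hy => rw [map_add, map_add, hx, hy]
  | hsmul r x hx => rw [map_smul, map_smul, hx]
  | hmul v x hx =>
    rw [eps_ι_mul, contr_shuffle, map_add, LinearMap.add_apply, hx, hx, shuffle_ι_mul, contr_eps,
      contr_eps]
    simp; abel

/-- Contracting either side distributes the vector over the three factors with the same signs, so
only the compatibility of the maps on values is needed. -/
theorem shuffle_assoc {W₁₂ W₂₃ : Type u} [AddCommGroup W₁₂] [Module K W₁₂] [AddCommGroup W₂₃]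
    [Module K W₂₃] {B : W₁ →ₗ[K] W₂ →ₗ[K] W₁₂} {C : W₁₂ →ₗ[K] W₃ →ₗ[K] U₁}
    {B' : W₂ →ₗ[K] W₃ →ₗ[K] W₂₃} {C' : W₁ →ₗ[K] W₂₃ →ₗ[K] U₁}
    (H : ∀ a b c, C (B a b) c = C' a (B' b c))
    (P : ExtHom K V W₁) (Q : ExtHom K V W₂) (R : ExtHom K V W₃) :
    shuffle C (shuffle B P Q) R = shuffle C' P (shuffle B' Q R) := by
  refine LinearMap.ext fun x => ?_
  induction x using induction_on generalizing P Q R with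
  | h1 => simp [H]
  | hadd x y hx hy => rw [map_add, map_add, hx, hy]
  | hsmul r x hx => rw [map_smul, map_smul, hx]
  | hmul v x hx =>
    simp only [shuffle_ι_mul, contr_shuffle, eps_shuffle, map_add, LinearMap.add_apply, hx]
    abel

theorem IsPar.shuffle {B : W₁ →ₗ[K] W₂ →ₗ[K] W₃} {p q : ℕ} {P : ExtHom K V W₁}
    {Q : ExtHom K V W₂} (hP : IsPar p P) (hQ : IsPar q Q) : IsPar (p + q) (shuffle B P Q) := by
  unfold IsPar at *
  rw [eps_shuffle, hP, hQ, pow_add]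
  simp [Units.smul_def, mul_smul]

theorem shuffle_comm (B : W₁ →ₗ[K] W₂ →ₗ[K] W₃) {p q : ℕ} {P : ExtHom K V W₁}
    {Q : ExtHom K V W₂} (hP : IsPar p P) (hQ : IsPar q Q) :
    shuffle B P Q = (-1 : ℤˣ) ^ (p * q) • shuffle B.flip Q P := by
  refine LinearMap.ext fun x => ?_
  rw [LinearMap.smul_apply]
  induction x using induction_on generalizing p q P Q with
  | h1 =>
    have h : P 1 = (-1 : ℤˣ) ^ p • P 1 := by
      rw [← LinearMap.smul_apply, ← hP, eps_one]
    -- At `1` only the degree zero part is seen. For even `q` there is no sign; for odd `q` the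
    -- required sign `(-1)^p` is absorbed by `h`.
    rcases Nat.even_or_odd q with hq | hq
    · simp [(hq.mul_left p).neg_one_pow]
    · conv_lhs => rw [shuffle_one, h]
      rw [mul_comm, pow_mul, hq.neg_one_pow, shuffle_one]
      simp [Units.smul_def]
  | hadd x y hx hy => rw [map_add, map_add, hx hP hQ, hy hP hQ, smul_add]
  | hsmul r x hx => rw [map_smul, map_smul, hx hP hQ, smul_comm]
  | hmul v x hx =>
    rw [shuffle_ι_mul, shuffle_ι_mul, hP, hQ, hx (hP.contr v) hQ]
    simp only [Units.smul_def, map_zsmul, LinearMap.smul_apply]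
    rw [hx hP (hQ.contr v), smul_add]
    simp only [add_mul, mul_add, pow_add, one_mul, mul_one]
    rcases Int.units_eq_one_or ((-1 : ℤˣ) ^ p) with h1 | h1 <;>
      rcases Int.units_eq_one_or ((-1 : ℤˣ) ^ q) with h2 | h2 <;>
      rcases Int.units_eq_one_or ((-1 : ℤˣ) ^ (p * q)) with h3 | h3 <;>
      · simp only [h1, h2, h3, Units.smul_def, Units.val_one, Units.val_neg, one_smul,
          neg_smul, mul_one, mul_neg, neg_neg]
        abel

end Shuffle

end ExtHom

namespace ExtHom

open ExteriorAlgebra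

/-! ### Opened arguments of shuffle products -/

section ShuffleMore

variable {K : Type k} {V W₁ W₂ W₃ W₁₂ W₂₃ W₁₃ U : Type u} [CommRing K] [AddCommGroup V] [Module K V]
  [AddCommGroup W₁] [Module K W₁] [AddCommGroup W₂] [Module K W₂] [AddCommGroup W₃] [Module K W₃]
  [AddCommGroup W₂₃] [Module K W₂₃] [AddCommGroup W₁₃] [Module K W₁₃] [AddCommGroup U] [Module K U]

/-- The bilinear map `(f, b) ↦ (v ↦ B (f v) b)`. -/
def openLeft (B : W₁ →ₗ[K] W₂ →ₗ[K] W₃) : HomSpace K V W₁ →ₗ[K] W₂ →ₗ[K] HomSpace K V W₃ :=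
  LinearMap.mk₂ K (fun f b => HomSpace.of (B.flip b ∘ₗ HomSpace.app f))
    (fun _ _ _ => by ext; simp) (fun _ _ _ => by ext; simp)
    (fun _ _ _ => by ext; simp) (fun _ _ _ => by ext; simp)

/-- The bilinear map `(a, g) ↦ (v ↦ B a (g v))`. -/
def openRight (B : W₁ →ₗ[K] W₂ →ₗ[K] W₃) : W₁ →ₗ[K] HomSpace K V W₂ →ₗ[K] HomSpace K V W₃ :=
  LinearMap.mk₂ K (fun a g => HomSpace.of (B a ∘ₗ HomSpace.app g))
    (fun _ _ _ => by ext; simp) (fun _ _ _ => by ext; simp)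
    (fun _ _ _ => by ext; simp) (fun _ _ _ => by ext; simp)

@[simp]
theorem openLeft_apply (B : W₁ →ₗ[K] W₂ →ₗ[K] W₃) (f : HomSpace K V W₁) (b : W₂) (v : V) :
    HomSpace.app (openLeft B f b) v = B (HomSpace.app f v) b := rfl

@[simp]
theorem openRight_apply (B : W₁ →ₗ[K] W₂ →ₗ[K] W₃) (a : W₁) (g : HomSpace K V W₂) (v : V) :
    HomSpace.app (openRight B a g) v = B a (HomSpace.app g v) := rfl

variable (K V W₁) in
/-- The bilinear map `(v, f) ↦ f v`. -/
def evalPair : V →ₗ[K] HomSpace K V W₁ →ₗ[K] W₁ := HomSpace.app.flip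

variable (K V W₁) in
/-- The exchange of the two arguments of a bilinear map. -/
def flipMap : HomSpace K V (HomSpace K V W₁) →ₗ[K] HomSpace K V (HomSpace K V W₁) where
  toFun f := HomSpace.of (HomSpace.of ∘ₗ (HomSpace.app ∘ₗ HomSpace.app f).flip)
  map_add' _ _ := by ext; simp
  map_smul' _ _ := by ext; simp

@[simp]
theorem evalPair_apply (v : V) (f : HomSpace K V W₁) : evalPair K V W₁ v f = HomSpace.app f v := rfl

@[simp]
theorem flipMap_apply (f : HomSpace K V (HomSpace K V W₁)) (v w : V) :
    HomSpace.app (HomSpace.app (flipMap K V W₁ f) v) w =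
      HomSpace.app (HomSpace.app f w) v := rfl

theorem shuffle_left_comm {C : W₁ →ₗ[K] W₂₃ →ₗ[K] U} {B : W₂ →ₗ[K] W₃ →ₗ[K] W₂₃}
    {C' : W₂ →ₗ[K] W₁₃ →ₗ[K] U} {B' : W₁ →ₗ[K] W₃ →ₗ[K] W₁₃}
    (H : ∀ a b c, C a (B b c) = C' b (B' a c)) {p q : ℕ} {P : ExtHom K V W₁}
    {Q : ExtHom K V W₂} (hP : IsPar p P) (hQ : IsPar q Q) (R : ExtHom K V W₃) :
    shuffle C P (shuffle B Q R) = (-1 : ℤˣ) ^ (p * q) • shuffle C' Q (shuffle B' P R) := by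
  -- The values of `P` and `Q` are combined into a map acting on the value of `R`; associativity
  -- then isolates the product of `P` and `Q`, where graded commutativity applies.
  let D : W₁ →ₗ[K] W₂ →ₗ[K] HomSpace K W₃ U :=
    LinearMap.mk₂ K (fun a b => HomSpace.of (C a ∘ₗ B b))
      (fun _ _ _ => by ext; simp) (fun _ _ _ => by ext; simp)
      (fun _ _ _ => by ext; simp) (fun _ _ _ => by ext; simp)
  have hD : ∀ a b c, HomSpace.app (D a b) c = C a (B b c) := fun _ _ _ => rfl
  have h1 : shuffle HomSpace.app (shuffle D P Q) R = shuffle C P (shuffle B Q R) :=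
    shuffle_assoc hD P Q R
  have h2 : shuffle HomSpace.app (shuffle D.flip Q P) R = shuffle C' Q (shuffle B' P R) :=
    shuffle_assoc (fun b a c => (LinearMap.flip_apply D a b ▸ hD a b c).trans (H a b c)) Q P R
  rw [← h1, ← h2, shuffle_comm D hP hQ]
  simp [Units.smul_def]

theorem shuffle_const_left (B : W₁ →ₗ[K] W₂ →ₗ[K] W₃) (w : W₁) (Q : ExtHom K V W₂) :
    shuffle B (const w) Q = post (B w) Q := by
  refine LinearMap.ext fun x => ?_
  induction x using induction_on generalizing Q with
  | h1 => simp
  | hadd x y hx hy => rw [map_add, map_add, hx, hy]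
  | hsmul r x hx => rw [map_smul, map_smul, hx]
  | hmul v x hx => rw [shuffle_ι_mul, contr_const, eps_const, hx]; simp

theorem shuffle_const_right (B : W₁ →ₗ[K] W₂ →ₗ[K] W₃) (P : ExtHom K V W₁) (w : W₂) :
    shuffle B P (const w) = post (B.flip w) P := by
  refine LinearMap.ext fun x => ?_
  induction x using induction_on generalizing P with
  | h1 => simp
  | hadd x y hx hy => rw [map_add, map_add, hx, hy]
  | hsmul r x hx => rw [map_smul, map_smul, hx]
  | hmul v x hx => rw [shuffle_ι_mul, contr_const, hx]; simp

theorem post_evalPair_openFirst (v : V) (P : ExtHom K V W₁) :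
    post (evalPair K V W₁ v) (openFirst P) = contr v P :=
  LinearMap.ext fun _ => rfl

theorem post_id (P : ExtHom K V W₁) : post LinearMap.id P = P := LinearMap.ext fun _ => rfl

/-- The opened vector is an argument of `P` or of `Q`: the contraction rule before the vector is
specified. -/
theorem openFirst_shuffle (B : W₁ →ₗ[K] W₂ →ₗ[K] W₃) (P : ExtHom K V W₁) (Q : ExtHom K V W₂) :
    openFirst (shuffle B P Q) =
      shuffle (openLeft B) (openFirst P) Q + shuffle (openRight B) (eps P) (openFirst Q) := by
  have h1 : ∀ v, post (evalPair K V W₃ v) (shuffle (openLeft B) (openFirst P) Q) =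
      shuffle B (contr v P) Q := fun v => by
    rw [post_shuffle (B' := B) (f := evalPair K V W₁ v) (g := LinearMap.id)
      (fun _ _ => by rw [evalPair_apply, evalPair_apply, openLeft_apply, LinearMap.id_apply]),
      post_evalPair_openFirst, post_id]
  have h2 : ∀ v, post (evalPair K V W₃ v) (shuffle (openRight B) (eps P) (openFirst Q)) =
      shuffle B (eps P) (contr v Q) := fun v => by
    rw [post_shuffle (B' := B) (f := LinearMap.id) (g := evalPair K V W₂ v)
      (fun _ _ => by rw [evalPair_apply, evalPair_apply, openRight_apply, LinearMap.id_apply]),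
      post_evalPair_openFirst, post_id]
  refine LinearMap.ext fun x => HomSpace.ext fun v => ?_
  rw [openFirst_apply, shuffle_ι_mul, ← h1, ← h2, LinearMap.add_apply, map_add, LinearMap.add_apply,
    post_apply, post_apply, evalPair_apply, evalPair_apply]

theorem shuffle_add_left (B : W₁ →ₗ[K] W₂ →ₗ[K] W₃) (P P' : ExtHom K V W₁) (Q : ExtHom K V W₂) :
    shuffle B (P + P') Q = shuffle B P Q + shuffle B P' Q := LinearMap.map_add₂ _ _ _ _

theorem shuffle_add_right (B : W₁ →ₗ[K] W₂ →ₗ[K] W₃) (P : ExtHom K V W₁) (Q Q' : ExtHom K V W₂) :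
    shuffle B P (Q + Q') = shuffle B P Q + shuffle B P Q' := map_add _ _ _

theorem shuffle_neg_right (B : W₁ →ₗ[K] W₂ →ₗ[K] W₃) (P : ExtHom K V W₁) (Q : ExtHom K V W₂) :
    shuffle B P (-Q) = -shuffle B P Q := map_neg _ _

theorem shuffle_units_smul_left (B : W₁ →ₗ[K] W₂ →ₗ[K] W₃) (u : ℤˣ) (P : ExtHom K V W₁)
    (Q : ExtHom K V W₂) : shuffle B (u • P) Q = u • shuffle B P Q := by
  simp [Units.smul_def]

theorem shuffle_units_smul_right (B : W₁ →ₗ[K] W₂ →ₗ[K] W₃) (u : ℤˣ) (P : ExtHom K V W₁)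
    (Q : ExtHom K V W₂) : shuffle B P (u • Q) = u • shuffle B P Q := by
  simp [Units.smul_def]

theorem openFirst_add (P P' : ExtHom K V W₁) :
    openFirst (P + P') = openFirst P + openFirst P' := map_add _ _ _

/-- Two opened arguments of an alternating functional anticommute. -/
theorem post_flipMap_openFirst (P : ExtHom K V W₁) :
    post (flipMap K V W₁) (openFirst (openFirst P)) = -openFirst (openFirst P) := by
  refine LinearMap.ext fun x => HomSpace.ext fun v => HomSpace.ext fun w => ?_
  rw [post_apply, flipMap_apply, LinearMap.neg_apply, map_neg, LinearMap.neg_apply, map_neg,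
    LinearMap.neg_apply]
  exact LinearMap.congr_fun (contr_contr_comm w v P) x

/-- The insertion of two functionals into the first two arguments of a third one. -/
theorem insert_two_comm {p q : ℕ} {P Q : ExtHom K V V} (hP : IsPar p P) (hQ : IsPar q Q)
    (R : ExtHom K V W₁) :
    shuffle (evalPair K V W₁) P (shuffle (openRight (evalPair K V W₁)) Q (openFirst (openFirst R))) =
      -((-1 : ℤˣ) ^ (p * q) • shuffle (evalPair K V W₁) Q
        (shuffle (openRight (evalPair K V W₁)) P (openFirst (openFirst R)))) := by
  have h2 : post LinearMap.id (shuffle ((openRight (evalPair K V W₁)).compl₂ (flipMap K V W₁)) P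
        (openFirst (openFirst R))) = shuffle (openRight (evalPair K V W₁)) (post LinearMap.id P)
        (post (flipMap K V W₁) (openFirst (openFirst R))) :=
    post_shuffle (fun _ _ => by rw [LinearMap.compl₂_apply, LinearMap.id_apply, LinearMap.id_apply])
      P (openFirst (openFirst R))
  rw [post_flipMap_openFirst, shuffle_neg_right, post_id, post_id] at h2
  rw [← smul_neg, ← shuffle_neg_right _ Q, ← h2]
  refine shuffle_left_comm (fun a b c => ?_) hP hQ _
  rw [evalPair_apply, evalPair_apply, openRight_apply, LinearMap.compl₂_apply, openRight_apply,
    evalPair_apply, evalPair_apply, flipMap_apply]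

end ShuffleMore

/-! ### The product `⋄` and its right pre-Lie identity -/

section Diamond

variable {K : Type k} {V F : Type u} [CommRing K] [AddCommGroup V] [Module K V] [AddCommGroup F] [Module K F]
  (ap : F →ₗ[K] V →ₗ[K] V) (cp : F →ₗ[K] F →ₗ[K] F)

/-- The alternatization of `Q`, in which the last argument is treated like the other ones. -/
def flat : ExtHom K V F →ₗ[K] ExtHom K V V :=
  (shuffle ap).flip proj

theorem flat_def (Q : ExtHom K V F) : flat ap Q = shuffle ap Q proj := rfl

theorem flat_add (Q R : ExtHom K V F) : flat ap (Q + R) = flat ap Q + flat ap R := map_add _ _ _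

/-- The product `P ⋄ Q`, for functionals with values in a space `F` of endomorphisms of `V` with
evaluation map `ap` and composition map `cp f g = g ∘ f`. -/
def dia : ExtHom K V F →ₗ[K] ExtHom K V F →ₗ[K] ExtHom K V F :=
  ((shuffle (evalPair K V F)).compl₁₂ (flat ap) openFirst + shuffle cp).flip

theorem dia_def (P Q : ExtHom K V F) :
    dia ap cp P Q = shuffle (evalPair K V F) (flat ap Q) (openFirst P) + shuffle cp Q P := rfl

theorem IsPar.flat {q : ℕ} {Q : ExtHom K V F} (hQ : IsPar q Q) :
    IsPar (q + 1) (flat ap Q) :=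
  hQ.shuffle isPar_proj

theorem openFirst_flat (Q : ExtHom K V F) :
    openFirst (flat ap Q) = shuffle (openLeft ap) (openFirst Q) proj +
      post ((openRight ap).flip (HomSpace.of LinearMap.id)) (eps Q) := by
  rw [flat_def, openFirst_shuffle, openFirst_proj, shuffle_const_right]

variable {ap cp}

/-- Once the last argument is treated like the others, the two parts of `⋄` merge: inserting `R` in
a first slot or in the last slot of `Q` becomes inserting `flat R` into `flat Q`. -/
theorem flat_dia (hc : ∀ f g v, ap (cp f g) v = ap g (ap f v)) {q : ℕ} {Q : ExtHom K V F}
    (hQ : IsPar q Q) (R : ExtHom K V F) :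
    flat ap (dia ap cp Q R) = shuffle (evalPair K V V) (flat ap R) (openFirst (flat ap Q)) := by
  rw [openFirst_flat, shuffle_add_right, dia_def, flat_add]
  congr 1
  · refine shuffle_assoc (fun a b c => ?_) (flat ap R) (openFirst Q) proj
    rw [evalPair_apply, evalPair_apply, openLeft_apply]
  · let B : V →ₗ[K] F →ₗ[K] HomSpace K F V :=
      LinearMap.mk₂ K (fun c b => HomSpace.of (ap b ∘ₗ ap.flip c))
        (fun _ _ _ => by ext; simp) (fun _ _ _ => by ext; simp)
        (fun _ _ _ => by ext; simp) (fun _ _ _ => by ext; simp)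
    have hB : ∀ c b a, HomSpace.app (B c b) a = ap b (ap a c) := fun _ _ _ => rfl
    have h1 : shuffle ap (shuffle cp R Q) proj =
        shuffle (evalPair K F V) R (shuffle B.flip Q proj) := by
      refine shuffle_assoc (fun a b c => ?_) _ _ _
      rw [hc, evalPair_apply, LinearMap.flip_apply, hB]
    have h2 : shuffle (evalPair K V V) (shuffle ap R proj) (post ((openRight ap).flip (HomSpace.of LinearMap.id)) (eps Q)) =
        shuffle (evalPair K F V) R (shuffle B proj (eps Q)) := by
      have h6 : shuffle ap.flip (shuffle ap R proj) (eps Q) =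
          shuffle (evalPair K F V) R (shuffle B proj (eps Q)) := by
        refine shuffle_assoc (fun a b c => ?_) _ _ _
        rw [evalPair_apply, hB, LinearMap.flip_apply]
      have h5 := post_shuffle (B := ap.flip) (B' := evalPair K V V) (f := LinearMap.id)
        (g := (openRight ap).flip (HomSpace.of LinearMap.id)) (h := LinearMap.id) (fun _ _ => by
          rw [evalPair_apply, LinearMap.id_apply, LinearMap.id_apply, LinearMap.flip_apply,
            LinearMap.flip_apply, openRight_apply, HomSpace.app_of, LinearMap.id_apply])
        (shuffle ap R proj) (eps Q)
      rw [← h6, ← post_id (shuffle ap.flip _ _), h5, post_id]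
    have h3 : shuffle B proj (eps Q) = shuffle B.flip Q proj := by
      have h4 : IsPar q (eps Q) := by
        unfold IsPar at *
        rw [hQ]
        simp [hQ, Units.smul_def]
      rw [shuffle_comm B isPar_proj h4, hQ, shuffle_units_smul_left, smul_smul, one_mul,
        ← mul_pow]
      simp
    rw [flat_def, flat_def, h1, h2, h3]

/-- The associator of `⋄` with first argument `P` collects the terms in which the other two arguments
are inserted into different arguments of `P`. -/
theorem dia_dia_sub (hc : ∀ f g v, ap (cp f g) v = ap g (ap f v))
    (ha : ∀ f g h, cp (cp f g) h = cp f (cp g h)) {q : ℕ} {Q : ExtHom K V F} (hQ : IsPar q Q)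
    (P R : ExtHom K V F) :
    dia ap cp (dia ap cp P Q) R - dia ap cp P (dia ap cp Q R) =
      shuffle (evalPair K V F) (flat ap R)
        (shuffle (openRight (evalPair K V F)) (eps (flat ap Q)) (openFirst (openFirst P))) +
      shuffle (evalPair K V F) (flat ap R) (shuffle (openRight cp) (eps Q) (openFirst P)) +
      shuffle cp R (shuffle (evalPair K V F) (flat ap Q) (openFirst P)) := by
  have h1 : shuffle (evalPair K V F) (shuffle (evalPair K V V) (flat ap R)
      (openFirst (flat ap Q))) (openFirst P) = shuffle (evalPair K V F) (flat ap R)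
        (shuffle (openLeft (evalPair K V F)) (openFirst (flat ap Q)) (openFirst P)) := by
    refine shuffle_assoc (fun a b c => ?_) _ _ _
    rw [evalPair_apply, evalPair_apply, evalPair_apply, openLeft_apply, evalPair_apply]
  have h2 : shuffle cp (shuffle (evalPair K V F) (flat ap R) (openFirst Q)) P =
      shuffle (evalPair K V F) (flat ap R) (shuffle (openLeft cp) (openFirst Q) P) := by
    refine shuffle_assoc (fun a b c => ?_) _ _ _
    rw [evalPair_apply, evalPair_apply, openLeft_apply]
  have h3 : shuffle cp (shuffle cp R Q) P = shuffle cp R (shuffle cp Q P) :=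
    shuffle_assoc ha _ _ _
  rw [dia_def ap cp (dia ap cp P Q) R, dia_def ap cp P (dia ap cp Q R), flat_dia hc hQ,
    dia_def ap cp P Q, dia_def ap cp Q R, openFirst_add, openFirst_shuffle, openFirst_shuffle]
  simp only [shuffle_add_left, shuffle_add_right]
  rw [h1, h2, h3]
  abel

theorem sign_rearrange {M : Type*} [AddCommGroup M] (X Y Z : M) (a b c : ℤˣ) :
    (a * -1) • -((c * a * (b * -1)) • X) + a • (c * a) • Y + Z =
      c • ((b * -1) • X + b • (c * b) • Z + Y) := by
  rcases Int.units_eq_one_or a with rfl | rfl <;>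
    rcases Int.units_eq_one_or b with rfl | rfl <;>
    rcases Int.units_eq_one_or c with rfl | rfl <;>
    · simp only [Units.smul_def, Units.val_one, Units.val_neg, one_smul, neg_smul, mul_one, mul_neg,
        neg_neg, smul_add, smul_neg]
      abel

/-- The associator of `⋄` is graded symmetric in its last two arguments. -/
theorem dia_dia_sub_comm (hc : ∀ f g v, ap (cp f g) v = ap g (ap f v))
    (ha : ∀ f g h, cp (cp f g) h = cp f (cp g h)) {q r : ℕ} {Q R : ExtHom K V F} (hQ : IsPar q Q)
    (hR : IsPar r R) (P : ExtHom K V F) :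
    dia ap cp (dia ap cp P Q) R - dia ap cp P (dia ap cp Q R) =
      (-1 : ℤˣ) ^ (q * r) •
        (dia ap cp (dia ap cp P R) Q - dia ap cp P (dia ap cp R Q)) := by
  have h1 := insert_two_comm (hR.flat ap) (hQ.flat ap) P
  have h3 : shuffle (evalPair K V F) (flat ap R) (shuffle (openRight cp) Q (openFirst P)) =
      (-1 : ℤˣ) ^ ((r + 1) * q) • shuffle cp Q
        (shuffle (evalPair K V F) (flat ap R) (openFirst P)) := by
    refine shuffle_left_comm (fun a b c => ?_) (hR.flat ap) hQ _
    rw [evalPair_apply, openRight_apply, evalPair_apply]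
  have h4 : shuffle (evalPair K V F) (flat ap Q) (shuffle (openRight cp) R (openFirst P)) =
      (-1 : ℤˣ) ^ ((q + 1) * r) • shuffle cp R
        (shuffle (evalPair K V F) (flat ap Q) (openFirst P)) := by
    refine shuffle_left_comm (fun a b c => ?_) (hQ.flat ap) hR _
    rw [evalPair_apply, openRight_apply, evalPair_apply]
  rw [dia_dia_sub hc ha hQ, dia_dia_sub hc ha hR, hQ.flat ap, hR.flat ap, hQ, hR]
  simp only [shuffle_units_smul_left, shuffle_units_smul_right]
  rw [h1, h3, h4]
  simp only [add_mul, mul_add, pow_add, one_mul, mul_one, pow_one, mul_comm r q]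
  generalize shuffle (evalPair K V F) (flat ap Q)
    (shuffle (openRight (evalPair K V F)) (flat ap R) (openFirst (openFirst P))) = X
  generalize shuffle cp Q (shuffle (evalPair K V F) (flat ap R) (openFirst P)) = Y
  generalize shuffle cp R (shuffle (evalPair K V F) (flat ap Q) (openFirst P)) = Z
  exact sign_rearrange X Y Z _ _ _

end Diamond

end ExtHom

/-! ### Graded Lie brackets -/

/-- A bracket on `T` that is graded for the parity given by the involution `eps`, graded skew-symmetric
and satisfies the graded Jacobi identity. -/
structure SuperLie (K T : Type*) [CommRing K] [AddCommGroup T] [Module K T] where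
  /-- The parity involution. -/
  eps : T →ₗ[K] T
  /-- The bracket. -/
  br : T →ₗ[K] T →ₗ[K] T
  eps_br : ∀ X Y, eps (br X Y) = br (eps X) (eps Y)
  skew : ∀ {p q : ℕ} {X Y : T}, eps X = (-1 : ℤˣ) ^ p • X → eps Y = (-1 : ℤˣ) ^ q • Y →
    br X Y = -((-1 : ℤˣ) ^ (p * q) • br Y X)
  leibniz : ∀ {p q r : ℕ} {X Y Z : T}, eps X = (-1 : ℤˣ) ^ p • X → eps Y = (-1 : ℤˣ) ^ q • Y →
    eps Z = (-1 : ℤˣ) ^ r • Z →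
    br (br X Y) Z = br X (br Y Z) + (-1 : ℤˣ) ^ (q * r) • br (br X Z) Y

theorem LinearMap.map_units_smul₂ {K T T' T'' : Type*} [CommRing K] [AddCommGroup T] [Module K T]
    [AddCommGroup T'] [Module K T'] [AddCommGroup T''] [Module K T''] (d : T →ₗ[K] T' →ₗ[K] T'')
    (u v : ℤˣ) (X : T) (Y : T') : d (u • X) (v • Y) = (u * v) • d X Y := by
  rcases Int.units_eq_one_or u with rfl | rfl <;> rcases Int.units_eq_one_or v with rfl | rfl <;>
    simp [Units.neg_smul]

section PreLie

variable {K T : Type*} [Field K] [CharZero K] [AddCommGroup T] [Module K T]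

/-- The graded commutator for a product `d` and a parity involution `e`. -/
def gradedCommutator (e : T →ₗ[K] T) (d : T →ₗ[K] T →ₗ[K] T) : T →ₗ[K] T →ₗ[K] T :=
  LinearMap.mk₂ K
    -- A bilinear expression with no reference to degrees: if `e` acts on `X` and `Y` by signs `a`
    -- and `b`, then `(1 + b + a - a b) / 2` is `-1` when both are `-1` and `1` otherwise, which is
    -- `(-1)^{pq}`.
    (fun X Y => d X Y - (2⁻¹ : K) • (d Y X + d (e Y) X + d Y (e X) - d (e Y) (e X)))
    (fun _ _ _ => by simp; module) (fun _ _ _ => by simp; module)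
    (fun _ _ _ => by simp; module) (fun _ _ _ => by simp; module)

theorem gradedCommutator_apply (e : T →ₗ[K] T) (d : T →ₗ[K] T →ₗ[K] T) (X Y : T) :
    gradedCommutator e d X Y =
      d X Y - (2⁻¹ : K) • (d Y X + d (e Y) X + d Y (e X) - d (e Y) (e X)) := rfl

theorem gradedCommutator_of_parity {e : T →ₗ[K] T} (d : T →ₗ[K] T →ₗ[K] T) {p q : ℕ} {X Y : T}
    (hX : e X = (-1 : ℤˣ) ^ p • X) (hY : e Y = (-1 : ℤˣ) ^ q • Y) :
    gradedCommutator e d X Y = d X Y - (-1 : ℤˣ) ^ (p * q) • d Y X := by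
  have h1 := LinearMap.map_units_smul₂ d ((-1) ^ q) 1 Y X
  have h2 := LinearMap.map_units_smul₂ d 1 ((-1) ^ p) Y X
  rw [one_smul] at h1 h2
  rw [gradedCommutator_apply, hX, hY, LinearMap.map_units_smul₂, h1, h2]
  rcases Nat.even_or_odd p with hp | hp <;> rcases Nat.even_or_odd q with hq | hq
  · simp only [hp.neg_one_pow, hq.neg_one_pow, (Even.mul_right hp q).neg_one_pow, one_smul, mul_one]
    module
  · simp only [hp.neg_one_pow, hq.neg_one_pow, (Even.mul_right hp q).neg_one_pow, one_smul, mul_one,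
      Units.neg_smul]
    module
  · simp only [hp.neg_one_pow, hq.neg_one_pow, (Even.mul_left hq p).neg_one_pow, one_smul, mul_one,
      one_mul, Units.neg_smul]
    module
  · simp only [hp.neg_one_pow, hq.neg_one_pow, (Odd.mul hp hq).neg_one_pow, one_smul, mul_one,
      mul_neg, neg_neg, Units.neg_smul]
    module

-- After expansion, the graded Jacobi identity is a signed sum of the three pre-Lie identities with
-- first argument `X`, `Y`, `Z`; the cases are the possible values of the three exchange signs.
omit [CharZero K] in
theorem gradedCommutator_leibniz_aux {a b c : ℤˣ} {X Y Z : T} (d : T →ₗ[K] T →ₗ[K] T)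
    (h1 : d (d X Y) Z - d X (d Y Z) = c • (d (d X Z) Y - d X (d Z Y)))
    (h2 : d (d Y X) Z - d Y (d X Z) = b • (d (d Y Z) X - d Y (d Z X)))
    (h3 : d (d Z X) Y - d Z (d X Y) = a • (d (d Z Y) X - d Z (d Y X))) :
    d (d X Y - a • d Y X) Z - (b * c) • d Z (d X Y - a • d Y X) =
      d X (d Y Z - c • d Z Y) - (a * b) • d (d Y Z - c • d Z Y) X +
      c • (d (d X Z - b • d Z X) Y - (a * c) • d Y (d X Z - b • d Z X)) := by
  rcases Int.units_eq_one_or a with rfl | rfl <;>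
    rcases Int.units_eq_one_or b with rfl | rfl <;>
    rcases Int.units_eq_one_or c with rfl | rfl <;>
    simp only [one_smul, Units.neg_smul, map_neg, map_sub, LinearMap.neg_apply, mul_neg, mul_one,
      neg_neg, LinearMap.sub_apply] at *
  · linear_combination (norm := module) h1 - h2 + h3
  · linear_combination (norm := module) h1 - h2 - h3
  · linear_combination (norm := module) h1 - h2 - h3
  · linear_combination (norm := module) h1 - h2 + h3
  · linear_combination (norm := module) h1 + h2 + h3
  · linear_combination (norm := module) h1 + h2 - h3
  · linear_combination (norm := module) h1 + h2 - h3
  · linear_combination (norm := module) h1 + h2 + h3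

/-- The graded Lie bracket of a graded right pre-Lie product. -/
def SuperLie.ofPreLie (e : T →ₗ[K] T) (d : T →ₗ[K] T →ₗ[K] T)
    (hed : ∀ X Y, e (d X Y) = d (e X) (e Y))
    (hd : ∀ (X : T) {Y Z : T} {q r : ℕ}, e Y = (-1 : ℤˣ) ^ q • Y → e Z = (-1 : ℤˣ) ^ r • Z →
      d (d X Y) Z - d X (d Y Z) = (-1 : ℤˣ) ^ (q * r) • (d (d X Z) Y - d X (d Z Y))) :
    SuperLie K T where
  eps := e
  br := gradedCommutator e d
  eps_br X Y := by
    simp only [gradedCommutator_apply, map_sub, map_add, map_smul, hed]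
  skew := by
    intro p q X Y hX hY
    rw [gradedCommutator_of_parity d hX hY, gradedCommutator_of_parity d hY hX, smul_sub, smul_smul,
      mul_comm q p, ← mul_pow]
    simp
  leibniz := by
    intro p q r X Y Z hX hY hZ
    have par : ∀ {p q : ℕ} {X Y : T}, e X = (-1 : ℤˣ) ^ p • X → e Y = (-1 : ℤˣ) ^ q • Y →
        e (gradedCommutator e d X Y) = (-1 : ℤˣ) ^ (p + q) • gradedCommutator e d X Y := by
      intro p q X Y hX hY
      rw [gradedCommutator_of_parity d hX hY]
      rw [map_sub, LinearMap.map_smul_of_tower, hed, hed, hX, hY, LinearMap.map_units_smul₂,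
        LinearMap.map_units_smul₂, smul_sub, pow_add, smul_comm, mul_comm ((-1 : ℤˣ) ^ q)]
    rw [gradedCommutator_of_parity d (par hX hY) hZ, gradedCommutator_of_parity d hX (par hY hZ),
      gradedCommutator_of_parity d (par hX hZ) hY, gradedCommutator_of_parity d hX hY,
      gradedCommutator_of_parity d hY hZ, gradedCommutator_of_parity d hX hZ]
    have h := gradedCommutator_leibniz_aux d (hd X hY hZ) (hd Y hX hZ) (hd Z hX hY)
    rw [add_mul, mul_add, add_mul, pow_add, pow_add, pow_add, mul_comm r q]
    exact h

end PreLie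

namespace SuperLie

variable {K T : Type*} [CommRing K] [AddCommGroup T] [Module K T] (L : SuperLie K T)

/-- The parity of an element. -/
def IsPar (p : ℕ) (X : T) : Prop := L.eps X = (-1 : ℤˣ) ^ p • X

variable {L}

theorem IsPar.br {p q : ℕ} {X Y : T} (hX : L.IsPar p X) (hY : L.IsPar q Y) :
    L.IsPar (p + q) (L.br X Y) := by
  unfold IsPar at *
  rw [L.eps_br, hX, hY, pow_add, LinearMap.map_units_smul₂]

end SuperLie

/-! ### The Matsushima–Nijenhuis bracket on functionals, and weights -/

namespace ExtHom

open ExteriorAlgebra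

section Basic

variable {K : Type k} {V F : Type u} [CommRing K] [AddCommGroup V] [Module K V] [AddCommGroup F]
  [Module K F] (ap : F →ₗ[K] V →ₗ[K] V) (cp : F →ₗ[K] F →ₗ[K] F)

theorem eps_proj : eps (proj : ExtHom K V V) = -proj := by
  have h : eps (proj : ExtHom K V V) = (-1 : ℤˣ) ^ 1 • proj := isPar_proj
  rw [h, pow_one, Units.neg_smul, one_smul]

theorem eps_flat (Q : ExtHom K V F) : eps (flat ap Q) = -flat ap (eps Q) := by
  rw [flat_def, eps_shuffle, eps_proj, shuffle_neg_right, flat_def]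

theorem shuffle_neg_neg {W₁ W₂ W₃ : Type u} [AddCommGroup W₁] [Module K W₁] [AddCommGroup W₂]
    [Module K W₂] [AddCommGroup W₃] [Module K W₃] (B : W₁ →ₗ[K] W₂ →ₗ[K] W₃) (P : ExtHom K V W₁)
    (Q : ExtHom K V W₂) : shuffle B (-P) (-Q) = shuffle B P Q := by
  rw [map_neg, map_neg, LinearMap.neg_apply, neg_neg]

theorem eps_dia (P Q : ExtHom K V F) : eps (dia ap cp P Q) = dia ap cp (eps P) (eps Q) := by
  rw [dia_def, dia_def, map_add, eps_shuffle, eps_shuffle, eps_flat, eps_openFirst, shuffle_neg_neg]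

theorem dia_const (P : ExtHom K V F) (e : F) :
    dia ap cp P (const e) =
      shuffle (evalPair K V F) (post (ap e) proj) (openFirst P) + post (cp e) P := by
  rw [dia_def, flat_def, shuffle_const_left, shuffle_const_left]

theorem dia_const_left (P : ExtHom K V F) (e : F) :
    dia ap cp (const e) P = post (cp.flip e) P := by
  rw [dia_def, openFirst_const, map_zero, zero_add, shuffle_const_right]

theorem openFirst_post_proj (m : V →ₗ[K] F) :
    openFirst (post m (proj : ExtHom K V V)) = const (HomSpace.of m) := by
  refine LinearMap.ext fun x => HomSpace.ext fun v => ?_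
  have h := LinearMap.congr_fun (contr_proj (K := K) v) x
  rw [contr_apply] at h
  rw [openFirst_apply, post_apply, h]
  simp [const]

theorem dia_post_proj (m : V →ₗ[K] F) :
    dia ap cp (post m proj) (post m proj) =
      post m (flat ap (post m proj)) + shuffle cp (post m proj) (post m proj) := by
  rw [dia_def, openFirst_post_proj, shuffle_const_right]
  rfl

theorem eps_post_proj (m : V →ₗ[K] F) :
    eps (post m (proj : ExtHom K V V)) = -post m proj := by
  rw [eps_post, eps_proj, map_neg]

theorem contr_post_proj (m : V →ₗ[K] F) (v : V) :
    contr v (post m (proj : ExtHom K V V)) = const (m v) := by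
  rw [contr_post, contr_proj]
  exact LinearMap.ext fun x => by simp [const]

theorem post_const {W₁ W₂ : Type u} [AddCommGroup W₁] [Module K W₁] [AddCommGroup W₂]
    [Module K W₂] (g : W₁ →ₗ[K] W₂) (w : W₁) : post g (const w : ExtHom K V W₁) = const (g w) :=
  LinearMap.ext fun x => by simp [const]

variable {ap cp}

/-- A bilinear product is a functional of degree one, so its `⋄`-square is determined by two
contractions; these give the expression in `hm`, which for `ap` and `cp` evaluation and composition
is the pre-Lie identity. -/
theorem dia_post_proj_eq_zero {m : V →ₗ[K] F}
    (hm : ∀ v w, m (ap (m v) w) - m (ap (m w) v) + cp (m v) (m w) - cp (m w) (m v) = 0) :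
    dia ap cp (post m proj) (post m proj) = 0 := by
  rw [dia_post_proj]
  refine ext_contr ?_ fun v => ext_contr ?_ fun w => ?_
  · rw [LinearMap.add_apply, post_apply, flat_def, shuffle_one, shuffle_one, post_apply, proj_one,
      map_zero, map_zero, map_zero, add_zero, LinearMap.zero_apply]
  · rw [map_add, contr_post, contr_shuffle, contr_post_proj, shuffle_const_left, eps_post_proj,
      shuffle_const_right, flat_def, contr_shuffle, contr_post_proj, shuffle_const_left,
      eps_post_proj, contr_proj, shuffle_const_right]
    simp
  · rw [map_add, contr_post, contr_shuffle, contr_post_proj, shuffle_const_left, eps_post_proj,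
      shuffle_const_right, flat_def, contr_shuffle, contr_post_proj, shuffle_const_left,
      eps_post_proj, contr_proj, shuffle_const_right]
    simp only [map_add, map_neg, contr_post, contr_proj, post_const, map_zero]
    rw [LinearMap.flip_apply, LinearMap.flip_apply, ← map_zero const, ← hm v w]
    simp only [map_add, map_sub]
    abel

end Basic

section Comp

variable (K : Type k) (V : Type u) [CommRing K] [AddCommGroup V] [Module K V]

/-- The composition in the opposite order. -/
def _root_.HomSpace.comp : HomSpace K V V →ₗ[K] HomSpace K V V →ₗ[K] HomSpace K V V :=
  LinearMap.mk₂ K (fun f g => HomSpace.of (HomSpace.app g ∘ₗ HomSpace.app f))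
    (fun _ _ _ => by ext; simp) (fun _ _ _ => by ext; simp)
    (fun _ _ _ => by ext; simp) (fun _ _ _ => by ext; simp)

variable {K V} in
@[simp]
theorem _root_.HomSpace.app_comp (f g : HomSpace K V V) (v : V) :
    HomSpace.app (HomSpace.comp K V f g) v = HomSpace.app g (HomSpace.app f v) := rfl

end Comp

section Bracket

variable (K : Type k) (V : Type u) [Field K] [CharZero K] [AddCommGroup V] [Module K V]

/-- The Matsushima–Nijenhuis bracket for functionals on the exterior algebra. -/
def mn : SuperLie K (ExtHom K V (HomSpace K V V)) :=
  SuperLie.ofPreLie eps (dia HomSpace.app (HomSpace.comp K V)) (eps_dia _ _)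
    (fun X _ _ _ _ hY hZ => dia_dia_sub_comm (fun _ _ _ => by rw [HomSpace.app_comp])
      (fun _ _ _ => HomSpace.ext fun _ => by simp only [HomSpace.app_comp]) hY hZ X)

variable {K V}

theorem mn_br {p q : ℕ} {X Y : ExtHom K V (HomSpace K V V)} (hX : IsPar p X) (hY : IsPar q Y) :
    (mn K V).br X Y = dia HomSpace.app (HomSpace.comp K V) X Y -
      (-1 : ℤˣ) ^ (p * q) • dia HomSpace.app (HomSpace.comp K V) Y X :=
  gradedCommutator_of_parity _ hX hY

/-- The bracket with an endomorphism. -/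
def weight (e : V →ₗ[K] V) (X : ExtHom K V (HomSpace K V V)) : ExtHom K V (HomSpace K V V) :=
  (mn K V).br X (const (HomSpace.of e))

/-- Explicitly, `e` is inserted into each argument of `X` in turn, the last one included, and the
composition of the value with `e` is subtracted. -/
theorem weight_eq (e : V →ₗ[K] V) (X : ExtHom K V (HomSpace K V V)) :
    weight e X = shuffle (evalPair K V _) (post e proj) (openFirst X) +
      post (HomSpace.comp K V (HomSpace.of e) - (HomSpace.comp K V).flip (HomSpace.of e)) X := by
  have h : weight e X = dia HomSpace.app (HomSpace.comp K V) X (const (HomSpace.of e)) -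
      dia HomSpace.app (HomSpace.comp K V) (const (HomSpace.of e)) X := by
    refine (gradedCommutator_apply _ _ _ _).trans ?_
    rw [eps_const]
    module
  rw [h, dia_const, dia_const_left, HomSpace.app_of, add_sub_assoc]
  rfl

/-- The engine of the weight inductions: contraction with a vector killed by `e` preserves weights,
contraction with a vector fixed by `e` lowers them by one. -/
theorem contr_weight (e : V →ₗ[K] V) (X : ExtHom K V (HomSpace K V V)) (v : V) :
    contr v (weight e X) = weight e (contr v X) + contr (e v) X := by
  rw [weight_eq, weight_eq, map_add, contr_shuffle, contr_post_proj, shuffle_const_left,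
    post_evalPair_openFirst, eps_post_proj, contr_openFirst, shuffle_neg_neg, contr_post]
  abel

theorem weight_one (e : V →ₗ[K] V) (X : ExtHom K V (HomSpace K V V)) :
    HomSpace.app (weight e X 1) = HomSpace.app (X 1) ∘ₗ e - e ∘ₗ HomSpace.app (X 1) := by
  rw [weight_eq, LinearMap.add_apply, shuffle_one, post_apply, proj_one, post_apply]
  ext v
  simp

theorem weight_const (e : V →ₗ[K] V) (f : HomSpace K V V) :
    weight e (const f) = const (HomSpace.of (HomSpace.app f ∘ₗ e - e ∘ₗ HomSpace.app f)) := by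
  rw [weight_eq, openFirst_const, map_zero, zero_add, post_const]
  congr 1
  exact HomSpace.ext fun v => by simp

theorem weight_post_proj (e : V →ₗ[K] V) {m : V →ₗ[K] HomSpace K V V} {c : K}
    (hm : ∀ v w, HomSpace.app (m v) (e w) - e (HomSpace.app (m v) w) +
      HomSpace.app (m (e v)) w = c • HomSpace.app (m v) w) :
    weight e (post m proj) = c • post m proj := by
  refine ext_contr ?_ fun v => ?_
  · have h : (post m proj : ExtHom K V (HomSpace K V V)) 1 = 0 := by simp
    refine HomSpace.ext fun w => ?_
    rw [weight_one, LinearMap.smul_apply, h]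
    simp
  · rw [contr_weight, map_smul, contr_post_proj, contr_post_proj, weight_const, ← map_add,
      ← map_smul]
    congr 1
    refine HomSpace.ext fun w => ?_
    simpa using hm v w

variable {e e' : V →ₗ[K] V} (he : ∀ v, e (e v) = e v) (hee : ∀ v, e v + e' v = v)

omit [CharZero K] in
include he hee in
theorem comp_eq_zero : (∀ v, e (e' v) = 0) ∧ (∀ v, e' (e v) = 0) ∧ ∀ v, e' (e' v) = e' v := by
  have h1 : ∀ v, e' v = v - e v := fun v => eq_sub_of_add_eq' (hee v)
  refine ⟨fun v => ?_, fun v => ?_, fun v => ?_⟩ <;> simp [h1, he]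

include he hee in
/-- No functional has weight `-2` or less. -/
theorem eq_zero_of_weight {c : ℕ} (hc : 2 ≤ c) {X : ExtHom K V (HomSpace K V V)}
    (hX : weight e X = -(c : K) • X) : X = 0 := by
  obtain ⟨h1, h2, h3⟩ := comp_eq_zero he hee
  refine LinearMap.ext fun x => ?_
  rw [LinearMap.zero_apply]
  induction x using induction_on generalizing X c with
  | h1 =>
    have h := congrArg HomSpace.app (LinearMap.congr_fun hX 1)
    rw [weight_one, LinearMap.smul_apply, map_smul] at h
    refine HomSpace.ext fun v => ?_
    set f := HomSpace.app (X 1) with hf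
    have h' : ∀ w, f (e w) - e (f w) = -(c : K) • f w := fun w => LinearMap.congr_fun h w
    -- On endomorphisms the only weights are `1, 0, -1`. The scalars `c + 1`, `c` and `c - 1` appear
    -- as factors of the four blocks of `f` relative to `e` and `e'`, and `c ≥ 2` makes them
    -- invertible.
    have hc0 : (c : K) ≠ 0 := by exact_mod_cast (by omega : c ≠ 0)
    have hc1 : (c : K) - 1 ≠ 0 := by
      rw [sub_ne_zero]; exact_mod_cast (by omega : c ≠ 1)
    have hc2 : (c : K) + 1 ≠ 0 := by exact_mod_cast (by omega : c + 1 ≠ 0)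
    have e1 : f (e v) = 0 := by
      have a1 := h' (e v)
      rw [he] at a1
      have a2 := congrArg e a1
      rw [map_sub, he, sub_self, map_smul] at a2
      have a3 : e (f (e v)) = 0 := by
        rcases smul_eq_zero.1 a2.symm with h | h
        · exact absurd (neg_eq_zero.1 h) hc0
        · exact h
      rw [a3, sub_zero] at a1
      have : ((c : K) + 1) • f (e v) = 0 := by rw [add_smul, one_smul]; nth_rw 2 [a1]; module
      exact (smul_eq_zero.1 this).resolve_left hc2
    have e2 : f (e' v) = 0 := by
      have a1 := h' (e' v)
      rw [h1, map_zero, zero_sub] at a1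
      have a2 := congrArg e a1
      rw [map_neg, he, map_smul] at a2
      have a3 : e (f (e' v)) = 0 := by
        have : ((c : K) - 1) • e (f (e' v)) = 0 := by
          rw [sub_smul, one_smul, sub_eq_zero]
          rw [neg_smul, neg_inj] at a2
          exact a2.symm
        exact (smul_eq_zero.1 this).resolve_left hc1
      rw [a3, neg_zero] at a1
      rcases smul_eq_zero.1 a1.symm with h | h
      · exact absurd (neg_eq_zero.1 h) hc0
      · exact h
    rw [← hee v, map_add, e1, e2]
    simp
  | hadd x y hx hy => rw [map_add, hx hc hX, hy hc hX, add_zero]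
  | hsmul r x hx => rw [map_smul, hx hc hX, smul_zero]
  | hmul v x hx =>
    have key : ∀ v, weight e (contr v X) = -(c : K) • contr v X - contr (e v) X := fun v => by
      rw [← map_smul, ← hX, contr_weight, add_sub_cancel_right]
    have k1 := key (e v)
    have k2 := key (e' v)
    rw [h1, map_zero, LinearMap.zero_apply, sub_zero] at k2
    rw [he] at k1
    -- A `g₁`-argument has been used up, so the weight drops to `-(c + 1)`; hence the induction for
    -- all `c` at once.
    have k3 : weight e (contr (e v) X) = -((c + 1 : ℕ) : K) • contr (e v) X := by
      rw [k1]; push_cast; module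
    rw [← contr_apply, ← hee v, map_add, LinearMap.add_apply, LinearMap.add_apply,
      hx (by omega) k3, hx hc k2, add_zero]

/-- The functional `x ↦ e ∘ X (e' x) ∘ e'`. -/
def conj (e e' : V →ₗ[K] V) :
    ExtHom K V (HomSpace K V V) →ₗ[K] ExtHom K V (HomSpace K V V) where
  toFun X := (HomSpace.of ∘ₗ e.compRight K ∘ₗ LinearMap.lcomp K V e' ∘ₗ HomSpace.app) ∘ₗ X ∘ₗ
    (ExteriorAlgebra.map e').toLinearMap
  map_add' _ _ := by ext; simp
  map_smul' _ _ := by ext; simp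

omit [CharZero K] in
theorem conj_apply (e e' : V →ₗ[K] V) (X : ExtHom K V (HomSpace K V V)) (x : ExteriorAlgebra K V)
    (v : V) : HomSpace.app (conj e e' X x) v =
      e (HomSpace.app (X (ExteriorAlgebra.map e' x)) (e' v)) := rfl

omit [CharZero K] in
theorem contr_conj (e e' : V →ₗ[K] V) (X : ExtHom K V (HomSpace K V V)) (v : V) :
    contr v (conj e e' X) = conj e e' (contr (e' v) X) :=
  LinearMap.ext fun x => HomSpace.ext fun w => by
    rw [contr_apply, conj_apply, conj_apply, contr_apply, map_mul, ExteriorAlgebra.map_apply_ι]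

-- Such a functional accepts no arguments from the image of `e` and takes values there, so only the
-- output counts.
include he hee in
theorem weight_conj (X : ExtHom K V (HomSpace K V V)) :
    weight e (conj e e' X) = -conj e e' X := by
  obtain ⟨h1, h2, h3⟩ := comp_eq_zero he hee
  refine LinearMap.ext fun x => ?_
  rw [LinearMap.neg_apply]
  induction x using induction_on generalizing X with
  | h1 =>
    refine HomSpace.ext fun v => ?_
    rw [weight_one, map_neg, LinearMap.neg_apply, LinearMap.sub_apply, LinearMap.comp_apply,
      LinearMap.comp_apply, conj_apply, conj_apply, h2, map_zero, map_zero, he, zero_sub]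
  | hadd x y hx hy => rw [map_add, map_add, hx, hy, neg_add]
  | hsmul r x hx => rw [map_smul, map_smul, hx, smul_neg]
  | hmul v x hx =>
    rw [← contr_apply, ← contr_apply, contr_weight, contr_conj, contr_conj, h2,
      LinearMap.add_apply, hx]
    simp

-- Filling an argument from the image of `e` would lower the weight to `-2`, where nothing lives; so
-- all arguments may be replaced by their `e'`-parts. In degree zero the equation `f e - e f = -f`
-- forces `f e = 0` and `e f = f`.
include he hee in
theorem conj_of_weight {X : ExtHom K V (HomSpace K V V)} (hX : weight e X = -X) :
    conj e e' X = X := by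
  obtain ⟨h1, h2, h3⟩ := comp_eq_zero he hee
  refine LinearMap.ext fun x => ?_
  induction x using induction_on generalizing X with
  | h1 =>
    have h := congrArg HomSpace.app (LinearMap.congr_fun hX 1)
    rw [weight_one, LinearMap.neg_apply, map_neg] at h
    refine HomSpace.ext fun v => ?_
    rw [conj_apply, map_one]
    set f := HomSpace.app (X 1) with hf
    have h' : ∀ w, f (e w) - e (f w) = -f w := fun w => LinearMap.congr_fun h w
    have a1 : f (e v) = 0 := by
      have a1 := h' (e v)
      rw [he] at a1
      have a2 := congrArg e a1
      rw [map_sub, he, sub_self, map_neg, eq_comm, neg_eq_zero] at a2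
      rw [a2, sub_zero] at a1
      have : (2 : K) • f (e v) = 0 := by rw [two_smul]; nth_rw 1 [a1]; exact neg_add_cancel _
      exact (smul_eq_zero.1 this).resolve_left two_ne_zero
    have a3 := h' v
    rw [a1, zero_sub, neg_inj] at a3
    have a4 : f v = f (e' v) := by nth_rw 1 [← hee v]; rw [map_add, a1, zero_add]
    rw [← a4, a3]
  | hadd x y hx hy => rw [map_add, map_add, hx hX, hy hX]
  | hsmul r x hx => rw [map_smul, map_smul, hx hX]
  | hmul v x hx =>
    have key : ∀ v, weight e (contr v X) = -contr v X - contr (e v) X := fun v => by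
      rw [← map_neg, ← hX, contr_weight, add_sub_cancel_right]
    have k1 := key (e v)
    have k2 := key (e' v)
    rw [h1, map_zero, LinearMap.zero_apply, sub_zero] at k2
    rw [he] at k1
    have k3 : contr (e v) X = 0 := eq_zero_of_weight he hee le_rfl (by rw [k1]; push_cast; module)
    have k4 : contr v X = contr (e' v) X := by
      conv_lhs => rw [← hee v, map_add, LinearMap.add_apply, k3, zero_add]
    rw [← contr_apply, ← contr_apply, contr_conj, hx k2, k4]

/-- Bracketing with the even element `e` is a derivation, by the graded Leibniz identity, so weights
add. -/
theorem weight_br {p q : ℕ} {X Y : ExtHom K V (HomSpace K V V)} (hX : IsPar p X) (hY : IsPar q Y)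
    {a b : K} (ha : weight e X = a • X) (hb : weight e Y = b • Y) :
    weight e ((mn K V).br X Y) = (a + b) • (mn K V).br X Y := by
  have h := (mn K V).leibniz hX hY (isPar_const (HomSpace.of e))
  rw [mul_zero, pow_zero, one_smul] at h
  have ha' : (mn K V).br X (const (HomSpace.of e)) = a • X := ha
  have hb' : (mn K V).br Y (const (HomSpace.of e)) = b • Y := hb
  rw [ha', hb', map_smul, map_smul, LinearMap.smul_apply, add_comm, ← add_smul] at h
  exact h

/-- Eigenvectors for distinct eigenvalues are independent; the eigenvalues `0, …, n - 1` are
distinct in characteristic zero. -/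
theorem eq_zero_of_sum_weight {n : ℕ} {A : ℕ → ExtHom K V (HomSpace K V V)}
    (hA : ∀ i, weight e (A i) = (i : K) • A i) (h : ∑ i ∈ Finset.range n, A i = 0) :
    ∀ i < n, A i = 0 := by
  induction n generalizing A with
  | zero => exact fun i hi => absurd hi (Nat.not_lt_zero i)
  | succ n ih =>
    have hw : ∀ (c : K) (i : ℕ), weight e (c • A i) = (i : K) • c • A i := fun c i => by
      rw [weight, map_smul, LinearMap.smul_apply, smul_comm]
      exact congrArg _ (hA i)
    have h1 := congrArg (weight e) h
    have h2 : weight e (∑ i ∈ Finset.range (n + 1), A i) =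
        ∑ i ∈ Finset.range (n + 1), (i : K) • A i := by
      rw [weight, map_sum, LinearMap.sum_apply]
      exact Finset.sum_congr rfl fun i _ => hA i
    rw [h2, weight, map_zero, LinearMap.zero_apply] at h1
    -- Applying the weight operator minus `n` removes the last summand and rescales the others by
    -- nonzero factors.
    have h3 : ∑ i ∈ Finset.range n, ((i : K) - n) • A i = 0 := by
      have := congrArg (fun z => (n : K) • z) h
      simp only [smul_zero, Finset.smul_sum] at this
      rw [Finset.sum_range_succ] at h1 this
      simp only [sub_smul, Finset.sum_sub_distrib]
      rw [eq_neg_of_add_eq_zero_left h1, eq_neg_of_add_eq_zero_left this, sub_self]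
    have h4 : ∀ i < n, A i = 0 := fun i hi => by
      have := ih (fun i => hw _ i) h3 i hi
      refine (smul_eq_zero.1 this).resolve_left ?_
      rw [sub_eq_zero]
      exact_mod_cast hi.ne
    intro i hi
    rcases (Nat.lt_succ_iff.1 hi).lt_or_eq with hi | rfl
    · exact h4 i hi
    · rwa [Finset.sum_range_succ, Finset.sum_eq_zero fun j hj => h4 j (Finset.mem_range.1 hj),
        zero_add] at h

end Bracket

end ExtHom

/-! ### Sums over three-block unshuffles -/

section ThreeBlocks

open Equiv

variable {α M : Type*} [AddCommGroup M]

theorem splitSum_zero_left (s : α → α → ℤˣ) (l : List α) (H : List α → List α → M) :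
    splitSum s 0 l H = H [] l := by
  induction l generalizing H with
  | nil => rfl
  | cons y l ih => simp [splitSum, ih]

theorem unshuffles_congr {n : ℕ} {b b' : Fin n → ℕ} (h : ∀ i j, b i = b j ↔ b' i = b' j) :
    unshuffles b = unshuffles b' := by
  simp only [unshuffles, h]

theorem sum_unshuffles_twoBlocks_sign {n p : ℕ} (hp : p ≤ n) (y : Fin n → α)
    (H : List α → List α → M) :
    ∑ σ ∈ unshuffles (twoBlocks p), Perm.sign σ •
        H ((List.ofFn (y ∘ σ)).take p) ((List.ofFn (y ∘ σ)).drop p) =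
      splitSum (fun _ _ => -1) p (List.ofFn y) H := by
  have h := sum_unshuffles_twoBlocks (fun _ => (0 : ℤ)) hp y H
  simp only [mul_zero, Int.negOnePow_zero] at h
  rw [← h]
  exact Finset.sum_congr rfl fun σ _ => by rw [sign_eq_koszulSign]; rfl

theorem threeBlocks_comp_succAbove_zero (q n : ℕ) :
    (threeBlocks (q + 1) : Fin (n + 1) → ℕ) ∘ (0 : Fin (n + 1)).succAbove = threeBlocks q := by
  funext i
  simp [threeBlocks]

theorem threeBlocks_comp_succAbove_succ {q n : ℕ} (hq : q + 1 < n + 1) :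
    (threeBlocks q : Fin (n + 1) → ℕ) ∘ (⟨q + 1, hq⟩ : Fin (n + 1)).succAbove =
      threeBlocks q := by
  funext i
  simp only [threeBlocks, Function.comp_apply, Fin.succAbove, Fin.lt_def, Fin.val_castSucc]
  split_ifs <;> (simp_all; try omega)

/-- Deleting the middle block, a single position, leaves two blocks, labelled `0` and `2` instead of
`0` and `1`. -/
theorem unshuffles_threeBlocks_comp_succAbove {q n : ℕ} (hq : q < n + 1) :
    unshuffles ((threeBlocks q : Fin (n + 1) → ℕ) ∘ (⟨q, hq⟩ : Fin (n + 1)).succAbove) =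
      unshuffles (twoBlocks q) := by
  have h : ∀ i : Fin n, ((threeBlocks q : Fin (n + 1) → ℕ) ∘ (⟨q, hq⟩ : Fin (n + 1)).succAbove) i =
      2 * twoBlocks q i := by
    intro i
    simp only [threeBlocks, twoBlocks, Function.comp_apply, Fin.succAbove, Fin.lt_def,
      Fin.val_castSucc]
    split_ifs <;> (simp_all; try omega)
  exact unshuffles_congr fun i j => by rw [h, h]; omega

theorem forall_lt_threeBlocks_ne_iff {q n : ℕ} (c : Fin (n + 1)) :
    (∀ i < c, threeBlocks q i ≠ threeBlocks q c) ↔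
      (c : ℕ) = 0 ∨ (c : ℕ) = q ∨ (c : ℕ) = q + 1 := by
  constructor
  · intro h
    by_contra! hc
    rcases lt_or_ge (c : ℕ) q with hlt | hge
    · refine h 0 (Fin.pos_of_ne_zero fun h0 => hc.1 (by simp [h0])) ?_
      have : 0 < q := by omega
      simp [threeBlocks, hlt, this]
    · refine h ⟨q + 1, by omega⟩ (by rw [Fin.lt_def]; simp; omega) ?_
      have h1 : ¬ (c : ℕ) < q := by omega
      simp [threeBlocks, h1, hc.2.1]
  · intro h i hi
    rw [Fin.lt_def] at hi
    unfold threeBlocks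
    split_ifs <;> omega

/-- The three summands are the cases in which `0` opens the first, middle or last block; the
conditions exclude an empty first or last block. -/
theorem sum_unshuffles_threeBlocks_rec {n q : ℕ} (hq : q < n + 1) (f : Perm (Fin (n + 1)) → M) :
    ∑ σ ∈ unshuffles (threeBlocks q), f σ =
      (if 0 < q then ∑ τ ∈ unshuffles (threeBlocks (q - 1)), f (insertZero 0 τ) else 0) +
      (∑ τ ∈ unshuffles (twoBlocks q), f (insertZero ⟨q, hq⟩ τ) +
      if h : q + 1 < n + 1 then
        ∑ τ ∈ unshuffles (threeBlocks q), f (insertZero ⟨q + 1, h⟩ τ) else 0) := by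
  classical
  rw [sum_unshuffles_eq_sum_insertZero, Finset.sum_filter]
  set g : Fin (n + 1) → M := fun c =>
    ∑ τ ∈ unshuffles (threeBlocks q ∘ c.succAbove), f (insertZero c τ) with hg
  have h1 : ∀ c : Fin (n + 1), (if ∀ i < c, threeBlocks q i ≠ threeBlocks q c then g c else 0) =
      (if c = 0 then if 0 < q then g c else 0 else 0) + ((if c = ⟨q, hq⟩ then g c else 0) +
        if (c : ℕ) = q + 1 then g c else 0) := by
    intro c
    rw [if_congr (forall_lt_threeBlocks_ne_iff c) rfl rfl]
    simp only [Fin.ext_iff, Fin.val_zero]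
    split_ifs <;> first | omega | simp
  rw [Finset.sum_congr rfl fun c _ => h1 c, Finset.sum_add_distrib, Finset.sum_add_distrib,
    Finset.sum_ite_eq' , Finset.sum_ite_eq']
  simp only [Finset.mem_univ, if_true]
  congr 1
  · by_cases h : 0 < q
    · obtain ⟨q, rfl⟩ := Nat.exists_eq_succ_of_ne_zero h.ne'
      rw [if_pos h, if_pos h, hg]
      simp only [Nat.succ_eq_add_one, threeBlocks_comp_succAbove_zero, Nat.add_sub_cancel]
    · rw [if_neg h, if_neg h]
  · congr 1
    · rw [hg]
      simp only [unshuffles_threeBlocks_comp_succAbove]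
    · by_cases h : q + 1 < n + 1
      · rw [dif_pos h, Finset.sum_eq_single ⟨q + 1, h⟩]
        · simp only [hg, if_true, threeBlocks_comp_succAbove_succ]
        · intro c _ hc
          exact if_neg fun h' => hc (Fin.ext h')
        · simp
      · rw [dif_neg h]
        exact Finset.sum_eq_zero fun c _ => if_neg (by omega)

/-- A three-block unshuffle is a choice of the first block followed by a choice of one of the
remaining letters. -/
theorem sum_unshuffles_threeBlocks {n q : ℕ} (hq : q < n) (y : Fin n → α)
    (H : List α → List α → M) :
    ∑ σ ∈ unshuffles (threeBlocks q), Perm.sign σ •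
        H ((List.ofFn (y ∘ σ)).take (q + 1)) ((List.ofFn (y ∘ σ)).drop (q + 1)) =
      splitSum (fun _ _ => -1) q (List.ofFn y) fun I J =>
        splitSum (fun _ _ => -1) 1 J fun I' J' => H (I ++ I') J' := by
  induction n generalizing q H with
  | zero => exact absurd hq (Nat.not_lt_zero q)
  | succ n ih =>
    set t := List.ofFn (Fin.tail y) with ht
    rw [show List.ofFn y = y 0 :: t from List.ofFn_succ, sum_unshuffles_threeBlocks_rec hq]
    have hlen : ∀ (m : ℕ) (_ : m ≤ n) (τ : Perm (Fin n)),
        ((List.ofFn (Fin.tail y ∘ τ)).take m).length = m := fun m hm τ => by simp [hm]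
    have h2 : ∑ τ ∈ unshuffles (twoBlocks q), Perm.sign (insertZero ⟨q, hq⟩ τ) •
        H ((List.ofFn (y ∘ insertZero ⟨q, hq⟩ τ)).take (q + 1))
          ((List.ofFn (y ∘ insertZero ⟨q, hq⟩ τ)).drop (q + 1)) =
        splitSum (fun _ _ => -1) q t fun I J => (-1 : ℤˣ) ^ q • H (I ++ [y 0]) J := by
      rw [ht, ← sum_unshuffles_twoBlocks_sign (Nat.lt_succ_iff.1 hq)]
      refine Finset.sum_congr rfl fun τ _ => ?_
      have hl := hlen q (by omega) τ
      rw [ofFn_comp_insertZero, sign_insertZero, mul_comm, mul_smul, ← List.singleton_append,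
        ← List.append_assoc, List.take_left' (by simp [hl]), List.drop_left' (by simp [hl])]
    have h3 : (if h : q + 1 < n + 1 then
        ∑ τ ∈ unshuffles (threeBlocks q), Perm.sign (insertZero ⟨q + 1, h⟩ τ) •
          H ((List.ofFn (y ∘ insertZero ⟨q + 1, h⟩ τ)).take (q + 1))
            ((List.ofFn (y ∘ insertZero ⟨q + 1, h⟩ τ)).drop (q + 1)) else 0) =
        splitSum (fun _ _ => -1) q t fun I J => splitSum (fun _ _ => -1) 1 J fun I' J' =>
          (-1 : ℤˣ) ^ (q + 1) • H (I ++ I') (y 0 :: J') := by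
      split_ifs with h
      · rw [ht, ← ih (Nat.lt_of_succ_lt_succ h) (Fin.tail y)
          fun I J => (-1 : ℤˣ) ^ (q + 1) • H I (y 0 :: J)]
        refine Finset.sum_congr rfl fun τ _ => ?_
        have hl := hlen (q + 1) (by omega) τ
        rw [ofFn_comp_insertZero, sign_insertZero, mul_comm, mul_smul, List.take_left' hl,
          List.drop_left' hl]
      · refine (splitSum_eq_zero fun I J hIJ hI => splitSum_of_length_lt ?_ _).symm
        have := hIJ.length_eq
        simp only [List.length_append, ht, List.length_ofFn] at this
        omega
    -- If the first letter is not in the first block, it is either the singled-out letter, having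
    -- passed `q` letters, or it lies in the last block, having passed `q + 1`.
    have h4 : (splitSum (fun _ _ => -1) q t fun I J =>
          (I.map fun _ => (-1 : ℤˣ)).prod • splitSum (fun _ _ => -1) 1 (y 0 :: J) fun I' J' =>
            H (I ++ I') J') =
        (splitSum (fun _ _ => -1) q t fun I J => (-1 : ℤˣ) ^ q • H (I ++ [y 0]) J) +
        splitSum (fun _ _ => -1) q t fun I J => splitSum (fun _ _ => -1) 1 J fun I' J' =>
          (-1 : ℤˣ) ^ (q + 1) • H (I ++ I') (y 0 :: J') := by
      rw [← splitSum_add]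
      refine splitSum_congr fun I J _ hI => ?_
      have e : ∀ I : List α, (I.map fun _ => (-1 : ℤˣ)).prod = (-1) ^ I.length := fun I => by simp
      rw [splitSum, smul_add, splitSum_zero_left, e, hI]
      congr 1
      rw [← splitSum_smul]
      refine splitSum_congr fun I' J' _ hI' => ?_
      rw [e, hI', smul_smul, ← pow_add]
    rw [h2, h3, ← h4]
    cases q with
    | zero => simp [splitSum]
    | succ q =>
      rw [splitSum, if_pos (Nat.succ_pos q)]
      congr 1
      rw [ht]
      refine Eq.trans ?_ (ih (Nat.lt_of_succ_lt_succ hq) (Fin.tail y) fun I J => H (y 0 :: I) J)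
      refine Finset.sum_congr rfl fun τ _ => ?_
      rw [ofFn_comp_insertZero, sign_insertZero]
      simp

end ThreeBlocks

theorem List.take_ofFn_eq {α : Type*} {n m : ℕ} (h : m ≤ n) (f : Fin n → α) :
    (List.ofFn f).take m = List.ofFn fun a : Fin m => f ⟨a, by omega⟩ :=
  List.ext_getElem (by simp [h]) fun i _ _ => by simp

theorem List.drop_ofFn_eq {α : Type*} {n m k : ℕ} (h : n = m + k) (f : Fin n → α) :
    (List.ofFn f).drop m = List.ofFn fun c : Fin k => f ⟨m + c, by omega⟩ :=
  List.ext_getElem (by simp; omega) fun i _ _ => by simp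

/-! ### Comparison of cochains with functionals -/

namespace ExtHom

open ExteriorAlgebra

section Degree

variable {K : Type k} {V W W₁ W₂ W₃ : Type u} [CommRing K] [AddCommGroup V] [Module K V]
  [AddCommGroup W] [Module K W] [AddCommGroup W₁] [Module K W₁] [AddCommGroup W₂] [Module K W₂]
  [AddCommGroup W₃] [Module K W₃]

variable (K) in
/-- The product of a list of vectors in the exterior algebra. -/
def lprod (l : List V) : ExteriorAlgebra K V := (l.map (ι K)).prod

@[simp]
theorem lprod_nil : lprod K ([] : List V) = 1 := rfl

@[simp]
theorem lprod_cons (v : V) (l : List V) : lprod K (v :: l) = ι K v * lprod K l := by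
  simp [lprod]

theorem lprod_ofFn {n : ℕ} (x : Fin n → V) : lprod K (List.ofFn x) = ιMulti K n x := by
  rw [lprod, List.map_ofFn, ιMulti_apply]
  rfl

theorem eq_zero_of_lprod {X : ExtHom K V W} (h : ∀ l, X (lprod K l) = 0) : X = 0 := by
  refine LinearMap.ext fun x => ?_
  rw [LinearMap.zero_apply]
  induction x using induction_on generalizing X with
  | h1 => exact h []
  | hadd x y hx hy => rw [map_add, hx h, hy h, add_zero]
  | hsmul r x hx => rw [map_smul, hx h, smul_zero]
  | hmul v x hx =>
    rw [← contr_apply, hx]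
    intro l
    rw [contr_apply, ← lprod_cons]
    exact h _

theorem ext_lprod {X Y : ExtHom K V W} (h : ∀ l, X (lprod K l) = Y (lprod K l)) : X = Y :=
  sub_eq_zero.1 (eq_zero_of_lprod fun l => by rw [LinearMap.sub_apply, h, sub_self])

/-- The functional is an alternating map of degree `n`. -/
def IsDeg (n : ℕ) (X : ExtHom K V W) : Prop := ∀ l : List V, l.length ≠ n → X (lprod K l) = 0

theorem IsDeg.ext {n : ℕ} {X Y : ExtHom K V W} (hX : IsDeg n X) (hY : IsDeg n Y)
    (h : ∀ x : Fin n → V, X (lprod K (List.ofFn x)) = Y (lprod K (List.ofFn x))) : X = Y :=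
  ext_lprod fun l => by
    by_cases hl : l.length = n
    · subst hl
      simpa using h l.get
    · rw [hX l hl, hY l hl]

theorem IsDeg.contr_eq_zero {X : ExtHom K V W} (hX : IsDeg 0 X) (v : V) : contr v X = 0 :=
  eq_zero_of_lprod fun l => by
    rw [contr_apply, ← lprod_cons]
    exact hX _ (by simp)

theorem IsDeg.contr {n : ℕ} {X : ExtHom K V W} (hX : IsDeg (n + 1) X) (v : V) :
    IsDeg n (contr v X) := fun l hl => by
  rw [contr_apply, ← lprod_cons]
  exact hX _ (by simpa using hl)

theorem IsDeg.openFirst {n : ℕ} {X : ExtHom K V W} (hX : IsDeg (n + 1) X) :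
    IsDeg n (openFirst X) := fun l hl => HomSpace.ext fun v => by
  rw [openFirst_apply, ← lprod_cons, hX _ (by simpa using hl)]
  simp

theorem eps_lprod (X : ExtHom K V W) (l : List V) :
    eps X (lprod K l) = (-1 : ℤˣ) ^ l.length • X (lprod K l) := by
  induction l generalizing X with
  | nil => simp
  | cons v l ih =>
    rw [lprod_cons, eps_ι_mul, ih, contr_apply, List.length_cons, pow_succ, mul_neg_one,
      Units.neg_smul]

theorem IsDeg.isPar {n : ℕ} {X : ExtHom K V W} (hX : IsDeg n X) : IsPar n X :=
  ext_lprod fun l => by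
    rw [eps_lprod, LinearMap.smul_apply]
    by_cases hl : l.length = n
    · rw [hl]
    · rw [hX l hl, smul_zero, smul_zero]

/-- Homogeneity of `P` fixes the length of its share of the arguments. The sign from `eps P` is the
sign with which `v` passes the letters in `I`, so both recursions coincide. -/
theorem shuffle_lprod (B : W₁ →ₗ[K] W₂ →ₗ[K] W₃) {p : ℕ} {P : ExtHom K V W₁} (hP : IsDeg p P)
    (Q : ExtHom K V W₂) (l : List V) :
    shuffle B P Q (lprod K l) =
      splitSum (fun _ _ => -1) p l fun I J => B (P (lprod K I)) (Q (lprod K J)) := by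
  induction l generalizing p P Q with
  | nil =>
    rw [lprod_nil, shuffle_one]
    cases p with
    | zero => simp [splitSum]
    | succ p => rw [splitSum, ← lprod_nil, hP [] (by simp), map_zero, LinearMap.zero_apply]
  | cons v l ih =>
    have h2 : shuffle B (eps P) (contr v Q) (lprod K l) = splitSum (fun _ _ => -1) p l fun I J =>
        (I.map fun _ => (-1 : ℤˣ)).prod • B (P (lprod K I)) (Q (lprod K (v :: J))) := by
      rw [hP.isPar, shuffle_units_smul_left, LinearMap.smul_apply, ih hP, ← splitSum_smul]
      refine splitSum_congr fun I J _ hI => ?_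
      rw [contr_apply, ← lprod_cons, ← hI]
      simp
    rw [lprod_cons, shuffle_ι_mul, h2]
    cases p with
    | zero => rw [hP.contr_eq_zero, map_zero, LinearMap.zero_apply, LinearMap.zero_apply, zero_add,
        splitSum]
    | succ p =>
      rw [splitSum, ih (hP.contr v)]
      simp only [contr_apply, lprod_cons]

theorem IsDeg.shuffle (B : W₁ →ₗ[K] W₂ →ₗ[K] W₃) {p q : ℕ} {P : ExtHom K V W₁}
    {Q : ExtHom K V W₂} (hP : IsDeg p P) (hQ : IsDeg q Q) : IsDeg (p + q) (shuffle B P Q) := by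
  intro l hl
  rw [shuffle_lprod B hP]
  refine splitSum_eq_zero fun I J hIJ hI => ?_
  have := hIJ.length_eq
  rw [List.length_append] at this
  rw [hQ J (by omega), map_zero]

theorem isDeg_ofAlt {n : ℕ} (f : V [⋀^Fin n]→ₗ[K] W) : IsDeg n (ofAlt n f) := by
  intro l hl
  induction n generalizing l with
  | zero =>
    obtain ⟨v, l, rfl⟩ := List.exists_cons_of_ne_nil (List.length_pos_iff.1 (Nat.pos_of_ne_zero hl))
    rw [ofAlt_zero, lprod_cons, const_ι_mul]
  | succ n ih =>
    cases l with
    | nil => rw [lprod_nil, ofAlt_succ_one]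
    | cons v l =>
      rw [lprod_cons, ← contr_apply, contr_ofAlt_succ]
      exact ih _ _ (by simpa using hl)

theorem ofAlt_lprod {n : ℕ} (f : V [⋀^Fin n]→ₗ[K] W) (x : Fin n → V) :
    ofAlt n f (lprod K (List.ofFn x)) = f x := by
  rw [lprod_ofFn, ofAlt_ιMulti]

theorem proj_lprod_singleton (v : V) : (proj : ExtHom K V V) (lprod K [v]) = v := by
  rw [lprod_cons, ← contr_apply, contr_proj, lprod_nil, const_one]

theorem isDeg_proj : IsDeg 1 (proj : ExtHom K V V) := isDeg_ofAlt _

end Degree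

/-! ### The Matsushima–Nijenhuis bracket of cochains in terms of functionals -/

section Cochain

variable {K : Type k} {V : Type u} [CommRing K] [AddCommGroup V] [Module K V]

/-- A cochain as a functional on the exterior algebra. -/
def toT (p : ℕ) : PreLieCochain K V V p →ₗ[K] ExtHom K V (HomSpace K V V) where
  toFun f := ofAlt p (HomSpace.of.compAlternatingMap f)
  map_add' _ _ := (congrArg (ofAlt p) (AlternatingMap.ext fun _ => map_add HomSpace.of _ _)).trans
    (map_add _ _ _)
  map_smul' c _ := (congrArg (ofAlt p) (AlternatingMap.ext fun _ => map_smul HomSpace.of c _)).trans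
    (map_smul _ c _)

theorem toT_def {p : ℕ} (f : PreLieCochain K V V p) :
    toT p f = ofAlt p (HomSpace.of.compAlternatingMap f) := rfl

theorem isDeg_toT {p : ℕ} (f : PreLieCochain K V V p) : IsDeg p (toT p f) := isDeg_ofAlt _

theorem toT_lprod {p : ℕ} (f : PreLieCochain K V V p) (x : Fin p → V) :
    toT p f (lprod K (List.ofFn x)) = HomSpace.of (f x) := ofAlt_lprod _ x

theorem toT_domDomCongr {m n : ℕ} (h : m = n) (f : PreLieCochain K V V m) :
    toT n (f.domDomCongr (finCongr h)) = toT m f := by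
  subst h
  rfl

variable (K V) in
/-- The bilinear map `(v, g) ↦ (f ↦ g (f v))`. -/
def applyAt : V →ₗ[K] HomSpace K V (HomSpace K V V) →ₗ[K]
    HomSpace K (HomSpace K V V) (HomSpace K V V) :=
  LinearMap.mk₂ K (fun v g => HomSpace.of (HomSpace.app g ∘ₗ HomSpace.app.flip v))
    (fun _ _ _ => by ext; simp) (fun _ _ _ => by ext; simp)
    (fun _ _ _ => by ext; simp) (fun _ _ _ => by ext; simp)

theorem app_applyAt (v : V) (g : HomSpace K V (HomSpace K V V)) (f : HomSpace K V V) :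
    HomSpace.app (applyAt K V v g) f = HomSpace.app g (HomSpace.app f v) := rfl

/-- Reassociation displays the three blocks: the first arguments of `Q`, then its last argument
picked by `proj`, then the remaining arguments of `P`. -/
theorem insert_eq (P Q : ExtHom K V (HomSpace K V V)) :
    shuffle (evalPair K V (HomSpace K V V)) (flat HomSpace.app Q) (openFirst P) =
      shuffle (evalPair K (HomSpace K V V) (HomSpace K V V)) Q
        (shuffle (applyAt K V) proj (openFirst P)) := by
  rw [flat_def]
  refine shuffle_assoc (fun f v g => ?_) _ _ _
  rw [evalPair_apply, evalPair_apply, app_applyAt]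

theorem toT_diamondFirst {p q : ℕ} (P : PreLieCochain K V V p) (Q : PreLieCochain K V V q) :
    toT (p + q) (PreLieCochain.diamondFirst P Q) =
      shuffle (evalPair K V (HomSpace K V V)) (flat HomSpace.app (toT q Q))
        (openFirst (toT p P)) := by
  cases p with
  | zero =>
    -- Without alternating arguments there is nothing to open, in agreement with the absence of the
    -- first sum.
    have h : openFirst (toT 0 P) = 0 := by
      rw [toT_def, ofAlt_zero, openFirst_const]
    rw [h, map_zero]
    exact map_zero _
  | succ s =>
    refine (isDeg_toT _).ext ?_ fun x => ?_
    · have := (((isDeg_toT Q).shuffle HomSpace.app isDeg_proj).shuffle (evalPair K V _)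
        (isDeg_toT P).openFirst)
      rwa [show q + 1 + s = s + 1 + q by omega] at this
    · let H : List V → List V → HomSpace K V V := fun I J =>
        toT (s + 1) P (lprod K (HomSpace.app (toT q Q (lprod K (I.take q)))
          (proj (lprod K (I.drop q))) :: J))
      rw [insert_eq, shuffle_lprod _ (isDeg_toT Q), toT_lprod]
      have h1 : ∀ I J : List V, I.length = q →
          evalPair K (HomSpace K V V) (HomSpace K V V) (toT q Q (lprod K I))
            (shuffle (applyAt K V) proj (openFirst (toT (s + 1) P)) (lprod K J)) =
          splitSum (fun _ _ => -1) 1 J fun I' J' => H (I ++ I') J' := by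
        intro I J hI
        rw [shuffle_lprod _ isDeg_proj, map_splitSum]
        refine splitSum_congr fun I' J' _ hI' => ?_
        rw [evalPair_apply, app_applyAt, openFirst_apply, ← lprod_cons]
        simp only [H]
        rw [List.take_left' hI, List.drop_left' hI]
      rw [splitSum_congr fun I J _ hI => h1 I J hI,
        ← sum_unshuffles_threeBlocks (show q < s + 1 + q by omega)]
      rw [PreLieCochain.diamondFirst, unshuffleSum_apply, map_sum]
      refine Finset.sum_congr rfl fun σ _ => ?_
      rw [LinearMap.map_smul_of_tower]
      congr 1
      simp only [H]
      have e1 : ((List.ofFn (x ∘ σ)).take (q + 1)).take q =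
          List.ofFn fun a : Fin q => x (σ ⟨a, by omega⟩) := by
        rw [List.take_take, min_eq_left (Nat.le_succ q), List.take_ofFn_eq (by omega)]
        rfl
      have e2 : ((List.ofFn (x ∘ σ)).take (q + 1)).drop q = [x (σ ⟨q, by omega⟩)] := by
        rw [List.take_ofFn_eq (by omega), List.drop_ofFn_eq (k := 1) rfl]
        rfl
      have e3 : (List.ofFn (x ∘ σ)).drop (q + 1) =
          List.ofFn fun c : Fin s => x (σ ⟨q + 1 + c, by omega⟩) := by
        rw [List.drop_ofFn_eq (k := s) (by omega)]
        rfl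
      rw [e1, e2, e3, toT_lprod, HomSpace.app_of, proj_lprod_singleton, ← List.ofFn_cons, toT_lprod]
      rfl

theorem toT_diamondLast {p q : ℕ} (P : PreLieCochain K V V p) (Q : PreLieCochain K V V q) :
    toT (p + q) (PreLieCochain.diamondLast P Q) =
      shuffle (HomSpace.comp K V).flip (toT p P) (toT q Q) := by
  refine (isDeg_toT _).ext ((isDeg_toT P).shuffle _ (isDeg_toT Q)) fun x => ?_
  rw [shuffle_lprod _ (isDeg_toT P), toT_lprod, ← sum_unshuffles_twoBlocks_sign (by omega),
    PreLieCochain.diamondLast, unshuffleSum_apply, map_sum]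
  refine Finset.sum_congr rfl fun σ _ => ?_
  rw [LinearMap.map_smul_of_tower]
  congr 1
  rw [List.take_ofFn_eq (by omega), List.drop_ofFn_eq rfl, toT_lprod, toT_lprod]
  rfl

theorem units_smul_eq {M : Type*} [AddCommGroup M] [Module K M] (n : ℕ) (x : M) :
    (-1 : K) ^ n • x = (-1 : ℤˣ) ^ n • x := by
  rcases Nat.even_or_odd n with h | h <;> simp [h.neg_one_pow]

/-- The factor `(-1)^{pq}` in front of the second sum is the sign of exchanging `P` and `Q` in the
shuffle product. It disappears because `dia` places `Q` first and composes in the opposite order. -/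
theorem toT_diamond {p q : ℕ} (P : PreLieCochain K V V p) (Q : PreLieCochain K V V q) :
    toT (p + q) (PreLieCochain.diamond P Q) =
      dia HomSpace.app (HomSpace.comp K V) (toT p P) (toT q Q) := by
  rw [PreLieCochain.diamond, map_add, map_smul, toT_diamondFirst, toT_diamondLast, dia_def,
    shuffle_comm (HomSpace.comp K V).flip (isDeg_toT P).isPar (isDeg_toT Q).isPar, units_smul_eq,
    smul_smul, ← mul_pow, LinearMap.flip_flip]
  simp

end Cochain

theorem toT_mnBracket {K : Type k} {V : Type u} [Field K] [CharZero K] [AddCommGroup V]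
    [Module K V] {p q : ℕ} (P : PreLieCochain K V V p) (Q : PreLieCochain K V V q) :
    toT (p + q) (PreLieCochain.mnBracket P Q) = (mn K V).br (toT p P) (toT q Q) := by
  rw [PreLieCochain.mnBracket, map_sub, map_smul, toT_domDomCongr, toT_diamond, toT_diamond,
    mn_br (isDeg_toT P).isPar (isDeg_toT Q).isPar, units_smul_eq]

theorem toT_ofBilin {K : Type k} {V : Type u} [CommRing K] [AddCommGroup V] [Module K V]
    (m : V →ₗ[K] V →ₗ[K] V) :
    toT 1 (PreLieCochain.ofBilin m) = post (HomSpace.of ∘ₗ m) proj := by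
  refine (isDeg_toT _).ext (fun l hl => ?_) fun x => ?_
  · rw [post_apply, isDeg_proj l hl, map_zero]
  · rw [toT_lprod, post_apply, show List.ofFn x = [x 0] by simp, proj_lprod_singleton]
    rfl

end ExtHom

/-! ### Iterated brackets -/

namespace SuperLie

open Equiv

variable {K T α : Type*} [CommRing K] [AddCommGroup T] [Module K T] (L : SuperLie K T)
  (p : α → ℕ) (a : α → T)

/-- The iterated bracket `[⋯[[X, a₁], a₂], ⋯, aₙ]`. -/
def multi (X : T) (l : List α) : T := l.foldl (fun Z y => L.br Z (a y)) X

@[simp]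
theorem multi_nil (X : T) : L.multi a X [] = X := rfl

@[simp]
theorem multi_cons (X : T) (y : α) (l : List α) :
    L.multi a X (y :: l) = L.multi a (L.br X (a y)) l := rfl

theorem multi_add (X Y : T) (l : List α) :
    L.multi a (X + Y) l = L.multi a X l + L.multi a Y l := by
  induction l generalizing X Y with
  | nil => rfl
  | cons z l ih => rw [multi_cons, map_add, LinearMap.add_apply, ih]; rfl

theorem multi_units_smul (u : ℤˣ) (X : T) (l : List α) :
    L.multi a (u • X) l = u • L.multi a X l := by
  induction l generalizing X with
  | nil => rfl
  | cons z l ih => rw [multi_cons, LinearMap.map_smul_of_tower, LinearMap.smul_apply, ih]; rfl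

/-- The sign `(-1)^{(n - 1) p₁ + (n - 2) p₂ + ⋯ + pₙ₋₁}` of a list. -/
def decSign : List α → ℤˣ
  | [] => 1
  | y :: l => (-1) ^ (l.length * p y) * decSign l

/-- The Koszul sign of the exchange of two elements. -/
def kappa (y z : α) : ℤˣ := (-1) ^ (p y * p z)

/-- The Koszul sign of the exchange of two elements in the graded skew-symmetric algebra, where the
degrees are shifted by one. -/
def chi (y z : α) : ℤˣ := (-1) ^ (p y * p z) * (-1) ^ (p y + p z)

theorem prod_map_kappa (y : α) (I : List α) :
    (I.map (kappa p y)).prod = (-1) ^ (p y * (I.map p).sum) := by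
  induction I with
  | nil => simp
  | cons z I ih => simp [ih, kappa, mul_add, pow_add]

theorem units_mul_self_cancel (u v : ℤˣ) : u * (u * v) = v := by
  rw [← mul_assoc, Int.units_mul_self, one_mul]

/-- Moving `y` in front of `I` changes `decSign` by `(-1)^{p y + p z}` for each `z` passed, which is
the quotient of `chi` and `kappa`. -/
theorem prod_map_chi_mul (y : α) (I J : List α) :
    (I.map (chi p y)).prod * decSign p (I ++ y :: J) =
      (I.map (kappa p y)).prod * ((-1) ^ ((I ++ J).length * p y) * decSign p (I ++ J)) := by
  induction I with
  | nil => simp [decSign]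
  | cons z I ih =>
    have e : decSign p (I ++ y :: J) = (I.map (chi p y)).prod * ((I.map (kappa p y)).prod *
        ((-1) ^ ((I ++ J).length * p y) * decSign p (I ++ J))) := by
      rw [← ih, units_mul_self_cancel]
    simp only [List.cons_append, decSign, List.map_cons, List.prod_cons, e]
    simp only [List.length_append, List.length_cons, ← add_assoc, add_mul, one_mul, pow_add, chi,
      kappa]
    generalize (List.map (chi p y) I).prod = A
    rcases Int.units_eq_one_or A with rfl | rfl <;>
      rcases Int.units_eq_one_or ((-1 : ℤˣ) ^ p z) with h | h <;> simp only [h] <;>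
      · simp only [one_mul, mul_one, neg_mul, mul_neg, neg_neg]
        ac_rfl

section Sign

variable {M : Type*} [AddCommGroup M]

/-- Multiplication by `decSign` trades the skew-symmetric Koszul signs for the signs of the bracket:
the degree shift, for sums over splittings. -/
theorem splitSum_chi (m : ℕ) (l : List α) (H : List α → List α → M) :
    (splitSum (chi p) m l fun I J => decSign p (I ++ J) • H I J) =
      decSign p l • splitSum (kappa p) m l H := by
  induction l generalizing m H with
  | nil => cases m <;> simp [splitSum]
  | cons y l ih =>
    have h : ∀ m, (splitSum (chi p) m l fun I J =>
        (I.map (chi p y)).prod • decSign p (I ++ y :: J) • H I (y :: J)) =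
        decSign p (y :: l) • splitSum (kappa p) m l fun I J =>
          (I.map (kappa p y)).prod • H I (y :: J) := by
      intro m
      rw [decSign, mul_comm, mul_smul, ← splitSum_smul, ← ih]
      refine splitSum_congr fun I J hIJ _ => ?_
      rw [smul_smul, prod_map_chi_mul, hIJ.length_eq, smul_smul, smul_smul]
      congr 1
      ac_rfl
    cases m with
    | zero => exact h 0
    | succ m =>
      rw [splitSum, splitSum, smul_add, h]
      congr 1
      rw [decSign, mul_comm, mul_smul, ← splitSum_smul, ← ih]
      refine splitSum_congr fun I J hIJ _ => ?_
      rw [List.cons_append, decSign, hIJ.length_eq, mul_comm, mul_smul]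

end Sign

/-- The sum of `± [M(X; I), M(Y; J)]` over all splittings of a list, where `M` is the iterated bracket;
`q` is the parity of `Y`. -/
def pairSum (q m : ℕ) (X Y : T) (l : List α) : T :=
  splitSum (kappa p) m l fun I J =>
    (-1 : ℤˣ) ^ ((I.map p).sum * q) • L.br (L.multi a X I) (L.multi a Y J)

theorem pairSum_nil (q : ℕ) (X Y : T) : L.pairSum p a q 0 X Y [] = L.br X Y := by
  simp [pairSum, splitSum]

theorem pairSum_of_length_lt {q m : ℕ} {l : List α} (h : l.length < m) (X Y : T) :
    L.pairSum p a q m X Y l = 0 :=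
  splitSum_of_length_lt h _

theorem pairSum_aux (q m : ℕ) (X Y : T) (y : α) (l : List α) :
    (splitSum (kappa p) m l fun I J => (I.map (kappa p y)).prod • (-1 : ℤˣ) ^ ((I.map p).sum * q) •
      L.br (L.multi a X I) (L.multi a Y (y :: J))) =
      L.pairSum p a (q + p y) m X (L.br Y (a y)) l :=
  splitSum_congr fun I J _ _ => by
    rw [prod_map_kappa, smul_smul, ← pow_add, multi_cons]
    congr 2
    ring

theorem pairSum_zero_cons (q : ℕ) (X Y : T) (y : α) (l : List α) :
    L.pairSum p a q 0 X Y (y :: l) = L.pairSum p a (q + p y) 0 X (L.br Y (a y)) l :=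
  L.pairSum_aux p a q 0 X Y y l

theorem pairSum_succ_cons (q m : ℕ) (X Y : T) (y : α) (l : List α) :
    L.pairSum p a q (m + 1) X Y (y :: l) =
      (-1 : ℤˣ) ^ (p y * q) • L.pairSum p a q m (L.br X (a y)) Y l +
        L.pairSum p a (q + p y) (m + 1) X (L.br Y (a y)) l := by
  rw [← pairSum_aux, pairSum, pairSum, splitSum, ← splitSum_smul]
  congr 1
  refine splitSum_congr fun I J _ _ => ?_
  rw [smul_smul, ← pow_add, ← add_mul, List.map_cons, List.sum_cons, multi_cons]

variable {L p a}

/-- The Leibniz rule applied once per letter: each letter of the list acts on `X` or on `Y`. -/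
theorem sum_pairSum {x q : ℕ} {X Y : T} (hX : L.IsPar x X) (hY : L.IsPar q Y) {l : List α}
    (ha : ∀ y ∈ l, L.IsPar (p y) (a y)) :
    ∑ m ∈ Finset.range (l.length + 1), L.pairSum p a q m X Y l = L.multi a (L.br X Y) l := by
  induction l generalizing x q X Y with
  | nil => simp [pairSum_nil]
  | cons y l ih =>
    have hy := ha y (by simp)
    have hl : ∀ z ∈ l, L.IsPar (p z) (a z) := fun z hz => ha z (by simp [hz])
    rw [List.length_cons, Finset.sum_range_succ']
    simp only [pairSum_succ_cons, pairSum_zero_cons]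
    rw [Finset.sum_add_distrib, ← Finset.smul_sum, ih (hX.br hy) hY hl, add_assoc,
      ← Finset.sum_range_succ' (fun m => L.pairSum p a (q + p y) m X (L.br Y (a y)) l),
      Finset.sum_range_succ, pairSum_of_length_lt L p a (Nat.lt_succ_self _), add_zero,
      ih hX (hY.br hy) hl, multi_cons, L.leibniz hX hY hy, add_comm, mul_comm q]
    rw [multi_add, multi_units_smul]

/-- Skew-symmetry of the outer bracket, with the roles of a sublist and its complement exchanged. -/
theorem pairSum_symm {x q : ℕ} {X Y : T} (hX : L.IsPar x X) (hY : L.IsPar q Y) {l : List α}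
    (ha : ∀ y ∈ l, L.IsPar (p y) (a y)) {m m' : ℕ} (hm : m + m' = l.length) :
    L.pairSum p a q m X Y l = -((-1 : ℤˣ) ^ (x * q) • L.pairSum p a x m' Y X l) := by
  induction l generalizing x q X Y m m' with
  | nil =>
    obtain ⟨rfl, rfl⟩ : m = 0 ∧ m' = 0 := by simpa using hm
    rw [pairSum_nil, pairSum_nil]
    exact L.skew hX hY
  | cons y l ih =>
    have hy := ha y (by simp)
    have hl : ∀ z ∈ l, L.IsPar (p z) (a z) := fun z hz => ha z (by simp [hz])
    rw [List.length_cons] at hm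
    have h1 : ∀ m, m + m' = l.length →
        (-1 : ℤˣ) ^ (p y * q) • L.pairSum p a q m (L.br X (a y)) Y l =
          -((-1 : ℤˣ) ^ (x * q) • L.pairSum p a (x + p y) m' Y (L.br X (a y)) l) := fun m hm => by
      rw [ih (hX.br hy) hY hl hm, smul_neg, smul_smul, add_mul, pow_add, mul_left_comm,
        Int.units_mul_self, mul_one]
    have h2 : ∀ m', m + m' = l.length →
        L.pairSum p a (q + p y) m X (L.br Y (a y)) l =
          -((-1 : ℤˣ) ^ (x * q) • (-1 : ℤˣ) ^ (p y * x) •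
            L.pairSum p a x m' (L.br Y (a y)) X l) := fun m' hm => by
      rw [ih hX (hY.br hy) hl hm, smul_smul, mul_add, pow_add, mul_comm x (p y)]
    cases m with
    | zero =>
      obtain ⟨m', rfl⟩ : ∃ k, m' = k + 1 := ⟨l.length, by omega⟩
      rw [pairSum_zero_cons, pairSum_succ_cons, h2 m' (by omega),
        pairSum_of_length_lt L p a (show l.length < m' + 1 by omega), add_zero]
    | succ m =>
      rw [pairSum_succ_cons, h1 m (by omega)]
      cases m' with
      | zero =>
        rw [pairSum_zero_cons, pairSum_of_length_lt L p a (show l.length < m + 1 by omega), add_zero]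
      | succ m' =>
        rw [pairSum_succ_cons, h2 m' (by omega), smul_add, neg_add, add_comm]

/-- If `X` commutes with all members of a list, it can be taken out of the iterated bracket. -/
theorem multi_br_of_commute {x q : ℕ} {X Y : T} (hX : L.IsPar x X) (hY : L.IsPar q Y) {l : List α}
    (ha : ∀ y ∈ l, L.IsPar (p y) (a y)) (hl : ∀ y ∈ l, L.br X (a y) = 0) :
    L.multi a (L.br X Y) l = L.br X (L.multi a Y l) := by
  induction l generalizing q Y with
  | nil => rfl
  | cons y l ih =>
    have hy := ha y (by simp)
    rw [multi_cons, L.leibniz hX hY hy, hl y (by simp), map_zero, LinearMap.zero_apply, smul_zero,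
      add_zero, ih (hY.br hy) (fun z hz => ha z (by simp [hz])) (fun z hz => hl z (by simp [hz]))]
    rfl

theorem multi_isPar {x : ℕ} {X : T} (hX : L.IsPar x X) {l : List α}
    (ha : ∀ y ∈ l, L.IsPar (p y) (a y)) : L.IsPar (x + (l.map p).sum) (L.multi a X l) := by
  induction l generalizing x X with
  | nil => simpa using hX
  | cons y l ih =>
    rw [multi_cons, List.map_cons, List.sum_cons, ← add_assoc]
    exact ih (hX.br (ha y (by simp))) fun z hz => ha z (by simp [hz])

variable (L p a)

/-- The iterated bracket with the sign `decSign`, as a multilinear map. -/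
def iter : (k : ℕ) → T →ₗ[K] MultilinearMap K (fun _ : Fin k => T) T
  | 0 => (MultilinearMap.constLinearEquivOfIsEmpty (R := K) (S := K) (M₁ := fun _ : Fin 0 => T)
      (M₂ := T)).toLinearMap
  -- An argument followed by `k` others is hit by the `k`-th power of `eps`. On homogeneous
  -- arguments this produces `decSign`, while remaining linear on all of `T`.
  | k + 1 => (multilinearCurryLeftEquiv K (fun _ : Fin (k + 1) => T) T).symm.toLinearMap ∘ₗ
      ((L.br.compl₂ (L.eps ^ k)).compr₂ (iter k))

@[simp]
theorem iter_zero (X : T) (x : Fin 0 → T) : L.iter 0 X x = X := rfl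

theorem iter_succ (k : ℕ) (X : T) (x : Fin (k + 1) → T) :
    L.iter (k + 1) X x = L.iter k (L.br X ((L.eps ^ k) (x 0))) (Fin.tail x) := rfl

variable {L p a} in
theorem IsPar.eps_pow {x : ℕ} {X : T} (hX : L.IsPar x X) (k : ℕ) :
    (L.eps ^ k) X = (-1 : ℤˣ) ^ (k * x) • X := by
  induction k with
  | zero => simp
  | succ k ih =>
    rw [pow_succ, Module.End.mul_apply, hX, LinearMap.map_smul_of_tower, ih, smul_smul, ← pow_add]
    congr 2
    ring

variable {L p a} in
theorem iter_eq {k : ℕ} (X : T) {y : Fin k → α} (ha : ∀ i, L.IsPar (p (y i)) (a (y i))) :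
    L.iter k X (a ∘ y) = decSign p (List.ofFn y) • L.multi a X (List.ofFn y) := by
  induction k generalizing X with
  | zero => simp [decSign]
  | succ k ih =>
    have h : Fin.tail (a ∘ y) = a ∘ Fin.tail y := rfl
    rw [iter_succ, h, ih (y := Fin.tail y) _ fun i => ha i.succ, Function.comp_apply, (ha 0).eps_pow,
      LinearMap.map_smul_of_tower, multi_units_smul, List.ofFn_succ, decSign, multi_cons, smul_smul,
      List.length_ofFn, mul_comm]
    rfl

variable {L p a}

theorem multi_swap {x : ℕ} {X : T} (hX : L.IsPar x X) {y z : α} (hy : L.IsPar (p y) (a y))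
    (hz : L.IsPar (p z) (a z)) (hyz : L.br (a y) (a z) = 0) (l : List α) :
    L.multi a X (y :: z :: l) = kappa p z y • L.multi a X (z :: y :: l) := by
  rw [multi_cons, multi_cons, L.leibniz hX hy hz, hyz, map_zero, zero_add, multi_units_smul, kappa,
    mul_comm]
  rfl

theorem multi_middle {x : ℕ} {X : T} (hX : L.IsPar x X) (y : α) (hy : L.IsPar (p y) (a y))
    (I J : List α) (hI : ∀ z ∈ I, L.IsPar (p z) (a z)) (h : ∀ z ∈ I, L.br (a z) (a y) = 0) :
    L.multi a X (I ++ y :: J) = (I.map (kappa p y)).prod • L.multi a X (y :: (I ++ J)) := by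
  induction I generalizing x X with
  | nil => simp
  | cons z I ih =>
    have hz := hI z (by simp)
    rw [List.cons_append, multi_cons, ih (hX.br hz) (fun w hw => hI w (by simp [hw]))
      (fun w hw => h w (by simp [hw])), ← multi_cons, multi_swap hX hz hy (h z (by simp)), smul_smul,
      List.map_cons, List.prod_cons, mul_comm]
    rfl

/-- Since the arguments commute, the Leibniz rule makes the iterated bracket symmetric with signs
`kappa`; `decSign` turns these into `chi`, the signs that `koszulSign` collects. -/
theorem decSign_multi_perm {d : α → ℤ} (hd : ∀ y z, -Int.negOnePow (d y * d z) = chi p y z) {n : ℕ}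
    {x : ℕ} {X : T} (hX : L.IsPar x X) {y : Fin n → α} (ha : ∀ i, L.IsPar (p (y i)) (a (y i)))
    (h : ∀ i j, L.br (a (y i)) (a (y j)) = 0) (σ : Perm (Fin n)) :
    decSign p (List.ofFn (y ∘ σ)) • L.multi a X (List.ofFn (y ∘ σ)) =
      koszulSign (d ∘ y) σ • decSign p (List.ofFn y) • L.multi a X (List.ofFn y) := by
  induction n generalizing x X with
  | zero => simp [koszulSign_eq_prod]
  | succ n ih =>
    obtain ⟨⟨c, τ⟩, rfl⟩ := (insertZero_bijective n).2 σ
    have hy : Fin.tail (d ∘ y) = d ∘ Fin.tail y := rfl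
    simp only
    rw [koszulSign_insertZero, ofFn_comp_insertZero, hy]
    set I := (List.ofFn (Fin.tail y ∘ τ)).take c with hI
    set J := (List.ofFn (Fin.tail y ∘ τ)).drop c with hJ
    have hIJ : I ++ J = List.ofFn (Fin.tail y ∘ τ) := List.take_append_drop _ _
    have hmem : ∀ z ∈ I, ∃ i, z = y i := fun z hz => by
      have := List.mem_of_mem_take hz
      rw [List.mem_ofFn'] at this
      obtain ⟨i, rfl⟩ := this
      exact ⟨_, rfl⟩
    have hsign : (((List.ofFn ((d ∘ Fin.tail y) ∘ τ)).take c).map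
        fun e => -Int.negOnePow ((d ∘ y) 0 * e)).prod = (I.map (chi p (y 0))).prod := by
      rw [Function.comp_assoc, ← List.map_ofFn, ← List.map_take, List.map_map, ← hI]
      congr 1
      exact List.map_congr_left fun z _ => hd (y 0) z
    rw [multi_middle hX (y 0) (ha 0) I J, hsign, multi_cons, hIJ, List.ofFn_succ, multi_cons,
      decSign, List.length_ofFn]
    · have h1 := ih (hX.br (ha 0)) (fun i => ha i.succ) (fun i j => h i.succ j.succ) τ
      have h2 := prod_map_chi_mul p (y 0) I J
      rw [hIJ, List.length_ofFn] at h2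
      have h3 : decSign p (I ++ y 0 :: J) = (I.map (chi p (y 0))).prod *
          ((I.map (kappa p (y 0))).prod * ((-1) ^ (n * p (y 0)) *
            decSign p (List.ofFn (Fin.tail y ∘ τ)))) := by
        rw [← h2, units_mul_self_cancel]
      have h4 := congrArg (fun Z => ((I.map (chi p (y 0))).prod * (-1 : ℤˣ) ^ (n * p (y 0))) • Z) h1
      simp only [smul_smul] at h4
      rw [h3, smul_smul, smul_smul]
      refine Eq.trans ?_ (h4.trans ?_)
      · congr 1
        generalize (I.map (kappa p (y 0))).prod = B
        rw [mul_assoc, mul_assoc, mul_comm _ B, units_mul_self_cancel]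
        exact (mul_assoc _ _ _).symm
      · congr 1
        ac_rfl
    · intro z hz
      obtain ⟨i, rfl⟩ := hmem z hz
      exact ha i
    · intro z hz
      obtain ⟨i, rfl⟩ := hmem z hz
      exact h i 0

end SuperLie

/-! ### The Jacobi identities for higher derived brackets -/

namespace SuperLie

open Equiv

variable {K T α : Type*} [CommRing K] [AddCommGroup T] [Module K T] {L : SuperLie K T}
  {p : α → ℕ} {a : α → T}

theorem multi_sum {κ : Type*} (s : Finset κ) (X : κ → T) (l : List α) :
    L.multi a (∑ i ∈ s, X i) l = ∑ i ∈ s, L.multi a (X i) l :=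
  map_sum (AddMonoidHom.mk' (fun X => L.multi a X l) fun X Y => L.multi_add a X Y l) X s

theorem decSign_append (I J : List α) :
    decSign p (I ++ J) = (-1) ^ (J.length * (I.map p).sum) * (decSign p I * decSign p J) := by
  induction I with
  | nil => simp [decSign]
  | cons y I ih =>
    rw [List.cons_append, decSign, decSign, ih, List.length_append, List.map_cons, List.sum_cons,
      mul_add, add_mul, pow_add, pow_add]
    generalize (-1 : ℤˣ) ^ (I.length * p y) = A, (-1 : ℤˣ) ^ (J.length * p y) = B,
      (-1 : ℤˣ) ^ (J.length * (I.map p).sum) = C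
    ac_rfl

theorem multi_append_singleton (X : T) (I : List α) (y : α) :
    L.multi a X (I ++ [y]) = L.br (L.multi a X I) (a y) := by
  simp [multi]

/-- The higher derived brackets, up to sign, satisfy the quadratic relations. -/
theorem sum_pairSum_eq_zero [NoZeroSMulDivisors ℕ T] {Δ : ℕ → T} (hΔ : ∀ i, L.IsPar 1 (Δ i))
    {l : List α} (ha : ∀ y ∈ l, L.IsPar (p y) (a y))
    (hz : ∀ i (I : List α), I ⊆ l → i < I.length → L.multi a (Δ i) I = 0)
    (hs : ∑ t ∈ Finset.range l.length, L.br (Δ (t + 1)) (Δ (l.length - t)) = 0) :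
    ∑ t ∈ Finset.range l.length, L.pairSum p a 1 (t + 1) (Δ (t + 1)) (Δ (l.length - t)) l = 0 := by
  set n := l.length with hn
  -- Of all lengths of `I`, only `t + 1` and `t` survive: a longer `I` overfills `Δ (t + 1)` and a
  -- shorter one leaves too many letters for `Δ (n - t)`. The term of length `t` is rewritten by
  -- skew-symmetry.
  have h1 : ∀ t < n, L.multi a (L.br (Δ (t + 1)) (Δ (n - t))) l =
      L.pairSum p a 1 (t + 1) (Δ (t + 1)) (Δ (n - t)) l +
        L.pairSum p a 1 (n - t) (Δ (n - t)) (Δ (t + 1)) l := by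
    intro t ht
    rw [← sum_pairSum (hΔ _) (hΔ _) ha, Finset.sum_eq_add_of_mem (t + 1) t
      (Finset.mem_range.2 (by omega)) (Finset.mem_range.2 (by omega)) (by omega)]
    · rw [pairSum_symm (m := t) (m' := n - t) (hΔ _) (hΔ _) ha (by omega)]
      simp
    · rintro m hm ⟨hm1, hm2⟩
      rw [Finset.mem_range] at hm
      refine splitSum_eq_zero fun I J hIJ hI => ?_
      have hlen := hIJ.length_eq
      rw [List.length_append] at hlen
      rcases lt_or_ge (t + 1) m with h | h
      · rw [hz _ I (fun y hy => hIJ.subset (List.mem_append_left _ hy)) (by omega), map_zero,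
          LinearMap.zero_apply, smul_zero]
      · rw [hz (n - t) J (fun y hy => hIJ.subset (List.mem_append_right _ hy)) (by omega), map_zero,
          smul_zero]
  have h2 : ∑ t ∈ Finset.range n, L.multi a (L.br (Δ (t + 1)) (Δ (n - t))) l = 0 := by
    rw [← multi_sum, hs]
    simpa using L.multi_add a 0 0 l
  rw [Finset.sum_congr rfl fun t ht => h1 t (Finset.mem_range.1 ht), Finset.sum_add_distrib] at h2
  -- The reflection `t ↦ n - 1 - t` exchanges `t + 1` and `n - t`, so both kinds of terms have the
  -- same sum, which then vanishes after division by two.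
  have h3 : ∑ t ∈ Finset.range n, L.pairSum p a 1 (n - t) (Δ (n - t)) (Δ (t + 1)) l =
      ∑ t ∈ Finset.range n, L.pairSum p a 1 (t + 1) (Δ (t + 1)) (Δ (n - t)) l := by
    rw [← Finset.sum_range_reflect]
    refine Finset.sum_congr rfl fun t ht => ?_
    rw [Finset.mem_range] at ht
    rw [show n - (n - 1 - t) = t + 1 by omega, show n - 1 - t + 1 = n - t by omega]
  rw [h3, ← two_nsmul] at h2
  exact (smul_eq_zero.1 h2).resolve_left two_ne_zero

/-- The generalized Jacobi identities for higher derived brackets. -/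
theorem iter_jacobi [NoZeroSMulDivisors ℕ T] {Δ : ℕ → T} (hΔ : ∀ i, L.IsPar 1 (Δ i)) {n : ℕ}
    {d : Fin n → ℤ} {p : Fin n → ℕ} {a : Fin n → T}
    (hd : ∀ y z, -Int.negOnePow (d y * d z) = chi p y z) (ha : ∀ y, L.IsPar (p y) (a y))
    (hz : ∀ i (I : List (Fin n)), i < I.length → L.multi a (Δ i) I = 0)
    (hs : ∑ t ∈ Finset.range n, L.br (Δ (t + 1)) (Δ (n - t)) = 0) :
    ∑ t : Fin n, (-1 : ℤ) ^ (t.val + 1) •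
      ∑ σ ∈ unshuffles (twoBlocks (t.val + 1) : Fin n → ℕ), koszulSign d σ •
        L.iter (n - 1 - t.val + 1) (Δ (n - 1 - t.val + 1))
          (Fin.cons (L.iter (t.val + 1) (Δ (t.val + 1))
              (fun c : Fin (t.val + 1) => a (σ ⟨c, by omega⟩)))
            (fun c : Fin (n - 1 - t.val) => a (σ ⟨t.val + 1 + c, by omega⟩))) = 0 := by
  set l := List.ofFn (id : Fin n → Fin n) with hl
  have hln : l.length = n := by simp [hl]
  -- All signs of the Jacobi sum collapse to one global factor that does not depend on `t`.
  have key : ∀ t : Fin n, (-1 : ℤ) ^ (t.val + 1) •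
      ∑ σ ∈ unshuffles (twoBlocks (t.val + 1) : Fin n → ℕ), koszulSign d σ •
        L.iter (n - 1 - t.val + 1) (Δ (n - 1 - t.val + 1))
          (Fin.cons (L.iter (t.val + 1) (Δ (t.val + 1))
              (fun c : Fin (t.val + 1) => a (σ ⟨c, by omega⟩)))
            (fun c : Fin (n - 1 - t.val) => a (σ ⟨t.val + 1 + c, by omega⟩))) =
      ((-1 : ℤˣ) ^ n * decSign p l) •
        L.pairSum p a 1 (t + 1) (Δ (t + 1)) (Δ (n - t)) l := by
    intro t
    set k := n - 1 - t.val with hk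
    have hkt : n - t.val = k + 1 := by omega
    have hchi : (fun y z => -Int.negOnePow (d y * d z)) = chi p :=
      funext fun y => funext fun z => hd y z
    -- The inner iterated bracket is saturated: by `hz` one more argument kills it. It therefore
    -- commutes with the letters of `J` and can be taken out.
    have h1 : ∀ I J : List (Fin n), I.length = t.val + 1 → J.length = k →
        L.multi a (L.br (L.multi a (Δ (t + 1)) I) (Δ (k + 1))) J =
          L.br (L.multi a (Δ (t + 1)) I) (L.multi a (Δ (k + 1)) J) := fun I J hI _ =>
      multi_br_of_commute (multi_isPar (hΔ _) fun y _ => ha y) (hΔ _) (fun y _ => ha y) fun y _ => by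
        rw [← multi_append_singleton]
        exact hz _ _ (by simp [hI])
    have h2 : ∀ σ : Perm (Fin n),
        L.iter (k + 1) (Δ (k + 1)) (Fin.cons (L.iter (t.val + 1) (Δ (t.val + 1))
              (fun c : Fin (t.val + 1) => a (σ ⟨c, by omega⟩)))
            (fun c : Fin k => a (σ ⟨t.val + 1 + c, by omega⟩))) =
        (fun I J => decSign p (I ++ J) • (-1 : ℤˣ) ^ k • (-1 : ℤˣ) ^ ((I.map p).sum * 1) •
          L.br (L.multi a (Δ (t + 1)) I) (L.multi a (Δ (k + 1)) J))
          ((List.ofFn (id ∘ σ)).take (t + 1)) ((List.ofFn (id ∘ σ)).drop (t + 1)) := by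
      intro σ
      set I := (List.ofFn (id ∘ σ)).take (t + 1) with hI
      set J := (List.ofFn (id ∘ σ)).drop (t + 1) with hJ
      have hI' : I = List.ofFn fun c : Fin (t.val + 1) => σ ⟨c, by omega⟩ :=
        List.take_ofFn_eq (by omega) _
      have hJ' : J = List.ofFn fun c : Fin k => σ ⟨t.val + 1 + c, by omega⟩ :=
        List.drop_ofFn_eq (by omega) _
      have e1 : L.iter (t.val + 1) (Δ (t.val + 1))
          (fun c : Fin (t.val + 1) => a (σ ⟨c, by omega⟩)) =
          decSign p I • L.multi a (Δ (t + 1)) I := by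
        rw [hI']
        exact iter_eq (Δ (t + 1)) fun i => ha _
      have hpar := multi_isPar (hΔ (t + 1)) (l := I) (fun y _ => ha y)
      have e2 : ∀ X : T, L.iter k X (fun c : Fin k => a (σ ⟨t.val + 1 + c, by omega⟩)) =
          decSign p J • L.multi a X J := by
        intro X
        rw [hJ']
        exact iter_eq X fun i => ha _
      have hIlen : I.length = t + 1 := by rw [hI']; simp
      have hJlen : J.length = k := by rw [hJ']; simp
      beta_reduce
      -- The inner bracket has parity one plus the sum of the parities in `I`. This enters through
      -- the power of `eps`, through the exchange with `Δ (k + 1)`, and against the mixed sign of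
      -- `decSign_append`.
      rw [iter_succ, Fin.cons_zero, Fin.tail_cons, e2, e1, LinearMap.map_smul_of_tower,
        hpar.eps_pow, LinearMap.map_smul_of_tower, LinearMap.map_smul_of_tower,
        L.skew (hΔ _) hpar, multi_units_smul, multi_units_smul, ← Units.neg_smul, multi_units_smul,
        h1 I J hIlen hJlen, decSign_append, hJlen]
      simp only [smul_smul]
      congr 1
      simp only [one_mul, mul_one, mul_add, pow_add, pow_one, neg_mul, neg_neg]
      ac_rfl
    have h3 : ∑ σ ∈ unshuffles (twoBlocks (t.val + 1) : Fin n → ℕ), koszulSign d σ •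
        L.iter (k + 1) (Δ (k + 1)) (Fin.cons (L.iter (t.val + 1) (Δ (t.val + 1))
              (fun c : Fin (t.val + 1) => a (σ ⟨c, by omega⟩)))
            (fun c : Fin k => a (σ ⟨t.val + 1 + c, by omega⟩))) =
        decSign p l • (-1 : ℤˣ) ^ k • L.pairSum p a 1 (t + 1) (Δ (t + 1)) (Δ (k + 1)) l := by
      rw [Finset.sum_congr rfl fun σ _ => congrArg (fun Z => koszulSign d σ • Z) (h2 σ)]
      refine (sum_unshuffles_twoBlocks (p := t.val + 1) d (by omega) id
        fun I J => decSign p (I ++ J) • (-1 : ℤˣ) ^ k • (-1 : ℤˣ) ^ ((I.map p).sum * 1) •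
          L.br (L.multi a (Δ (t + 1)) I) (L.multi a (Δ (k + 1)) J)).trans ?_
      rw [hchi, splitSum_chi, splitSum_smul]
      rfl
    rw [h3, hkt, show (-1 : ℤ) ^ (t.val + 1) = (((-1 : ℤˣ) ^ (t.val + 1) : ℤˣ) : ℤ) by simp,
      ← Units.smul_def, smul_smul, smul_smul]
    congr 1
    have hn : (-1 : ℤˣ) ^ n = (-1) ^ (t.val + 1) * (-1) ^ k := by
      rw [← pow_add]
      congr 1
      omega
    rw [hn]
    ac_rfl
  rw [Finset.sum_congr rfl fun t _ => key t, ← Finset.smul_sum,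
    Fin.sum_univ_eq_sum_range (fun t => L.pairSum p a 1 (t + 1) (Δ (t + 1)) (Δ (n - t)) l) n]
  have := sum_pairSum_eq_zero hΔ (l := l) (p := p) (a := a) (fun y _ => ha y)
    (fun i I _ hI => hz i I hI) (by rw [hln]; exact hs)
  rw [hln] at this
  rw [this, smul_zero]

end SuperLie

/-! ### Lifts as functionals on the exterior algebra -/

namespace PreLieCochain

section Grading

variable {K V W : Type*} [CommRing K] [AddCommGroup V] [Module K V] [AddCommGroup W] [Module K W]

theorem toTotal_mem_grading {p : ℕ} (f : PreLieCochain K V W p) :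
    toTotal f ∈ grading K V W (p + 1) := by
  intro q hq
  by_contra h
  refine hq ?_
  rw [toTotal, DirectSum.lof_eq_of]
  exact DirectSum.of_eq_of_ne _ _ _ (by omega)

theorem apply_eq_zero_of_mem_grading {m : ℤ} {f : Total K V W} (hf : f ∈ grading K V W m) {p : ℕ}
    (h : (p : ℤ) + 1 ≠ m) : f p = 0 := by
  by_contra h'
  exact h (hf p h')

theorem eq_toTotal_of_mem_grading {p : ℕ} {f : Total K V W} (hf : f ∈ grading K V W (p + 1)) :
    f = toTotal (f p) := by
  refine DFinsupp.ext fun q => ?_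
  by_cases h : q = p
  · subst h
    exact (DirectSum.of_eq_same q (f q)).symm
  · rw [apply_eq_zero_of_mem_grading hf (p := q) (by omega)]
    exact (DirectSum.of_eq_of_ne _ _ _ h).symm

theorem eq_zero_or_of_mem_grading {m : ℤ} {f : Total K V W} (hf : f ∈ grading K V W m) :
    f = 0 ∨ ∃ p : ℕ, m = p + 1 ∧ f = toTotal (f p) := by
  by_cases h : ∃ p : ℕ, m = p + 1
  · obtain ⟨p, rfl⟩ := h
    exact Or.inr ⟨p, rfl, eq_toTotal_of_mem_grading hf⟩
  · exact Or.inl (DFinsupp.ext fun q =>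
      apply_eq_zero_of_mem_grading hf fun hq => h ⟨q, hq.symm⟩)

theorem coe_grading_apply (z : ⨁ m : ℤ, grading K V W m) (p : ℕ) :
    DirectSum.coeAddMonoidHom (grading K V W) z p = (z (p + 1) : Total K V W) p := by
  induction z using DirectSum.induction_on with
  | zero => simp
  | of m x =>
    rw [DirectSum.coeAddMonoidHom_of]
    by_cases h : (p : ℤ) + 1 = m
    · subst h
      rw [DirectSum.of_eq_same]
    · rw [DirectSum.of_eq_of_ne _ _ _ h, apply_eq_zero_of_mem_grading x.2 h]
      rfl
  | add x y hx hy =>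
    rw [map_add, DirectSum.add_apply, hx, hy, DirectSum.add_apply]
    rfl

theorem grading_isInternal : DirectSum.IsInternal (grading K V W) := by
  constructor
  · intro z z' hz
    refine DFinsupp.ext fun m => Subtype.ext (DFinsupp.ext fun p => ?_)
    by_cases h : (p : ℤ) + 1 = m
    · subst h
      rw [← coe_grading_apply, ← coe_grading_apply, hz]
    · rw [apply_eq_zero_of_mem_grading (z m).2 h, apply_eq_zero_of_mem_grading (z' m).2 h]
  · intro f
    induction f using DirectSum.induction_on with
    | zero => exact ⟨0, map_zero _⟩
    | of p f => exact ⟨DirectSum.of _ ((p : ℤ) + 1) ⟨toTotal f, toTotal_mem_grading f⟩,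
        DirectSum.coeAddMonoidHom_of _ _ _⟩
    | add x y hx hy =>
      obtain ⟨x', rfl⟩ := hx
      obtain ⟨y', rfl⟩ := hy
      exact ⟨x' + y', map_add _ _ _⟩

end Grading

end PreLieCochain

/-! ### The total spaces inside the functionals, and a criterion for being a lift -/

namespace ExtHom

open ExteriorAlgebra

section Total

variable {K : Type k} {G : Type u} [CommRing K] [AddCommGroup G] [Module K G]

variable (K G) in
/-- An element of `C*(G, G)` as a functional on the exterior algebra. -/
def ofTotal : Total K G G →ₗ[K] ExtHom K G (HomSpace K G G) :=
  DirectSum.toModule K ℕ _ fun p => toT p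

theorem ofTotal_toTotal {p : ℕ} (f : PreLieCochain K G G p) :
    ofTotal K G (toTotal f) = toT p f :=
  DirectSum.toModule_lof K p f

theorem ofTotal_lprod (f : Total K G G) {n : ℕ} (x : Fin n → G) :
    ofTotal K G f (lprod K (List.ofFn x)) = HomSpace.of (f n x) := by
  induction f using DirectSum.induction_on with
  | zero => rw [map_zero]; exact (map_zero _).symm
  | of p f =>
    refine (LinearMap.congr_fun (ofTotal_toTotal f) _).trans ?_
    by_cases h : n = p
    · subst h
      rw [toT_lprod, DirectSum.of_eq_same]
    · rw [isDeg_toT f _ (by simpa using h), DirectSum.of_eq_of_ne _ _ _ h]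
      exact (map_zero _).symm
  | add f g hf hg =>
    rw [map_add, LinearMap.add_apply, hf, hg, ← map_add]
    rfl

theorem ofTotal_injective : Function.Injective (ofTotal K G) := by
  rw [injective_iff_map_eq_zero]
  intro f hf
  refine DFinsupp.ext fun n => AlternatingMap.ext fun x => ?_
  rw [← HomSpace.app_of (f n x), ← ofTotal_lprod, hf]
  exact map_zero _

/-- The space `C^{p+1}(g₂, g₁)`. -/
abbrev SubCochain (g₁ g₂ : Submodule K G) (p : ℕ) : Type _ := PreLieCochain K g₂ g₁ p

/-- The space `C*(g₂, g₁)`. -/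
abbrev SubTotal (g₁ g₂ : Submodule K G) : Type _ := Total K g₂ g₁

/-- The grading of `C*(g₂, g₁)`. -/
abbrev subGrading (g₁ g₂ : Submodule K G) : ℤ → Submodule K (SubTotal g₁ g₂) := grading K g₂ g₁

variable {g₁ g₂ : Submodule K G} (h : IsCompl g₁ g₂)

/-- An element of `C*(g₂, g₁)` as a functional on the exterior algebra of `G`. -/
noncomputable def liftT : Total K g₂ g₁ →ₗ[K] ExtHom K G (HomSpace K G G) :=
  ofTotal K G ∘ₗ liftTotal h

theorem liftTotal_toTotal {p : ℕ} (f : PreLieCochain K g₂ g₁ p) :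
    liftTotal h (toTotal f) = toTotal (lift h p f) :=
  DirectSum.lmap_lof _ _ _

theorem liftT_toTotal {p : ℕ} (f : PreLieCochain K g₂ g₁ p) :
    liftT h (toTotal f) = toT p (lift h p f) := by
  rw [liftT, LinearMap.comp_apply, liftTotal_toTotal, ofTotal_toTotal]

theorem lift_injective (p : ℕ) : Function.Injective (lift h p) := by
  intro f f' hf
  refine AlternatingMap.ext fun x => LinearMap.ext fun z => Subtype.ext ?_
  have h1 := lift_apply h p f (fun i => (x i : G)) z
  have h2 := lift_apply h p f' (fun i => (x i : G)) z
  simp only [Submodule.projectionOnto_apply_left] at h1 h2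
  rw [← h1, ← h2, hf]

theorem liftT_injective : Function.Injective (liftT h) := by
  refine ofTotal_injective.comp ?_
  rw [injective_iff_map_eq_zero]
  intro f hf
  refine DFinsupp.ext fun p => lift_injective h p ?_
  have h1 : liftTotal h f p = lift h p (f p) := DirectSum.lmap_apply _ _ _
  rw [← h1, hf]
  exact (map_zero _).symm

end Total

section Conj

variable {K : Type k} {G : Type u} [Field K] [AddCommGroup G] [Module K G] {g₁ g₂ : Submodule K G}
  (h : IsCompl g₁ g₂)

theorem conj_toT_lprod (e e' : G →ₗ[K] G) {p : ℕ} (f : PreLieCochain K G G p) (x : Fin p → G)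
    (z : G) : HomSpace.app (conj e e' (toT p f) (lprod K (List.ofFn x))) z =
      e (f (fun i => e' (x i)) (e' z)) := by
  have h1 : ExteriorAlgebra.map e' (lprod K (List.ofFn x)) =
      lprod K (List.ofFn fun i => e' (x i)) := by
    rw [lprod_ofFn, lprod_ofFn, ExteriorAlgebra.map_apply_ιMulti]
    rfl
  rw [conj_apply, h1, toT_lprod, HomSpace.app_of]

theorem isDeg_conj (e e' : G →ₗ[K] G) {p : ℕ} {X : ExtHom K G (HomSpace K G G)}
    (hX : IsDeg p X) : IsDeg p (conj e e' X) := by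
  intro l hl
  have h1 : ∀ l, ExteriorAlgebra.map e' (lprod K l) = lprod K (l.map e') := by
    intro l
    induction l with
    | nil => simp
    | cons v l ih => rw [lprod_cons, map_mul, ih, map_apply_ι, List.map_cons, lprod_cons]
  refine HomSpace.ext fun z => ?_
  rw [conj_apply, h1, hX _ (by simpa using hl)]
  simp

/-- A cochain is a lift if it is invariant under the projection `conj`. -/
theorem exists_lift_eq_iff {p : ℕ} (f : PreLieCochain K G G p) :
    (∃ f' : SubCochain g₁ g₂ p, lift h p f' = f) ↔
      conj (g₁.projection g₂ h) (g₂.projection g₁ h.symm) (toT p f) = toT p f := by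
  constructor
  · rintro ⟨f, rfl⟩
    refine (isDeg_conj _ _ (isDeg_toT _)).ext (isDeg_toT _) fun x => HomSpace.ext fun z => ?_
    rw [conj_toT_lprod, toT_lprod, HomSpace.app_of, lift_apply, lift_apply]
    simp only [Submodule.projection_apply, Submodule.projectionOnto_apply_left]
  · intro hf
    -- The candidate is `f` restricted to `g₂` with its value projected to `g₁`; invariance under
    -- `conj` says that nothing is lost.
    refine ⟨((g₁.projectionOnto g₂ h).compRight K ∘ₗ LinearMap.lcomp K G g₂.subtype).compAlternatingMap
      (f.compLinearMap g₂.subtype), AlternatingMap.ext fun x => LinearMap.ext fun z => ?_⟩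
    have h1 := conj_toT_lprod (g₁.projection g₂ h) (g₂.projection g₁ h.symm) f x z
    rw [hf, toT_lprod, HomSpace.app_of] at h1
    rw [h1, lift_apply]
    rfl

end Conj

end ExtHom

/-! ### Quasi-twilled pre-Lie algebras and derived brackets -/

namespace ExtHom

section Weight

variable {K : Type k} {G : Type u} [Field K] [CharZero K] [AddCommGroup G] [Module K G]
  {g₁ g₂ : Submodule K G} (h : IsCompl g₁ g₂)

theorem weight_toT_ofBilin {e : G →ₗ[K] G} {m : G →ₗ[K] G →ₗ[K] G} {c : K}
    (hm : ∀ v w, m v (e w) - e (m v w) + m (e v) w = c • m v w) :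
    weight e (toT 1 (ofBilin m)) = c • toT 1 (ofBilin m) := by
  rw [toT_ofBilin]
  exact weight_post_proj e fun v w => hm v w

omit [CharZero K] in
theorem projection_projection_self (v : G) :
    g₁.projection g₂ h (g₁.projection g₂ h v) = g₁.projection g₂ h v :=
  Submodule.projection_apply_of_mem_left h (Submodule.projection_apply_mem h v)

omit [CharZero K] in
theorem projection_projection_symm (v : G) :
    g₁.projection g₂ h (g₂.projection g₁ h.symm v) = 0 :=
  Submodule.projection_apply_of_mem_right h (Submodule.projection_apply_mem h.symm v)

omit [CharZero K] in
theorem conj_liftT (f : SubTotal g₁ g₂) :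
    conj (g₁.projection g₂ h) (g₂.projection g₁ h.symm) (liftT h f) = liftT h f := by
  induction f using DirectSum.induction_on with
  | zero => rw [map_zero, map_zero]
  | of p f =>
    exact (liftT_toTotal h f).symm ▸ (exists_lift_eq_iff h _).1 ⟨f, rfl⟩
  | add f f' hf hf' => rw [map_add, map_add, hf, hf']

theorem weight_liftT (f : SubTotal g₁ g₂) :
    weight (g₁.projection g₂ h) (liftT h f) = -liftT h f := by
  rw [← conj_liftT]
  exact weight_conj (projection_projection_self h)
    (Submodule.projection_add_projection_eq_self h) _

/-- A nonzero element lies in some degree `m = p + 1`, where `(m - 1).natAbs` is `p`; in all other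
degrees the element is zero and has every parity. -/
theorem isPar_liftT {m : ℤ} {f : SubTotal g₁ g₂} (hf : f ∈ subGrading g₁ g₂ m) :
    (mn K G).IsPar (m - 1).natAbs (liftT h f) := by
  rcases eq_zero_or_of_mem_grading hf with rfl | ⟨p, rfl, hp⟩
  · rw [map_zero]
    exact (map_zero _).trans (smul_zero _).symm
  · rw [hp, liftT_toTotal, show ((p : ℤ) + 1 - 1).natAbs = p by simp]
    exact (isDeg_toT _).isPar

/-- The bracket would have weight `-2`. -/
theorem br_liftT_liftT {m n : ℤ} {f f' : SubTotal g₁ g₂} (hf : f ∈ subGrading g₁ g₂ m)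
    (hf' : f' ∈ subGrading g₁ g₂ n) : (mn K G).br (liftT h f) (liftT h f') = 0 := by
  refine eq_zero_of_weight (projection_projection_self h)
    (Submodule.projection_add_projection_eq_self h) le_rfl ?_
  rw [weight_br (isPar_liftT h hf) (isPar_liftT h hf') (a := -1) (b := -1)]
  · norm_num
  · rw [weight_liftT, neg_one_smul]
  · rw [weight_liftT, neg_one_smul]

variable {α : Type*} {p : α → ℕ} {a : α → ExtHom K G (HomSpace K G G)}

theorem weight_multi {e : G →ₗ[K] G} (ha : ∀ y, (mn K G).IsPar (p y) (a y))
    (hw : ∀ y, weight e (a y) = -a y) {x : ℕ} {X : ExtHom K G (HomSpace K G G)}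
    (hX : (mn K G).IsPar x X) {c : K} (hc : weight e X = c • X) (l : List α) :
    weight e ((mn K G).multi a X l) = (c - l.length) • (mn K G).multi a X l := by
  induction l generalizing x X c with
  | nil => simpa using hc
  | cons y l ih =>
    rw [SuperLie.multi_cons, ih (hX.br (ha y)) (c := c + -1)
      (weight_br hX (ha y) hc (by rw [hw, neg_one_smul]))]
    congr 1
    push_cast [List.length_cons]
    ring

theorem exists_toT_eq_multi (ha : ∀ y, ∃ f, a y = toT (p y) f) {n : ℕ}
    (F : PreLieCochain K G G n) (l : List α) :
    ∃ F', (mn K G).multi a (toT n F) l = toT (n + (l.map p).sum) F' := by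
  induction l generalizing n with
  | nil => exact ⟨F, rfl⟩
  | cons y l ih =>
    obtain ⟨f, hf⟩ := ha y
    rw [SuperLie.multi_cons, hf, ← toT_mnBracket, List.map_cons, List.sum_cons, ← add_assoc]
    exact ih _

end Weight

/-! ### Components of the multiplication and their quadratic relations -/

section Components

variable {K : Type k} {G : Type u} [Field K] [LeftPreLieRing G] [LeftPreLieAlgebra K G]
  {g₁ g₂ : Submodule K G} (h : IsCompl g₁ g₂)

/-- The component of weight `i - 1` of the multiplication of a quasi-twilled pre-Lie algebra. -/
noncomputable def component : ℕ → PreLieCochain K G G 1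
  | 1 => muHatTwo h
  | 2 => muHatOne h
  | 3 => phiHatOne h
  | _ => 0

theorem component_of_four_le {i : ℕ} (hi : 4 ≤ i) : component h i = 0 := by
  obtain ⟨j, rfl⟩ := Nat.exists_eq_add_of_le' hi
  rfl

variable [CharZero K]

theorem isPar_component (i : ℕ) : (mn K G).IsPar 1 (toT 1 (component h i)) :=
  (isDeg_toT _).isPar

/-- Every term of `μ̂₂`, `μ̂₁`, `φ̂₁` has respectively `0`, `1`, `2` more inputs than outputs in
`g₁`. -/
theorem weight_component (i : ℕ) : weight (g₁.projection g₂ h) (toT 1 (component h i)) =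
    ((i : K) - 1) • toT 1 (component h i) := by
  have h1 := projection_projection_self h
  have h2 := projection_projection_symm h
  have h3 := projection_projection_symm h.symm
  have h0 : weight (g₁.projection g₂ h) (toT 1 (0 : PreLieCochain K G G 1)) =
      ((i : K) - 1) • toT 1 (0 : PreLieCochain K G G 1) := by
    rw [map_zero, smul_zero, weight, map_zero, LinearMap.zero_apply]
  match i with
  | 0 => exact h0
  | 1 | 2 | 3 =>
    refine weight_toT_ofBilin fun v w => ?_
    simp only [sandwich, LinearMap.add_apply, LinearMap.compr₂_apply, LinearMap.compl₁₂_apply,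
      LinearMap.mul_apply', map_add, h1, h2, h3, map_zero, LinearMap.zero_apply]
    push_cast
    module
  | i + 4 => exact h0

theorem br_mul_self :
    (mn K G).br (toT 1 (ofBilin (LinearMap.mul K G))) (toT 1 (ofBilin (LinearMap.mul K G))) = 0 := by
  rw [mn_br (isDeg_toT _).isPar (isDeg_toT _).isPar, toT_ofBilin, dia_post_proj_eq_zero]
  · simp
  · intro v w
    refine HomSpace.ext fun z => ?_
    have := LeftPreLieRing.assoc_symm' v w z
    simp only [associator] at this
    simp only [map_add, map_sub, LinearMap.add_apply, LinearMap.sub_apply, LinearMap.comp_apply,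
      HomSpace.app_of, HomSpace.app_comp, LinearMap.mul_apply', map_zero, LinearMap.zero_apply]
    linear_combination (norm := abel) this

theorem sum_br_component (hG : IsQuasiTwilled g₁ g₂) (n : ℕ) :
    ∑ t ∈ Finset.range n, (mn K G).br (toT 1 (component hG.isCompl (t + 1)))
      (toT 1 (component hG.isCompl (n - t))) = 0 := by
  set Δ := fun i => toT 1 (component hG.isCompl i) with hΔ
  have hw : ∀ i, weight (g₁.projection g₂ hG.isCompl) (Δ i) = ((i : K) - 1) • Δ i :=
    weight_component hG.isCompl
  have h4 : ∀ i, 4 ≤ i → Δ i = 0 := fun i hi => by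
    simp only [hΔ]
    rw [component_of_four_le _ hi, map_zero]
  -- `A w` collects the brackets whose component indices add up to `w + 2`, hence those of weight
  -- `w`.
  let A : ℕ → ExtHom K G (HomSpace K G G) := fun w =>
    ∑ t ∈ Finset.range (w + 1), (mn K G).br (Δ (t + 1)) (Δ (w + 1 - t))
  have hA : ∀ w, weight (g₁.projection g₂ hG.isCompl) (A w) = (w : K) • A w := by
    intro w
    simp only [A]
    rw [weight, map_sum, LinearMap.sum_apply, Finset.smul_sum]
    refine Finset.sum_congr rfl fun t ht => ?_
    rw [Finset.mem_range] at ht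
    refine (weight_br (isPar_component _ _) (isPar_component _ _) (hw _) (hw _)).trans ?_
    congr 1
    rw [Nat.cast_sub (by omega)]
    push_cast
    ring
  -- Components have weights at most `2`, so the weights `0, …, 4` exhaust the bracket of the
  -- multiplication with itself.
  have hsum : ∑ w ∈ Finset.range 5, A w = 0 := by
    have hπ : toT 1 (ofBilin (LinearMap.mul K G)) = Δ 1 + Δ 2 + Δ 3 := by
      rw [hat_decomposition hG.isCompl, (isQuasiTwilled_iff hG.isCompl).1 hG, add_zero, map_add,
        map_add, add_comm (toT 1 _), add_comm, ← add_assoc]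
      rfl
    have h0 := br_mul_self (K := K) (G := G)
    rw [hπ] at h0
    rw [← h0]
    simp only [A, Finset.sum_range_succ, Finset.sum_range_zero, h4 4 le_rfl, h4 5 (by omega),
      map_zero, LinearMap.zero_apply, map_add, LinearMap.add_apply, zero_add, add_zero,
      Nat.reduceAdd, Nat.reduceSub]
    abel
  rcases Nat.eq_zero_or_pos n with rfl | hn
  · rfl
  obtain ⟨w, rfl⟩ : ∃ w, n = w + 1 := ⟨n - 1, by omega⟩
  by_cases hw5 : w < 5
  · exact eq_zero_of_sum_weight hA hsum w hw5
  · refine Finset.sum_eq_zero fun t ht => ?_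
    -- For `w ≥ 5` the two indices add up to at least `7`, so one of them is at least `4` and its
    -- component is zero.
    rcases le_or_gt 4 (t + 1) with ht4 | ht4
    · rw [component_of_four_le _ ht4, map_zero, map_zero, LinearMap.zero_apply]
    · rw [component_of_four_le _ (show 4 ≤ w + 1 - t by omega), map_zero, map_zero]

variable {k : ℕ} {d : Fin k → ℤ} {x : Fin k → SubTotal g₁ g₂} (hx : ∀ i, x i ∈ subGrading g₁ g₂ (d i))

include hx

theorem multi_component_eq_zero {i : ℕ} {l : List (Fin k)} (hi : i < l.length) :
    (mn K G).multi (fun j => liftT h (x j)) (toT 1 (component h i)) l = 0 := by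
  rcases Nat.eq_zero_or_pos i with rfl | hi0
  · have h0 : toT 1 (component h 0) = (0 : ExtHom K G (HomSpace K G G)) := map_zero _
    rw [h0]
    simpa using (mn K G).multi_add (fun j => liftT h (x j)) 0 0 l
  · refine eq_zero_of_weight (c := l.length + 1 - i) (projection_projection_self h)
      (Submodule.projection_add_projection_eq_self h) (by omega) ?_
    rw [weight_multi (fun j => isPar_liftT h (hx j)) (fun j => weight_liftT h (x j))
      (isPar_component h i) (weight_component h i)]
    congr 1
    rw [Nat.cast_sub (by omega)]
    push_cast
    ring

/-- The weight `k - 1` drops to `-1` after `k` brackets with lifts, so the result is again a lift: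
the operations preserve `C*(g₂, g₁)`. -/
theorem exists_liftT_eq_iter : ∃ y ∈ subGrading g₁ g₂ (∑ i, d i + 2 - k),
    liftT h y = (mn K G).iter k (toT 1 (component h k)) fun i => liftT h (x i) := by
  -- A zero argument may carry any degree, even one without cochains, so it is separated before
  -- exponents `p` are chosen.
  by_cases h0 : ∃ i, x i = 0
  · obtain ⟨i, hi⟩ := h0
    refine ⟨0, zero_mem _, ?_⟩
    rw [map_zero, MultilinearMap.map_coord_zero _ i (by rw [hi, map_zero])]
  · have h1 : ∀ i, ∃ p : ℕ, d i = p + 1 ∧ x i = toTotal (x i p) := fun i =>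
      (eq_zero_or_of_mem_grading (hx i)).resolve_left fun hi => h0 ⟨i, hi⟩
    choose p hp hxp using h1
    have ha : ∀ i, ∃ f, liftT h (x i) = toT (p i) f := fun i =>
      ⟨_, by rw [hxp, liftT_toTotal]⟩
    have hpar : ∀ i, (mn K G).IsPar (p i) (liftT h (x i)) := fun i => by
      have := isPar_liftT h (hx i)
      rwa [hp, show ((p i : ℤ) + 1 - 1).natAbs = p i by simp] at this
    have hiter := SuperLie.iter_eq (p := p) (a := fun i => liftT h (x i)) (toT 1 (component h k))
      (y := id) hpar
    set l := List.ofFn (id : Fin k → Fin k) with hl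
    have hlen : l.length = k := by simp [hl]
    obtain ⟨F, hF⟩ := exists_toT_eq_multi ha (component h k) l
    have hw := weight_multi hpar (fun j => weight_liftT h (x j))
      (isPar_component h k) (weight_component h k) l
    rw [hlen, sub_sub, sub_add_cancel_right, neg_one_smul, hF] at hw
    obtain ⟨f, hf⟩ := (exists_lift_eq_iff h F).2 (conj_of_weight (projection_projection_self h)
      (Submodule.projection_add_projection_eq_self h) hw)
    -- The cochain has `1 + ∑ p i` alternating arguments and one more last argument; `p i = d i - 1`
    -- gives degree `2 - k` for the operation.
    have hd : ((1 + (l.map p).sum : ℕ) : ℤ) + 1 = ∑ i, d i + 2 - k := by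
      have h2 : (l.map p).sum = ∑ i, p i := by
        rw [hl, List.map_ofFn, List.sum_ofFn]
        rfl
      rw [h2, Finset.sum_congr rfl fun i _ => hp i, Finset.sum_add_distrib]
      push_cast
      simp
      ring
    refine ⟨toTotal (((SuperLie.decSign p l : ℤ) : K) • f), hd ▸ toTotal_mem_grading _, ?_⟩
    rw [liftT_toTotal, map_smul, map_smul, hf, ← hF, Int.cast_smul_eq_zsmul, ← Units.smul_def]
    exact hiter.symm

end Components

/-- With `a = d y - 1` and `b = d z - 1`, the exponent `a b + a + b` equals `d y * d z - 1`; this is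
the degree shift on the level of exchange signs. -/
theorem neg_negOnePow_eq_chi {α : Type*} (d : α → ℤ) (y z : α) :
    -Int.negOnePow (d y * d z) = SuperLie.chi (fun i => (d i - 1).natAbs) y z := by
  have h1 : ∀ m : ℤ, (-1 : ℤˣ) ^ m.natAbs = Int.negOnePow m := fun m => by
    rcases Int.natAbs_eq m with hm | hm
    · conv_rhs => rw [hm]
      rfl
    · conv_rhs => rw [hm, Int.negOnePow_neg]
      rfl
  rw [SuperLie.chi, pow_add, ← Int.natAbs_mul, h1, h1, h1, ← Int.negOnePow_add,
    ← Int.negOnePow_add, ← Int.negOnePow_succ, Int.negOnePow_eq_iff]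
  exact ⟨1, by ring⟩

end ExtHom

/-! ### The L∞-structure and its first three operations -/

namespace ExtHom

section HigherDerived

variable {K : Type k} {G : Type u} [Field K] [CharZero K] [LeftPreLieRing G]
  [LeftPreLieAlgebra K G] {g₁ g₂ : Submodule K G} (h : IsCompl g₁ g₂)

/-- A left inverse of the inclusion of `C*(g₂, g₁)` into the functionals on the exterior algebra. -/
noncomputable def unlift : ExtHom K G (HomSpace K G G) →ₗ[K] SubTotal g₁ g₂ :=
  LinearMap.leftInverse (V := SubTotal g₁ g₂) (liftT h)

omit [CharZero K] in
theorem unlift_liftT (f : SubTotal g₁ g₂) : unlift h (liftT h f) = f :=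
  LinearMap.leftInverse_apply_of_inj (V := SubTotal g₁ g₂)
    (LinearMap.ker_eq_bot_of_injective (liftT_injective h)) f

/-- The higher derived brackets on `C*(g₂, g₁)`. -/
noncomputable def higherBracket (k : ℕ) :
    MultilinearMap K (fun _ : Fin k => SubTotal g₁ g₂) (SubTotal g₁ g₂) :=
  (unlift h).compMultilinearMap
    (((mn K G).iter k (toT 1 (component h k))).compLinearMap fun _ => liftT h)

theorem higherBracket_apply {k : ℕ} (x : Fin k → SubTotal g₁ g₂) :
    higherBracket h k x =
      unlift h ((mn K G).iter k (toT 1 (component h k)) fun i => liftT h (x i)) := rfl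

theorem higherBracket_eq_zero {k : ℕ} (hk : component h k = 0) : higherBracket h k = 0 := by
  refine MultilinearMap.ext fun x => ?_
  rw [higherBracket_apply, hk, map_zero, map_zero]
  exact map_zero _

section Homogeneous

variable {k : ℕ} {d : Fin k → ℤ} {x : Fin k → SubTotal g₁ g₂}
  (hx : ∀ i, x i ∈ subGrading g₁ g₂ (d i))

include hx

theorem higherBracket_mem : higherBracket h k x ∈ subGrading g₁ g₂ (∑ i, d i + 2 - k) := by
  obtain ⟨y, hy, hy'⟩ := exists_liftT_eq_iter h hx
  rwa [higherBracket_apply, ← hy', unlift_liftT]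

/-- On homogeneous arguments the iterated bracket lies in the image of `liftT`, so the arbitrarily
chosen left inverse `unlift` really inverts there. -/
theorem liftT_higherBracket : liftT h (higherBracket h k x) =
    (mn K G).iter k (toT 1 (component h k)) fun i => liftT h (x i) := by
  obtain ⟨y, hy, hy'⟩ := exists_liftT_eq_iter h hx
  rw [higherBracket_apply, ← hy', unlift_liftT]

theorem higherBracket_skew (σ : Equiv.Perm (Fin k)) :
    higherBracket h k (fun i => x (σ i)) = koszulSign d σ • higherBracket h k x := by
  have ha : ∀ i, (mn K G).IsPar ((d i - 1).natAbs) (liftT h (x i)) := fun i => isPar_liftT h (hx i)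
  have h1 := SuperLie.decSign_multi_perm (p := fun i => (d i - 1).natAbs)
    (a := fun i => liftT h (x i)) (neg_negOnePow_eq_chi d) (isPar_component h k) (y := id)
    ha (fun i j => br_liftT_liftT h (hx i) (hx j)) σ
  have h2 := SuperLie.iter_eq (p := fun i => (d i - 1).natAbs) (a := fun i => liftT h (x i))
    (toT 1 (component h k)) (y := id) ha
  have h3 := SuperLie.iter_eq (p := fun i => (d i - 1).natAbs) (a := fun i => liftT h (x i))
    (toT 1 (component h k)) (y := id ∘ σ) fun i => ha (σ i)
  rw [← h2, ← h3] at h1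
  have h4 := congrArg (unlift h) h1
  rw [LinearMap.map_smul_of_tower] at h4
  exact h4

end Homogeneous

theorem higherBracket_jacobi (hG : IsQuasiTwilled g₁ g₂) (n : ℕ) (d : Fin n → ℤ)
    (x : Fin n → SubTotal g₁ g₂) (hx : ∀ i, x i ∈ subGrading g₁ g₂ (d i)) :
    ∑ t : Fin n, (-1 : ℤ) ^ (t.val + 1) •
      ∑ σ ∈ unshuffles (twoBlocks (t.val + 1) : Fin n → ℕ), koszulSign d σ •
        higherBracket hG.isCompl (n - 1 - t.val + 1)
          (Fin.cons (higherBracket hG.isCompl (t.val + 1)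
              (fun a : Fin (t.val + 1) => x (σ ⟨a, by omega⟩)))
            (fun c : Fin (n - 1 - t.val) => x (σ ⟨t.val + 1 + c, by omega⟩))) = 0 := by
  -- Characteristic zero, used to pass from twice the Jacobi sum to the sum itself.
  have : NoZeroSMulDivisors ℕ (ExtHom K G (HomSpace K G G)) := ⟨fun {c X} hc => by
    rw [← Nat.cast_smul_eq_nsmul K] at hc
    simpa using smul_eq_zero.1 hc⟩
  have key := SuperLie.iter_jacobi (isPar_component hG.isCompl) (neg_negOnePow_eq_chi d)
    (fun i => isPar_liftT hG.isCompl (hx i))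
    (fun i I hI => multi_component_eq_zero hG.isCompl hx hI) (sum_br_component hG n)
  have h1 := congrArg (unlift hG.isCompl) key
  rw [map_zero, map_sum] at h1
  rw [← h1]
  refine Finset.sum_congr rfl fun t _ => ?_
  rw [map_zsmul, map_sum]
  congr 1
  refine Finset.sum_congr rfl fun σ _ => ?_
  rw [LinearMap.map_smul_of_tower, higherBracket_apply]
  congr 3
  funext i
  refine Fin.cases ?_ (fun i => ?_) i
  · rw [Fin.cons_zero, Fin.cons_zero, liftT_higherBracket _ fun i => hx _]
  · rw [Fin.cons_succ, Fin.cons_succ]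

/-- The higher derived brackets make `C*(g₂, g₁)` an L∞-algebra. -/
noncomputable def lInftyAlgebra (hG : IsQuasiTwilled g₁ g₂) :
    LInftyAlgebra K (E := SubTotal g₁ g₂) (subGrading g₁ g₂) where
  isInternal := grading_isInternal
  l := higherBracket hG.isCompl
  l_zero := higherBracket_eq_zero _ rfl
  l_mem _ _ _ hx := higherBracket_mem _ hx
  l_skew _ _ _ hx := higherBracket_skew _ hx
  jacobi := higherBracket_jacobi hG

theorem ofTotal_liftTotal_lInftyAlgebra (hG : IsQuasiTwilled g₁ g₂) {k : ℕ}
    {x : Fin k → SubTotal g₁ g₂}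
    (hx : ∀ i, ∃ (p : ℕ) (f : SubCochain g₁ g₂ p), x i = toTotal f) :
    ofTotal K G (liftTotal hG.isCompl ((lInftyAlgebra hG).l k x)) =
      (mn K G).iter k (toT 1 (component hG.isCompl k)) fun i => liftT hG.isCompl (x i) := by
  choose p f hf using hx
  exact liftT_higherBracket hG.isCompl (d := fun i => (p i : ℤ) + 1)
    fun i => hf i ▸ toTotal_mem_grading (f i)

theorem eps_pow_toT (n : ℕ) {p : ℕ} (f : PreLieCochain K G G p) :
    ((mn K G).eps ^ n) (toT p f) = (-1 : K) ^ (n * p) • toT p f := by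
  have hf : (mn K G).IsPar p (toT p f) := (isDeg_toT f).isPar
  rw [hf.eps_pow, units_smul_eq]

theorem liftTotal_lInftyAlgebra_one (hG : IsQuasiTwilled g₁ g₂) {p : ℕ} (f : SubCochain g₁ g₂ p) :
    liftTotal hG.isCompl ((lInftyAlgebra hG).l 1 ![toTotal f]) =
      toTotal (mnBracket (muHatTwo hG.isCompl) (lift hG.isCompl p f)) := by
  refine ofTotal_injective ?_
  rw [ofTotal_liftTotal_lInftyAlgebra hG (Fin.forall_fin_one.2 ⟨p, f, rfl⟩), ofTotal_toTotal,
    toT_mnBracket, SuperLie.iter_succ, SuperLie.iter_zero, Matrix.cons_val_zero, liftT_toTotal]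
  rfl

theorem liftTotal_lInftyAlgebra_two (hG : IsQuasiTwilled g₁ g₂) {p q : ℕ}
    (f₁ : SubCochain g₁ g₂ p) (f₂ : SubCochain g₁ g₂ q) :
    liftTotal hG.isCompl ((lInftyAlgebra hG).l 2 ![toTotal f₁, toTotal f₂]) =
      (-1 : K) ^ p • toTotal (mnBracket (mnBracket (muHatOne hG.isCompl) (lift hG.isCompl p f₁))
        (lift hG.isCompl q f₂)) := by
  refine ofTotal_injective ?_
  rw [ofTotal_liftTotal_lInftyAlgebra hG (Fin.forall_fin_two.2 ⟨⟨p, f₁, rfl⟩, ⟨q, f₂, rfl⟩⟩),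
    map_smul, ofTotal_toTotal, toT_mnBracket, toT_mnBracket, SuperLie.iter_succ,
    SuperLie.iter_succ, SuperLie.iter_zero]
  simp only [Fin.tail, Matrix.cons_val_zero, Fin.succ_zero_eq_one, Matrix.cons_val_one,
    liftT_toTotal, eps_pow_toT, map_smul, LinearMap.smul_apply, one_mul, pow_zero]
  rfl

theorem liftTotal_lInftyAlgebra_three (hG : IsQuasiTwilled g₁ g₂) {p q r : ℕ}
    (f₁ : SubCochain g₁ g₂ p) (f₂ : SubCochain g₁ g₂ q) (f₃ : SubCochain g₁ g₂ r) :
    liftTotal hG.isCompl ((lInftyAlgebra hG).l 3 ![toTotal f₁, toTotal f₂, toTotal f₃]) =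
      (-1 : K) ^ q • toTotal (mnBracket (mnBracket (mnBracket (phiHatOne hG.isCompl)
        (lift hG.isCompl p f₁)) (lift hG.isCompl q f₂)) (lift hG.isCompl r f₃)) := by
  refine ofTotal_injective ?_
  rw [ofTotal_liftTotal_lInftyAlgebra hG (Fin.forall_fin_succ.2 ⟨⟨p, f₁, rfl⟩,
      Fin.forall_fin_two.2 ⟨⟨q, f₂, rfl⟩, ⟨r, f₃, rfl⟩⟩⟩),
    map_smul, ofTotal_toTotal, toT_mnBracket, toT_mnBracket, toT_mnBracket, SuperLie.iter_succ,
    SuperLie.iter_succ, SuperLie.iter_succ, SuperLie.iter_zero]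
  -- The first argument is followed by two others and the second by one, so of `(-1)^{2p + q}` only
  -- `(-1)^q` remains.
  have h2 : (-1 : K) ^ (2 * p) = 1 := by rw [pow_mul, neg_one_sq, one_pow]
  have h3 : ![toTotal f₁, toTotal f₂, toTotal f₃] (Fin.succ 1) = toTotal f₃ := rfl
  simp only [Fin.tail, Matrix.cons_val_zero, Fin.succ_zero_eq_one, Matrix.cons_val_one, h3,
    liftT_toTotal, eps_pow_toT, map_smul, LinearMap.smul_apply, one_mul, pow_zero, one_smul, h2,
    Module.End.one_apply]
  rw [show component hG.isCompl (2 + 1) = phiHatOne hG.isCompl from rfl]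

theorem lInftyAlgebra_l_eq_zero (hG : IsQuasiTwilled g₁ g₂) {k : ℕ} (hk : 4 ≤ k) :
    (lInftyAlgebra hG).l k = 0 :=
  higherBracket_eq_zero hG.isCompl (component_of_four_le _ hk)

end HigherDerived

end ExtHom

/-- Since index `p` stands for `C^{p+1}`, the signs `(-1)^{m-1}` and `(-1)^{n-1}` appear as `(-1)^p`
and `(-1)^q`. Equality after lifting is also the claim that the right-hand sides are lifts. -/
theorem mainTheorem1 {K G : Type*} [Field K] [IsAlgClosed K] [CharZero K]
    [LeftPreLieRing G] [LeftPreLieAlgebra K G] [FiniteDimensional K G]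
    (g₁ g₂ : Submodule K G) (hG : IsQuasiTwilled g₁ g₂) :
    ∃ L : LInftyAlgebra K (grading K g₂ g₁),
      (∀ (p : ℕ) (f : PreLieCochain K g₂ g₁ p),
        liftTotal hG.isCompl (L.l 1 ![toTotal f]) =
          toTotal (mnBracket (muHatTwo hG.isCompl) (lift hG.isCompl p f))) ∧
      (∀ (p q : ℕ) (f₁ : PreLieCochain K g₂ g₁ p) (f₂ : PreLieCochain K g₂ g₁ q),
        liftTotal hG.isCompl (L.l 2 ![toTotal f₁, toTotal f₂]) =
          (-1 : K) ^ p • toTotal (mnBracket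
            (mnBracket (muHatOne hG.isCompl) (lift hG.isCompl p f₁)) (lift hG.isCompl q f₂))) ∧
      (∀ (p q r : ℕ) (f₁ : PreLieCochain K g₂ g₁ p) (f₂ : PreLieCochain K g₂ g₁ q)
        (f₃ : PreLieCochain K g₂ g₁ r),
        liftTotal hG.isCompl (L.l 3 ![toTotal f₁, toTotal f₂, toTotal f₃]) =
          (-1 : K) ^ q • toTotal (mnBracket (mnBracket
            (mnBracket (phiHatOne hG.isCompl) (lift hG.isCompl p f₁)) (lift hG.isCompl q f₂))
              (lift hG.isCompl r f₃))) ∧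
      ∀ k : ℕ, 4 ≤ k → L.l k = 0 := by
  refine ⟨ExtHom.lInftyAlgebra hG, fun p f => ?_, fun p q f₁ f₂ => ?_, fun p q r f₁ f₂ f₃ => ?_,
    fun k hk => ExtHom.lInftyAlgebra_l_eq_zero hG hk⟩
  · convert ExtHom.liftTotal_lInftyAlgebra_one hG f using 1
  · convert ExtHom.liftTotal_lInftyAlgebra_two hG f₁ f₂ using 1
  · convert ExtHom.liftTotal_lInftyAlgebra_three hG f₁ f₂ f₃ using 1
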